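/- **Setting.** Let $N\ge 1$ be an integer, $\mathsf x,\mathsf y\in\{0,1\}$, $\eta,\omega\in\mathbb C$ with $\operatorname{Im}\omega>0$, $\xi_1,\dots,\xi_N\in\mathbb C$, and put $\Gamma=\pi\mathbb Z+\pi\omega\mathbb Z$, $$\theta(z)=-i\sum_{k\in\mathbb Z}(-1)^k e^{i\pi\omega(k+\frac12)^2}e^{2i(k+\frac12)z},\qquad t_0=-\tfrac{\eta}{2}N+\mathsf x\tfrac{\pi}{2}+\mathsf y\tfrac{\pi}{2}\omega .$$ Assume that the crossing parameter $\eta$ is generic in the sense that $\eta\notin\Gamma$ and $t_0+k\eta\notin\Gamma$ for all $k\in\mathbb Z$. (This forces $(\mathsf x,\mathsf y)\ne(0,0)$ when $N$ is even; if $(\mathsf x,\mathsf y)\neq(0,0)$ or $N$ is odd, it holds whenever $\eta\notin\pi\mathbb Q+\pi\omega\mathbb Q$.) Let $a(\lambda)=\theta(\lambda+\eta)$, $b(\lambda|t)=\theta(\lambda)\theta(t+\eta)/\theta(t)$, $c(\lambda|t)=\theta(\eta)\theta(t+\lambda)/\theta(t)$, and let $$R(\lambda|t)=\begin{pmatrix}a(\lambda)&0&0&0\\0&e^{i\mathsf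 y\eta}b(\lambda|t)&e^{i\mathsf y\lambda}c(\lambda|t)&0\\0&e^{-i\mathsf y\lambda}c(\lambda|-t)&e^{-i\mathsf y\eta}b(\lambda|-t)&0\\0&0&0&a(\lambda)\end{pmatrix}\in\operatorname{End}(\mathbb C^2\otimes\mathbb C^2).$$ On $V_0\otimes V_1\otimes\cdots\otimes V_N$, $V_n=\mathbb C^2$, let $$\mathsf M_0(\lambda|t)=R_{0,N}\Big(\lambda-\xi_N\Big|t+\eta\sum_{m=1}^{N-1}\sigma^z_m\Big)\cdots R_{0,1}(\lambda-\xi_1|t)=\begin{pmatrix}\mathsf A(\lambda|t)&\mathsf B(\lambda|t)\\ \mathsf C(\lambda|t)&\mathsf D(\lambda|t)\end{pmatrix}_{[0]} .$$ Let $\mathbb D^{\mathcal R}$ be the space with basis $|h_1,\dots,h_N\rangle\otimes|t(k)\rangle$, $h_n\in\{0,1\}$, $k\in\mathbb Z$, where $\sigma_n^z$ has eigenvalue $1-2h_n$, $\tau|t(k)\rangle=t(k)|t(k)\rangle$ with $t(k)=t_0-\eta k$, and $\mathsf T_\tau^{\pm}|t(k)\rangle=|t(k\pm1)\rangle$. Let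 $\mathbb D^{\mathcal L}$ be its restricted dual, i.e. the span of the dual basis, on which operators act from the right. Put $\mathcal B(\lambda)=\mathsf B(\lambda|\tau)\mathsf T^-_\tau$, $\mathcal C(\lambda)=\mathsf C(\lambda|\tau)\mathsf T^+_\tau$ and, for $\kappa\in\mathbb C\setminus\{0\}$, $$\overline{\mathcal T}^{(\kappa)}(\lambda)=\kappa^{-1}\mathcal B(\lambda)+\kappa\,\mathcal C(\lambda).$$ Let $\bar{\mathbb D}^{(0,\mathcal R)}$ and $\bar{\mathbb D}^{(0,\mathcal L)}$ be the eigenspaces of $\eta\sum_n\sigma_n^z+2\tau$ in $\mathbb D^{\mathcal R}$ and $\mathbb D^{\mathcal L}$ for the eigenvalue $\mathsf x\pi+\mathsf y\pi\omega$. An *eigenvalue* of $\overline{\mathcal T}^{(\kappa)}(\lambda)$ on one of these spaces is a function $\bar{\mathsf t}:\mathbb C\to\mathbb C$ for which there is a non-zero vector (covector) of that space, independent of $\lambda$, that is an eigenvector of $\overline{\mathcal T}^{(\kappa)}(\lambda)$ with eigenvalue $\bar{\mathsf t}(\lambda)$ for all $\lambda\in\mathbb C$. The *eigenspace* of $\bar{\mathsf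 t}$ consists of all such vectors, and $0$. Finally let $$\mathsf a(\lambda)=\prod_{n=1}^N a(\lambda-\xi_n),\quad \mathsf d(\lambda)=\mathsf a(\lambda-\eta),\quad \mathsf a_{\mathsf x,\mathsf y}(\lambda)=(-1)^{\mathsf x+\mathsf y+\mathsf x\mathsf y}\mathsf a(\lambda).$$ For $\mathbf h\in\{0,1\}^N$ and a fixed normalization constant $\nu\neq0$ define the SOV states $$\langle 0,\mathbf h|=\tfrac1\nu\,\big(\langle 0,\dots,0|\otimes\langle t(0)|\big)\prod_{n=1}^N\Big(\frac{\mathcal C(\xi_n)}{\mathsf d(\xi_n-\eta)}\Big)^{h_n},\qquad |\mathbf h,0\rangle=\tfrac1\nu\prod_{n=1}^N\Big(\frac{\mathcal C(\xi_n-\eta)}{\mathsf d(\xi_n-\eta)}\Big)^{1-h_n}\big(|1,\dots,1\rangle\otimes|t(-N)\rangle\big)$$ (products ordered with $n$ increasing from left to right), and the $N\times N$ matrix $\Theta^{(0,\mathbf h)}$ with entries $[\Theta^{(0,\mathbf h)}]_{ij}=\vartheta_{j-1}\big(\xi_i-\eta h_i-\tfrac1N(\sum_k\xi_k+t_0)\big)$,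 where $$\vartheta_j(\lambda)=\sum_{n\in\mathbb Z}e^{i\pi N\omega(n+\frac12-\frac jN)^2+2iN(n+\frac12-\frac jN)(\lambda-\frac\pi2)} .$$ **Theorem.** The spaces $\bar{\mathbb D}^{(0,\mathcal L)}$ and $\bar{\mathbb D}^{(0,\mathcal R)}$ have dimension $2^N$. 1. For every $\kappa\ne0$, the operators $\overline{\mathcal T}^{(\kappa)}(\lambda)$, $\lambda\in\mathbb C$, preserve $\bar{\mathbb D}^{(0,\mathcal L)}$ and $\bar{\mathbb D}^{(0,\mathcal R)}$ and commute with each other on these spaces. 2. The set of eigenvalues of $\overline{\mathcal T}^{(\kappa)}(\lambda)$ is the same for all $\kappa\in\mathbb C\setminus\{0\}$, and the same on $\bar{\mathbb D}^{(0,\mathcal L)}$ as on $\bar{\mathbb D}^{(0,\mathcal R)}$. Denote it by $\Sigma_{\overline{\mathcal T}}$. 3. Suppose that $\xi_a-\xi_b+\epsilon\eta\notin\Gamma$ for all $a\ne b$ and $\epsilon\in\{-1,0,1\}$. Then, for every $\kappa\neq0$, the spectrum of $\overline{\mathcal T}^{(\kappa)}(\lambda)$ in $\bar{\mathbb D}^{(0,\mathcal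 L)}$ and in $\bar{\mathbb D}^{(0,\mathcal R)}$ is simple, i.e. the eigenspace of each eigenvalue $\bar{\mathsf t}\in\Sigma_{\overline{\mathcal T}}$ is one-dimensional, and $\Sigma_{\overline{\mathcal T}}$ is exactly the set of functions of the form $$\bar{\mathsf t}(\lambda)=\sum_{a=1}^N e^{i\mathsf y(\xi_a-\lambda)}\,\frac{\theta(t_0-\lambda+\xi_a)}{\theta(t_0)}\prod_{b\ne a}\frac{\theta(\lambda-\xi_b)}{\theta(\xi_a-\xi_b)}\;\bar{\mathsf t}(\xi_a),\qquad (\bar{\mathsf t}(\xi_1),\dots,\bar{\mathsf t}(\xi_N))\in\mathbb C^N,$$ which satisfy $$\bar{\mathsf t}(\xi_a)\,\bar{\mathsf t}(\xi_a-\eta)=(-1)^{\mathsf x+\mathsf y+\mathsf x\mathsf y}\,\mathsf a(\xi_a)\,\mathsf d(\xi_a-\eta),\qquad a=1,\dots,N .$$ 4. Under the condition of 3, let $\bar{\mathsf t}\in\Sigma_{\overline{\mathcal T}}$. Then the numbers $\bar{\mathsf t}(\xi_a-\eta)$, $\mathsf d(\xi_a-\eta)$ and $\mathsf a_{\mathsf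 x,\mathsf y}(\xi_a)$ are non-zero and $\mathsf d(\xi_a-\eta)/\bar{\mathsf t}(\xi_a-\eta)=\bar{\mathsf t}(\xi_a)/\mathsf a_{\mathsf x,\mathsf y}(\xi_a)$. For any numbers $\mathsf q_a^{(0)}\ne0$ and $\mathsf q_a^{(1)}$ with $$\frac{\mathsf q_a^{(1)}}{\mathsf q_a^{(0)}}=\frac{\mathsf d(\xi_a-\eta)}{\bar{\mathsf t}(\xi_a-\eta)}=\frac{\bar{\mathsf t}(\xi_a)}{\mathsf a_{\mathsf x,\mathsf y}(\xi_a)},\qquad a=1,\dots,N,$$ and for every $\kappa\ne0$, the right and left eigenspaces of $\bar{\mathsf t}$ are spanned by the non-zero states $$|\Psi^{(\kappa)}_{\bar{\mathsf t}}\rangle=\sum_{\mathbf h\in\{0,1\}^N}\prod_{a=1}^N\bigg[\Big(\kappa^{-1}e^{i\mathsf y\eta}\frac{\mathsf a_{\mathsf x,\mathsf y}(\xi_a)}{\mathsf d(\xi_a-\eta)}\Big)^{h_a}\mathsf q_a^{(h_a)}\bigg]\det\big[\Theta^{(0,\mathbf h)}\big]\,|\mathbf h,0\rangle,$$ $$\langle\Psi^{(\kappa)}_{\bar{\mathsf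 t}}|=\sum_{\mathbf h\in\{0,1\}^N}\prod_{a=1}^N\Big[\big(\kappa\,e^{i\mathsf y\eta}\big)^{h_a}\mathsf q_a^{(h_a)}\Big]\det\big[\Theta^{(0,\mathbf h)}\big]\,\langle 0,\mathbf h| .$$ -/

import Mathlib

open scoped BigOperators

/-! The dynamical six-vertex model with antiperiodic boundary conditions. -/

namespace SOS

noncomputable section

/-- The theta function `θ₁(z|ω)` with quasi-periods `π` and `πω`. -/
def theta (ω z : ℂ) : ℂ :=
  -Complex.I * ∑' k : ℤ, (-1 : ℂ) ^ k *
    Complex.exp (Complex.I * Real.pi * ω * ((k : ℂ) + 1 / 2) ^ 2) *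
    Complex.exp (2 * Complex.I * ((k : ℂ) + 1 / 2) * z)

/-- The lattice `Γ = πℤ + πωℤ`. -/
def periodLattice (ω : ℂ) : Set ℂ :=
  {z | ∃ m n : ℤ, z = (m : ℂ) * Real.pi + (n : ℂ) * Real.pi * ω}

/-- The numerical parameters of the model: the number of sites `N`, the labels `x, y ∈ {0,1}`,
the modular parameter `ω`, the crossing parameter `η`, and the inhomogeneities `ξ`. -/
structure Model where
  N : ℕ
  x : ℕ
  y : ℕ
  ω : ℂ
  η : ℂ
  ξ : Fin N → ℂ

namespace Model

variable (P : Model)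

/-- `t₀ = -ηN/2 + xπ/2 + yπω/2`. -/
def t0 : ℂ := -(P.η / 2) * P.N + P.x * (Real.pi / 2) + P.y * (Real.pi / 2) * P.ω

/-- The eigenvalue `t(a) = -ηa + t₀` of `τ` on `|t(a)⟩`. -/
def tval (a : ℤ) : ℂ := -P.η * a + P.t0

/-! ### The dynamical R-matrix -/

/-- The Boltzmann weight `a`. -/
def wa (u : ℂ) : ℂ := theta P.ω (u + P.η)

/-- The Boltzmann weight `b`. -/
def wb (u t : ℂ) : ℂ := theta P.ω u * theta P.ω (t + P.η) / theta P.ω t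

/-- The Boltzmann weight `c`. -/
def wc (u t : ℂ) : ℂ := theta P.ω P.η * theta P.ω (t + u) / theta P.ω t

/-- The dynamical `R`-matrix on `ℂ² ⊗ ℂ²`, written in the basis `(0,0), (0,1), (1,0), (1,1)`,
where the index `h` stands for the eigenvalue `1 - 2h` of `σᶻ`. -/
def R (u t : ℂ) : Matrix (Fin 2 × Fin 2) (Fin 2 × Fin 2) ℂ :=
  (!![P.wa u, 0, 0, 0;
      0, Complex.exp (Complex.I * P.y * P.η) * P.wb u t,
        Complex.exp (Complex.I * P.y * u) * P.wc u t, 0;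
      0, Complex.exp (-Complex.I * P.y * u) * P.wc u (-t),
        Complex.exp (-Complex.I * P.y * P.η) * P.wb u (-t), 0;
      0, 0, 0, P.wa u] : Matrix (Fin (2 * 2)) (Fin (2 * 2)) ℂ).submatrix
    finProdFinEquiv finProdFinEquiv

/-! ### The monodromy matrix -/

/-- Labels `h ∈ {0,1}^N` of the spin basis of the quantum space. -/
abbrev Conf : Type := Fin P.N → Fin 2

/-- The eigenvalue `1 - 2h` of `σᶻ`. -/
def sz (h : Fin 2) : ℂ := 1 - 2 * ((h : ℕ) : ℂ)

/-- `R_{0,n}(u - ξ_n | t + η ∑_{m<n} σ_mᶻ)` on (auxiliary space) ⊗ (quantum space). -/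
def siteR (u t : ℂ) (n : Fin P.N) : Matrix (Fin 2 × P.Conf) (Fin 2 × P.Conf) ℂ :=
  Matrix.of fun p q =>
    if ∀ m, m ≠ n → p.2 m = q.2 m then
      P.R (u - P.ξ n) (t + P.η * ∑ m ∈ Finset.univ.filter (fun m => m < n), sz (q.2 m))
        (p.1, p.2 n) (q.1, q.2 n)
    else 0

/-- The monodromy matrix, the ordered product of the factors with the last site leftmost. -/
def monodromy (u t : ℂ) : Matrix (Fin 2 × P.Conf) (Fin 2 × P.Conf) ℂ :=
  ((List.ofFn fun n => P.siteR u t n).reverse).prod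

/-- The entry `B(u|t)` of the monodromy matrix. -/
def opB (u t : ℂ) : Matrix P.Conf P.Conf ℂ :=
  Matrix.of fun h k => P.monodromy u t (0, h) (1, k)

/-- The entry `C(u|t)` of the monodromy matrix. -/
def opC (u t : ℂ) : Matrix P.Conf P.Conf ℂ :=
  Matrix.of fun h k => P.monodromy u t (1, h) (0, k)

/-! ### The dynamical-spin space and its operators -/

/-- The right representation space; `Finsupp.single (h, a) 1` is `(⊗ₙ |n,hₙ⟩) ⊗ |t(a)⟩`. -/
abbrev Space : Type := (P.Conf × ℤ) →₀ ℂ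

/-- The operator `F(τ)` obtained by substituting the operator `τ` for the dynamical parameter in a
`t`-dependent operator `F(t)` of the quantum space. -/
def substTau (F : ℂ → Matrix P.Conf P.Conf ℂ) : Module.End ℂ P.Space :=
  Finsupp.linearCombination ℂ fun p : P.Conf × ℤ =>
    ∑ h : P.Conf, Finsupp.single (h, p.2) (F (P.tval p.2) h p.1)

/-- The shift `|h⟩ ⊗ |t(a)⟩ ↦ |h⟩ ⊗ |t(a+s)⟩`; the cases `s = 1` and `s = -1` are the dynamical
operators `T_τ⁺` and `T_τ⁻`. -/
def shiftT (s : ℤ) : Module.End ℂ P.Space :=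
  Finsupp.lmapDomain ℂ ℂ fun p : P.Conf × ℤ => (p.1, p.2 + s)

/-- The operator `τ`. -/
def tau : Module.End ℂ P.Space := P.substTau fun t => t • (1 : Matrix P.Conf P.Conf ℂ)

/-- The total spin `S = ∑ₙ σₙᶻ`. -/
def spin : Module.End ℂ P.Space :=
  P.substTau fun _ => Matrix.diagonal fun h => ∑ n, sz (h n)

/-- `S_τ = ηS + 2τ`. -/
def spinTau : Module.End ℂ P.Space := P.η • P.spin + (2 : ℂ) • P.tau

/-- `𝓑(u) = B(u|τ) T_τ⁻`. -/
def calB (u : ℂ) : Module.End ℂ P.Space := P.substTau (P.opB u) * P.shiftT (-1)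

/-- `𝓒(u) = C(u|τ) T_τ⁺`. -/
def calC (u : ℂ) : Module.End ℂ P.Space := P.substTau (P.opC u) * P.shiftT 1

/-- The `κ`-twisted antiperiodic transfer matrix `κ⁻¹ 𝓑(u) + κ 𝓒(u)`. Its action on covectors is
given by `LinearMap.dualMap`, that is, `⟨φ| T = φ ∘ T`. -/
def transfer (κ u : ℂ) : Module.End ℂ P.Space := κ⁻¹ • P.calB u + κ • P.calC u

/-! ### The antiperiodic spaces of states -/

/-- The eigenvalue `xπ + yπω` of `S_τ`. -/
def sector : ℂ := P.x * Real.pi + P.y * Real.pi * P.ω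

/-- The space of states of the antiperiodic model (right). -/
def rightSpace : Submodule ℂ P.Space := Module.End.eigenspace P.spinTau P.sector

/-- The covector `(⊗ₙ ⟨n,hₙ|) ⊗ ⟨t(a)|`. -/
def bra (p : P.Conf × ℤ) : Module.Dual ℂ P.Space := Finsupp.lapply p

/-- The space of states of the antiperiodic model (left): the covectors of the restricted dual
(the span of the dual dynamical-spin basis) with eigenvalue `xπ + yπω` of `S_τ`. -/
def leftSpace : Submodule ℂ (Module.Dual ℂ P.Space) :=
  Submodule.span ℂ (Set.range P.bra) ⊓ Module.End.eigenspace P.spinTau.dualMap P.sector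

/-- The common eigenspace, in the right space of states, of the operators `transfer κ u`, `u ∈ ℂ`,
for the eigenvalue function `t`. -/
def rightEigenspace (κ : ℂ) (t : ℂ → ℂ) : Submodule ℂ P.Space :=
  P.rightSpace ⊓ ⨅ u : ℂ, Module.End.eigenspace (P.transfer κ u) (t u)

/-- The common eigenspace, in the left space of states, of the operators `transfer κ u`, `u ∈ ℂ`,
for the eigenvalue function `t`. -/
def leftEigenspace (κ : ℂ) (t : ℂ → ℂ) : Submodule ℂ (Module.Dual ℂ P.Space) :=
  P.leftSpace ⊓ ⨅ u : ℂ, Module.End.eigenspace (P.transfer κ u).dualMap (t u)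

/-- The set of eigenvalue functions on the right space of states. -/
def rightSpectrum (κ : ℂ) : Set (ℂ → ℂ) := {t | P.rightEigenspace κ t ≠ ⊥}

/-- The set of eigenvalue functions on the left space of states. -/
def leftSpectrum (κ : ℂ) : Set (ℂ → ℂ) := {t | P.leftEigenspace κ t ≠ ⊥}

/-! ### The SOV states -/

/-- The function `𝖺(u) = ∏ₙ a(u - ξₙ)`. -/
def fa (u : ℂ) : ℂ := ∏ n, P.wa (u - P.ξ n)

/-- The function `𝖽(u) = 𝖺(u - η)`. -/
def fd (u : ℂ) : ℂ := P.fa (u - P.η)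

/-- The function `𝖺_{x,y}(u) = (-1)^{x+y+xy} 𝖺(u)`. -/
def faxy (u : ℂ) : ℂ := (-1) ^ (P.x + P.y + P.x * P.y) * P.fa u

/-- The left reference state: all `hₙ = 0`, dynamical parameter `t(0) = t₀`, normalization `ν⁻¹`. -/
def leftRef (ν : ℂ) : Module.Dual ℂ P.Space := ν⁻¹ • P.bra (fun _ => 0, 0)

/-- The right reference state: all `hₙ = 1`, dynamical parameter `t(-N) = t₀ + Nη`,
normalization `ν⁻¹`. -/
def rightRef (ν : ℂ) : P.Space := ν⁻¹ • Finsupp.single (fun _ => 1, -(P.N : ℤ)) 1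

/-- The left SOV state `⟨0,h| = ⟨0,𝟎| ∏ₙ (𝓒(ξₙ) / 𝖽(ξₙ - η))^{hₙ}`. -/
def leftState (ν : ℂ) (h : P.Conf) : Module.Dual ℂ P.Space :=
  (P.leftRef ν).comp
    (List.ofFn fun n => ((P.fd (P.ξ n - P.η))⁻¹ • P.calC (P.ξ n)) ^ (h n : ℕ)).prod

/-- The right SOV state `|h,0⟩ = ∏ₙ (𝓒(ξₙ - η) / 𝖽(ξₙ - η))^{1-hₙ} |𝟏,0⟩`. -/
def rightState (ν : ℂ) (h : P.Conf) : P.Space :=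
  (List.ofFn fun n =>
    ((P.fd (P.ξ n - P.η))⁻¹ • P.calC (P.ξ n - P.η)) ^ (1 - (h n : ℕ))).prod (P.rightRef ν)

/-- The theta functions `ϑ_j`, `0 ≤ j ≤ N - 1`, of order `N`. -/
def vartheta (j : ℕ) (u : ℂ) : ℂ :=
  ∑' n : ℤ, Complex.exp
    (Complex.I * Real.pi * P.N * P.ω * ((n : ℂ) + 1 / 2 - j / P.N) ^ 2 +
      2 * Complex.I * P.N * ((n : ℂ) + 1 / 2 - j / P.N) * (u - Real.pi / 2))

/-- The matrix `Θ^{(0,h)}` with entries `ϑ_{j-1}(ξ_i^{(h_i)} - ξ̄₀)` (here `j` starts at `0`), where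
`ξ_i^{(h)} = ξ_i - ηh` and `ξ̄₀ = (∑ₖ ξₖ + t₀) / N`. -/
def Theta (h : P.Conf) : Matrix (Fin P.N) (Fin P.N) ℂ :=
  Matrix.of fun i j =>
    P.vartheta j (P.ξ i - P.η * ((h i : ℕ) : ℂ) - (∑ k, P.ξ k + P.t0) / P.N)

/-- The factorized right state with coefficients `q`. -/
def rightPsi (ν κ : ℂ) (q : Fin P.N → Fin 2 → ℂ) : P.Space :=
  ∑ h : P.Conf,
    ((∏ a, (κ⁻¹ * Complex.exp (Complex.I * P.y * P.η) *
        (P.faxy (P.ξ a) / P.fd (P.ξ a - P.η))) ^ (h a : ℕ) * q a (h a)) *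
      (P.Theta h).det) • P.rightState ν h

/-- The factorized left state with coefficients `q`. -/
def leftPsi (ν κ : ℂ) (q : Fin P.N → Fin 2 → ℂ) : Module.Dual ℂ P.Space :=
  ∑ h : P.Conf,
    ((∏ a, (κ * Complex.exp (Complex.I * P.y * P.η)) ^ (h a : ℕ) * q a (h a)) *
      (P.Theta h).det) • P.leftState ν h

/-! ### The conditions of the statement -/

/-- The condition on the inhomogeneities: `ξ_a - ξ_b + εη ∉ Γ` for `a ≠ b` and `ε ∈ {-1,0,1}`. -/
def InhomogeneityCondition : Prop :=
  ∀ a b : Fin P.N, a ≠ b → ∀ ε : ℤ, ε = -1 ∨ ε = 0 ∨ ε = 1 →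
    P.ξ a - P.ξ b + ε * P.η ∉ periodLattice P.ω

/-- The functions of the theta-interpolated form (note `t_{0,𝟎} = t₀`) which satisfy the discrete
system of equations. -/
def discreteSolutions : Set (ℂ → ℂ) :=
  {t | (∀ u, t u = ∑ a, Complex.exp (Complex.I * P.y * (P.ξ a - u)) *
          (theta P.ω (P.t0 - u + P.ξ a) / theta P.ω P.t0) *
          (∏ b ∈ Finset.univ.erase a,
            theta P.ω (u - P.ξ b) / theta P.ω (P.ξ a - P.ξ b)) * t (P.ξ a)) ∧
      ∀ a, t (P.ξ a) * t (P.ξ a - P.η) =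
        (-1) ^ (P.x + P.y + P.x * P.y) * P.fa (P.ξ a) * P.fd (P.ξ a - P.η)}

end Model

end

end SOS

/-! ### The theta series: quasi-periods, parity, addition formula, non-vanishing. -/

namespace SOS
noncomputable section

open Complex

/-! The operator `η S + 2τ` is diagonal, and since `η ≠ 0` its chosen eigenspace consists of the
states `|h⟩ ⊗ |t(-deg h)⟩`, one for each configuration. Hence the dimension is `2^N`, and the
transfer matrix becomes a `2^N × 2^N` matrix `transferMatrix`. The value `tconf h` of the dynamical
parameter on this sector is such that transport through the chain turns `t` into `-(t - sector)`,
where `sector` is a period. The `R`-matrix is invariant under simultaneous spin flip and this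
reflection (`R_flip`). Multiplying the exchange relation `R_mul_pathTwo` by the flip and taking a
trace gives commutativity (`sum_pathTwo_comm`).

Changing `κ` is conjugation by the diagonal matrix `(κ/κ')^deg`, since `𝓑` and `𝓒` change the degree
by one in opposite directions. Left and right spectra agree because joint eigenvectors and joint
eigencovectors of a commuting family in finite dimension have the same eigenvalue functions; this is
Nakayama's lemma (`exists_dual_of_smul_eq_zero`) and needs no simplicity.

For the discrete system there are two inputs. First, all entries of the transfer matrix lie in one
space of theta functions of order `N`, so they are determined by interpolation at `N` nodes `ξ_a - η
h_a`, for any choice of `h` (`sum_node_add`, `interpolation`). Second, fusion: the two-row matrix at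
`(ξ_a, ξ_a - η)` projects onto the singlet, so `T(ξ_a) T(ξ_a - η)` is the scalar `faxy(ξ_a) fd(ξ_a -
η)` (`transferMatrix_mul_fused`), while `𝓒(ξ_a) 𝓒(ξ_a - η) = 0`. These two facts force the asserted
form and the equations on every eigenvalue.

Conversely, the left SOV covector of `h` is annihilated by `𝓑(ξ_b)` when `h_b = 0`. Thus `T(ξ_b)`
switches `h_b` from `0` to `1`, and by fusion `T(ξ_b - η)` switches it back. The components of an
eigenvector along these covectors then form a product over the sites, unique up to a scalar. For a
solution of the discrete system, interpolation at the nodes of `h` shows that the vector with these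
components is an eigenvector for every spectral parameter (`eigenvector_of_dotProduct`). The right
SOV states are dual to the left ones up to non-zero factors, and these factors obey the inverse of
the recursion of `det Θ` (`pairing_self`, `det_Theta_update`); this puts the determinants into the
eigenstates.

All theta identities rest on the three-term Weierstrass relation, and the theory of zeros and
interpolation on that relation together with Liouville's theorem. -/

theorem theta_eq_jacobiTheta₂ (ω z : ℂ) :
    theta ω z = -I * exp (I * Real.pi * ω / 4 + I * z) *
      jacobiTheta₂ (z / Real.pi + ω / 2 + 1 / 2) ω := by
  have hpi : (Real.pi : ℂ) ≠ 0 := by exact_mod_cast Real.pi_ne_zero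
  have h : ∀ k : ℤ, (-1 : ℂ) ^ k * exp (I * Real.pi * ω * ((k : ℂ) + 1 / 2) ^ 2) *
      exp (2 * I * ((k : ℂ) + 1 / 2) * z) = exp (I * Real.pi * ω / 4 + I * z) *
        jacobiTheta₂_term k (z / Real.pi + ω / 2 + 1 / 2) ω := by
    intro k
    have h1 : (-1 : ℂ) ^ k = exp (k * (Real.pi * I)) := by
      rw [exp_int_mul, exp_pi_mul_I]
    rw [h1, jacobiTheta₂_term, ← exp_add, ← exp_add, ← exp_add]
    congr 1
    field_simp
    ring
  rw [theta]
  simp_rw [h, tsum_mul_left]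
  rw [jacobiTheta₂, ← mul_assoc (-I)]

theorem differentiable_theta {ω : ℂ} (hω : 0 < ω.im) : Differentiable ℂ (theta ω) := by
  have h : theta ω = fun z => -I * exp (I * Real.pi * ω / 4 + I * z) *
      jacobiTheta₂ (z / Real.pi + ω / 2 + 1 / 2) ω := funext (theta_eq_jacobiTheta₂ ω)
  rw [h]
  intro z
  refine DifferentiableAt.mul (by fun_prop) ?_
  exact DifferentiableAt.comp (g := fun w => jacobiTheta₂ w ω) z
    (differentiableAt_jacobiTheta₂_fst _ hω) (by fun_prop)

theorem theta_add_pi (ω z : ℂ) : theta ω (z + Real.pi) = -theta ω z := by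
  have hpi : (Real.pi : ℂ) ≠ 0 := by exact_mod_cast Real.pi_ne_zero
  rw [theta_eq_jacobiTheta₂, theta_eq_jacobiTheta₂]
  have h1 : (z + Real.pi) / Real.pi + ω / 2 + 1 / 2 = (z / Real.pi + ω / 2 + 1 / 2) + 1 := by
    field_simp; ring
  have h2 : I * Real.pi * ω / 4 + I * (z + Real.pi) =
      (I * Real.pi * ω / 4 + I * z) + Real.pi * I := by ring
  rw [h1, jacobiTheta₂_add_left, h2, exp_add, exp_pi_mul_I]
  ring

theorem theta_add_pi_mul (ω z : ℂ) : theta ω (z + Real.pi * ω) =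
    -exp (-(I * Real.pi * ω) - 2 * I * z) * theta ω z := by
  have hpi : (Real.pi : ℂ) ≠ 0 := by exact_mod_cast Real.pi_ne_zero
  rw [theta_eq_jacobiTheta₂, theta_eq_jacobiTheta₂]
  have h1 : (z + Real.pi * ω) / Real.pi + ω / 2 + 1 / 2 =
      (z / Real.pi + ω / 2 + 1 / 2) + ω := by
    field_simp
    ring
  have h2 : -exp (-(I * Real.pi * ω) - 2 * I * z) =
      exp (-(I * Real.pi * ω) - 2 * I * z + Real.pi * I) := by
    rw [exp_add _ (Real.pi * I), exp_pi_mul_I]; ring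
  have h3 : exp (I * Real.pi * ω / 4 + I * (z + Real.pi * ω)) *
      exp (-Real.pi * I * (ω + 2 * (z / Real.pi + ω / 2 + 1 / 2))) =
      exp (-(I * Real.pi * ω) - 2 * I * z + Real.pi * I) *
        exp (I * Real.pi * ω / 4 + I * z) := by
    rw [← exp_add, ← exp_add]
    refine exp_eq_exp_iff_exists_int.mpr ⟨-1, ?_⟩
    field_simp
    push_cast
    ring
  rw [h1, jacobiTheta₂_add_left', h2]
  linear_combination (-I * jacobiTheta₂ (z / Real.pi + ω / 2 + 1 / 2) ω) * h3

theorem theta_neg (ω z : ℂ) : theta ω (-z) = -theta ω z := by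
  rw [theta, theta, ← (Equiv.subRight (0 : ℤ)).tsum_eq, ← mul_neg, ← tsum_neg,
    ← (Equiv.subLeft (-1 : ℤ)).tsum_eq]
  congr 1
  refine tsum_congr fun k => ?_
  simp only [Equiv.subLeft_apply, Equiv.subRight_apply, sub_zero]
  have h1 : (-1 : ℂ) ^ (-1 - k : ℤ) = -(-1 : ℂ) ^ k := by
    rw [zpow_sub₀ (by norm_num)]
    rcases Int.even_or_odd k with h | h
    · simp [h.neg_one_zpow]
    · simp [h.neg_one_zpow]
  rw [h1]
  push_cast
  rw [show ((-1 : ℂ) - k + 1 / 2) ^ 2 = (k + 1 / 2) ^ 2 by ring,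
    show 2 * I * ((-1 : ℂ) - k + 1 / 2) * -z = 2 * I * (k + 1 / 2) * z by ring]
  ring

theorem theta_zero (ω : ℂ) : theta ω 0 = 0 := by
  have h := theta_neg ω 0
  rw [neg_zero] at h
  linear_combination h / 2

/-- The even part of the order-two theta series. -/
def thetaEven (ω z : ℂ) : ℂ :=
  ∑' a : ℤ, exp (2 * I * Real.pi * ω * (a : ℂ) ^ 2 + 4 * I * a * z)

/-- The odd part of the order-two theta series. -/
def thetaOdd (ω z : ℂ) : ℂ :=
  ∑' a : ℤ, exp (2 * I * Real.pi * ω * ((a : ℂ) + 1 / 2) ^ 2 + 4 * I * (a + 1 / 2) * z)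

theorem hasSum_thetaEven {ω : ℂ} (hω : 0 < ω.im) (z : ℂ) :
    HasSum (fun a : ℤ => exp (2 * I * Real.pi * ω * (a : ℂ) ^ 2 + 4 * I * a * z))
      (thetaEven ω z) := by
  refine Summable.hasSum ?_
  have h := (summable_jacobiTheta₂_term_iff (2 * z / Real.pi) (2 * ω)).mpr (by simpa using hω)
  refine h.congr fun a => ?_
  have hpi : (Real.pi : ℂ) ≠ 0 := by exact_mod_cast Real.pi_ne_zero
  rw [jacobiTheta₂_term]
  congr 1
  field_simp
  ring

theorem thetaOdd_term (ω z : ℂ) (a : ℤ) :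
    exp (2 * I * Real.pi * ω * ((a : ℂ) + 1 / 2) ^ 2 + 4 * I * (a + 1 / 2) * z) =
      exp (I * Real.pi * ω / 2 + 2 * I * z) *
        jacobiTheta₂_term a (2 * z / Real.pi + ω) (2 * ω) := by
  have hpi : (Real.pi : ℂ) ≠ 0 := by exact_mod_cast Real.pi_ne_zero
  rw [jacobiTheta₂_term, ← exp_add]
  congr 1
  field_simp
  ring

theorem hasSum_thetaOdd {ω : ℂ} (hω : 0 < ω.im) (z : ℂ) :
    HasSum (fun a : ℤ => exp (2 * I * Real.pi * ω * ((a : ℂ) + 1 / 2) ^ 2 +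
      4 * I * (a + 1 / 2) * z)) (thetaOdd ω z) := by
  refine Summable.hasSum ?_
  simp_rw [thetaOdd_term]
  exact ((summable_jacobiTheta₂_term_iff _ (2 * ω)).mpr (by simpa using hω)).mul_left _

theorem differentiable_thetaEven {ω : ℂ} (hω : 0 < ω.im) : Differentiable ℂ (thetaEven ω) := by
  have hpi : (Real.pi : ℂ) ≠ 0 := by exact_mod_cast Real.pi_ne_zero
  have h : thetaEven ω = fun z => jacobiTheta₂ (2 * z / Real.pi) (2 * ω) := by
    funext z
    refine tsum_congr fun a => ?_
    rw [jacobiTheta₂_term]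
    congr 1
    field_simp
    ring
  rw [h]
  intro z
  exact DifferentiableAt.comp (g := fun w => jacobiTheta₂ w (2 * ω)) z
    (differentiableAt_jacobiTheta₂_fst _ (by simpa using hω)) (by fun_prop)

theorem differentiable_thetaOdd {ω : ℂ} (hω : 0 < ω.im) : Differentiable ℂ (thetaOdd ω) := by
  have h : thetaOdd ω = fun z => exp (I * Real.pi * ω / 2 + 2 * I * z) *
      jacobiTheta₂ (2 * z / Real.pi + ω) (2 * ω) := by
    funext z
    simp_rw [thetaOdd, thetaOdd_term, tsum_mul_left]
    rfl
  rw [h]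
  intro z
  refine DifferentiableAt.mul (by fun_prop) ?_
  exact DifferentiableAt.comp (g := fun w => jacobiTheta₂ w (2 * ω)) z
    (differentiableAt_jacobiTheta₂_fst _ (by simpa using hω)) (by fun_prop)

theorem hasSum_theta {ω : ℂ} (hω : 0 < ω.im) (z : ℂ) :
    HasSum (fun k : ℤ => -I * ((-1 : ℂ) ^ k * exp (I * Real.pi * ω * ((k : ℂ) + 1 / 2) ^ 2) *
      exp (2 * I * ((k : ℂ) + 1 / 2) * z))) (theta ω z) := by
  have hpi : (Real.pi : ℂ) ≠ 0 := by exact_mod_cast Real.pi_ne_zero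
  rw [theta]
  refine HasSum.mul_left _ (Summable.hasSum ?_)
  have h := ((summable_jacobiTheta₂_term_iff (z / Real.pi + ω / 2 + 1 / 2) ω).mpr hω).mul_left
    (exp (I * Real.pi * ω / 4 + I * z))
  refine h.congr fun k => ?_
  have h1 : (-1 : ℂ) ^ k = exp (k * (Real.pi * I)) := by
    rw [exp_int_mul, exp_pi_mul_I]
  rw [h1, jacobiTheta₂_term, ← exp_add, ← exp_add, ← exp_add]
  congr 1
  field_simp
  ring

/-- A pair of integers has coordinates of equal or of opposite parity. This splitting of the index
set separates a product of two theta series into products of series in the half-sum and the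
half-difference of the arguments. -/
theorem bijective_intPair_parity : Function.Bijective
    (Sum.elim (fun p => (p.1 + p.2, p.1 - p.2)) (fun p => (p.1 + p.2, p.1 - p.2 - 1)) :
      (ℤ × ℤ) ⊕ (ℤ × ℤ) → ℤ × ℤ) := by
  constructor
  · rintro (⟨a, b⟩ | ⟨a, b⟩) (⟨c, d⟩ | ⟨c, d⟩) h <;>
      simp only [Sum.elim_inl, Sum.elim_inr, Prod.mk.injEq] at h
    · congr 2 <;> omega
    · omega
    · omega
    · congr 2 <;> omega
  · rintro ⟨a, b⟩
    rcases Int.even_or_odd' (a - b) with ⟨c, h | h⟩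
    · exact ⟨Sum.inl (a - c, c), by simp only [Sum.elim_inl, Prod.mk.injEq]; omega⟩
    · exact ⟨Sum.inr (a - c, c), by simp only [Sum.elim_inr, Prod.mk.injEq]; omega⟩

/-- Parallelogram identity for exponents: `(k+l+1/2)² + (k-l+1/2)² = 2(k+1/2)² + 2l²`. The
opposite-parity case moves the half-integer from `k` to `l` and changes the sign. -/
theorem theta_term_mul_of_even (ω x y : ℂ) (k l : ℤ) :
    -I * ((-1 : ℂ) ^ (k + l) * exp (I * Real.pi * ω * (((k + l : ℤ) : ℂ) + 1 / 2) ^ 2) *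
        exp (2 * I * (((k + l : ℤ) : ℂ) + 1 / 2) * (x + y))) *
      (-I * ((-1 : ℂ) ^ (k - l) * exp (I * Real.pi * ω * (((k - l : ℤ) : ℂ) + 1 / 2) ^ 2) *
        exp (2 * I * (((k - l : ℤ) : ℂ) + 1 / 2) * (x - y)))) =
      -(exp (2 * I * Real.pi * ω * ((k : ℂ) + 1 / 2) ^ 2 + 4 * I * (k + 1 / 2) * x) *
        exp (2 * I * Real.pi * ω * (l : ℂ) ^ 2 + 4 * I * l * y)) := by
  have hs : (-1 : ℂ) ^ (k + l) * (-1) ^ (k - l) = 1 := by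
    rw [← zpow_add₀ (by norm_num)]
    exact Even.neg_one_zpow ⟨k, by ring⟩
  have e : exp (I * Real.pi * ω * (((k + l : ℤ) : ℂ) + 1 / 2) ^ 2) *
      exp (2 * I * (((k + l : ℤ) : ℂ) + 1 / 2) * (x + y)) *
      (exp (I * Real.pi * ω * (((k - l : ℤ) : ℂ) + 1 / 2) ^ 2) *
      exp (2 * I * (((k - l : ℤ) : ℂ) + 1 / 2) * (x - y))) =
      exp (2 * I * Real.pi * ω * ((k : ℂ) + 1 / 2) ^ 2 + 4 * I * (k + 1 / 2) * x) *
        exp (2 * I * Real.pi * ω * (l : ℂ) ^ 2 + 4 * I * l * y) := by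
    simp only [← exp_add]
    congr 1
    push_cast
    ring
  rw [← e]
  generalize exp (I * Real.pi * ω * (((k + l : ℤ) : ℂ) + 1 / 2) ^ 2) = A
  generalize exp (2 * I * (((k + l : ℤ) : ℂ) + 1 / 2) * (x + y)) = B
  generalize exp (I * Real.pi * ω * (((k - l : ℤ) : ℂ) + 1 / 2) ^ 2) = C
  generalize exp (2 * I * (((k - l : ℤ) : ℂ) + 1 / 2) * (x - y)) = D
  generalize (-1 : ℂ) ^ (k + l) = s at *
  generalize (-1 : ℂ) ^ (k - l) = t at *
  linear_combination (A * B * C * D) * (s * t * I_sq - hs)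

theorem theta_term_mul_of_odd (ω x y : ℂ) (k l : ℤ) :
    -I * ((-1 : ℂ) ^ (k + l) * exp (I * Real.pi * ω * (((k + l : ℤ) : ℂ) + 1 / 2) ^ 2) *
        exp (2 * I * (((k + l : ℤ) : ℂ) + 1 / 2) * (x + y))) *
      (-I * ((-1 : ℂ) ^ (k - l - 1) *
        exp (I * Real.pi * ω * (((k - l - 1 : ℤ) : ℂ) + 1 / 2) ^ 2) *
        exp (2 * I * (((k - l - 1 : ℤ) : ℂ) + 1 / 2) * (x - y)))) =
      exp (2 * I * Real.pi * ω * (k : ℂ) ^ 2 + 4 * I * k * x) *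
        exp (2 * I * Real.pi * ω * ((l : ℂ) + 1 / 2) ^ 2 + 4 * I * (l + 1 / 2) * y) := by
  have hs : (-1 : ℂ) ^ (k + l) * (-1) ^ (k - l - 1) = -1 := by
    rw [← zpow_add₀ (by norm_num)]
    exact Odd.neg_one_zpow ⟨k - 1, by ring⟩
  have e : exp (I * Real.pi * ω * (((k + l : ℤ) : ℂ) + 1 / 2) ^ 2) *
      exp (2 * I * (((k + l : ℤ) : ℂ) + 1 / 2) * (x + y)) *
      (exp (I * Real.pi * ω * (((k - l - 1 : ℤ) : ℂ) + 1 / 2) ^ 2) *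
      exp (2 * I * (((k - l - 1 : ℤ) : ℂ) + 1 / 2) * (x - y))) =
      exp (2 * I * Real.pi * ω * (k : ℂ) ^ 2 + 4 * I * k * x) *
        exp (2 * I * Real.pi * ω * ((l : ℂ) + 1 / 2) ^ 2 + 4 * I * (l + 1 / 2) * y) := by
    simp only [← exp_add]
    congr 1
    push_cast
    ring
  rw [← e]
  generalize exp (I * Real.pi * ω * (((k + l : ℤ) : ℂ) + 1 / 2) ^ 2) = A
  generalize exp (2 * I * (((k + l : ℤ) : ℂ) + 1 / 2) * (x + y)) = B
  generalize exp (I * Real.pi * ω * (((k - l - 1 : ℤ) : ℂ) + 1 / 2) ^ 2) = C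
  generalize exp (2 * I * (((k - l - 1 : ℤ) : ℂ) + 1 / 2) * (x - y)) = D
  generalize (-1 : ℂ) ^ (k + l) = s at *
  generalize (-1 : ℂ) ^ (k - l - 1) = t at *
  linear_combination (A * B * C * D) * (s * t * I_sq - hs)

theorem mul_eq_of_hasSum_parity {f g p q r s : ℤ → ℂ} {A B P Q R S : ℂ} (hf : HasSum f A)
    (hg : HasSum g B) (hp : HasSum p P) (hq : HasSum q Q) (hr : HasSum r R) (hs : HasSum s S)
    (h0 : ∀ k l, f (k + l) * g (k - l) = -(p k * q l))
    (h1 : ∀ k l, f (k + l) * g (k - l - 1) = r k * s l) : A * B = R * S - P * Q := by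
  have h3 := hf.mul hg (summable_mul_of_summable_norm hf.summable.norm hg.summable.norm)
  rw [← (Equiv.ofBijective _ bijective_intPair_parity).hasSum_iff] at h3
  have h4 := (hp.mul hq (summable_mul_of_summable_norm hp.summable.norm hq.summable.norm)).neg
  have h5 := hr.mul hs (summable_mul_of_summable_norm hr.summable.norm hs.summable.norm)
  have h6 := h3.unique (HasSum.sum (a := -(P * Q)) (b := R * S)
    (h4.congr_fun fun x => h0 x.1 x.2) (h5.congr_fun fun x => h1 x.1 x.2))
  rw [h6]
  ring

/-- The product is a `2 × 2` determinant in the vectors `(thetaEven, thetaOdd)` at `x` and `y`. This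
form turns Weierstrass' identity into the Plücker relation for four vectors in the plane. -/
theorem theta_mul_theta {ω : ℂ} (hω : 0 < ω.im) (x y : ℂ) :
    theta ω (x + y) * theta ω (x - y) =
      thetaEven ω x * thetaOdd ω y - thetaOdd ω x * thetaEven ω y :=
  mul_eq_of_hasSum_parity (hasSum_theta hω (x + y)) (hasSum_theta hω (x - y))
    (hasSum_thetaOdd hω x) (hasSum_thetaEven hω y) (hasSum_thetaEven hω x) (hasSum_thetaOdd hω y)
    (theta_term_mul_of_even ω x y) (theta_term_mul_of_odd ω x y)

/-- Weierstrass' three-term identity. -/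
theorem theta_weierstrass {ω : ℂ} (hω : 0 < ω.im) (a b c d : ℂ) :
    theta ω (a + b) * theta ω (a - b) * (theta ω (c + d) * theta ω (c - d)) -
      theta ω (a + c) * theta ω (a - c) * (theta ω (b + d) * theta ω (b - d)) +
      theta ω (a + d) * theta ω (a - d) * (theta ω (b + c) * theta ω (b - c)) = 0 := by
  simp only [theta_mul_theta hω]
  ring

theorem integral_exp_two_pi_int (n : ℤ) :
    ∫ x in (0 : ℝ)..1, exp (2 * Real.pi * I * n * x) = if n = 0 then 1 else 0 := by
  split_ifs with h
  · simp [h]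
  · have hc : 2 * Real.pi * I * n ≠ 0 := by
      simp [Real.pi_ne_zero, h]
    rw [integral_exp_mul_complex hc]
    have : exp (2 * Real.pi * I * n * (1 : ℝ)) = 1 := exp_eq_one_iff.mpr ⟨n, by push_cast; ring⟩
    rw [this]
    simp

/-- On the real period `[0,1]` the series is an absolutely convergent Fourier series whose zeroth
coefficient is `1`, so it cannot vanish identically. -/
theorem jacobiTheta₂_ne_zero {τ : ℂ} (hτ : 0 < τ.im) : ∃ z, jacobiTheta₂ z τ ≠ 0 := by
  by_contra! h
  let f : ℤ → C(ℝ, ℂ) := fun n =>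
    ⟨fun x => jacobiTheta₂_term n (x : ℂ) τ, by unfold jacobiTheta₂_term; fun_prop⟩
  have hfn (n : ℤ) : ‖(f n).restrict (⟨Set.uIcc 0 1, isCompact_uIcc⟩ :
      TopologicalSpace.Compacts ℝ)‖ ≤ ‖jacobiTheta₂_term n 0 τ‖ := by
    refine (ContinuousMap.norm_le _ (norm_nonneg _)).mpr fun x => ?_
    simp [f, norm_jacobiTheta₂_term]
  have hs : Summable fun n : ℤ => ‖(f n).restrict (⟨Set.uIcc 0 1, isCompact_uIcc⟩ :
      TopologicalSpace.Compacts ℝ)‖ :=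
    Summable.of_nonneg_of_le (fun _ => norm_nonneg _) hfn
      ((summable_jacobiTheta₂_term_iff 0 τ).mpr hτ).norm
  have h1 := intervalIntegral.hasSum_intervalIntegral_of_summable_norm hs
  have h2 : ∀ n : ℤ, ∫ x in (0 : ℝ)..1, f n x = if n = 0 then 1 else 0 := by
    intro n
    have : ∀ x : ℝ, f n x = exp (2 * Real.pi * I * n * x) * exp (Real.pi * I * n ^ 2 * τ) :=
      fun x => by simp only [f, ContinuousMap.coe_mk, jacobiTheta₂_term, exp_add]
    simp_rw [this]
    rw [intervalIntegral.integral_mul_const, integral_exp_two_pi_int]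
    split_ifs with hn
    · simp [hn]
    · simp
  have h3 : ∫ x in (0 : ℝ)..1, ∑' n : ℤ, f n x = 0 := by
    have : ∀ x : ℝ, ∑' n : ℤ, f n x = 0 := fun x => h x
    simp [this]
  simp_rw [h2] at h1
  rw [h3] at h1
  exact one_ne_zero ((hasSum_ite_eq (0 : ℤ) (1 : ℂ)).unique h1)

theorem exists_theta_ne_zero {ω : ℂ} (hω : 0 < ω.im) : ∃ z, theta ω z ≠ 0 := by
  obtain ⟨z, hz⟩ := jacobiTheta₂_ne_zero hω
  have hpi : (Real.pi : ℂ) ≠ 0 := by exact_mod_cast Real.pi_ne_zero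
  refine ⟨Real.pi * (z - ω / 2 - 1 / 2), ?_⟩
  rw [theta_eq_jacobiTheta₂]
  refine mul_ne_zero (mul_ne_zero (by simp) (exp_ne_zero _)) ?_
  convert hz using 2
  field_simp
  ring

end
end SOS

/-! ### Zeros of theta functions, divisibility, and interpolation. -/

namespace SOS
noncomputable section

open Complex Filter Topology

theorem zero_mem_periodLattice (ω : ℂ) : (0 : ℂ) ∈ periodLattice ω := ⟨0, 0, by simp⟩

theorem neg_mem_periodLattice {ω z : ℂ} (h : z ∈ periodLattice ω) : -z ∈ periodLattice ω := by
  obtain ⟨m, n, rfl⟩ := h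
  exact ⟨-m, -n, by push_cast; ring⟩

/-- Entire functions of order `n` with multipliers `α` and `β e^{-2inz}` for the quasi-periods
`π` and `πω`. -/
structure IsThetaFun (ω : ℂ) (n : ℕ) (α β : ℂ) (f : ℂ → ℂ) : Prop where
  diff : Differentiable ℂ f
  add_pi : ∀ z, f (z + Real.pi) = α * f z
  add_pi_mul : ∀ z, f (z + Real.pi * ω) = β * exp (-(2 * I * n * z)) * f z

namespace IsThetaFun

variable {ω α β α' β' : ℂ} {n m : ℕ} {f g : ℂ → ℂ}

theorem mul (hf : IsThetaFun ω n α β f) (hg : IsThetaFun ω m α' β' g) :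
    IsThetaFun ω (n + m) (α * α') (β * β') (fun z => f z * g z) where
  diff := hf.diff.mul hg.diff
  add_pi z := by rw [hf.add_pi, hg.add_pi]; ring
  add_pi_mul z := by
    have : exp (-(2 * I * (n + m : ℕ) * z)) =
        exp (-(2 * I * n * z)) * exp (-(2 * I * m * z)) := by
      rw [← exp_add]; congr 1; push_cast; ring
    rw [hf.add_pi_mul, hg.add_pi_mul, this]; ring

theorem add (hf : IsThetaFun ω n α β f) (hg : IsThetaFun ω n α β g) :
    IsThetaFun ω n α β (fun z => f z + g z) where
  diff := hf.diff.add hg.diff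
  add_pi z := by rw [hf.add_pi, hg.add_pi]; ring
  add_pi_mul z := by rw [hf.add_pi_mul, hg.add_pi_mul]; ring

theorem const_mul (c : ℂ) (hf : IsThetaFun ω n α β f) :
    IsThetaFun ω n α β (fun z => c * f z) where
  diff := hf.diff.const_mul c
  add_pi z := by rw [hf.add_pi]; ring
  add_pi_mul z := by rw [hf.add_pi_mul]; ring

theorem zero : IsThetaFun ω n α β (fun _ => 0) where
  diff := differentiable_const 0
  add_pi z := by simp
  add_pi_mul z := by simp

theorem sum {ι : Type*} {s : Finset ι} {f : ι → ℂ → ℂ} (h : ∀ i ∈ s, IsThetaFun ω n α β (f i)) :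
    IsThetaFun ω n α β (fun z => ∑ i ∈ s, f i z) := by
  classical
  induction s using Finset.induction_on with
  | empty => simpa using zero
  | insert a s ha ih =>
    simp_rw [Finset.sum_insert ha]
    exact (h a (by simp)).add (ih fun i hi => h i (by simp [hi]))

theorem sub (hf : IsThetaFun ω n α β f) (hg : IsThetaFun ω n α β g) :
    IsThetaFun ω n α β (fun z => f z - g z) := by
  simpa [sub_eq_add_neg] using hf.add (hg.const_mul (-1))

theorem prod {ι : Type*} {s : Finset ι} {f : ι → ℂ → ℂ} {n : ι → ℕ} {α β : ι → ℂ}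
    (h : ∀ i ∈ s, IsThetaFun ω (n i) (α i) (β i) (f i)) :
    IsThetaFun ω (∑ i ∈ s, n i) (∏ i ∈ s, α i) (∏ i ∈ s, β i) (fun z => ∏ i ∈ s, f i z) := by
  classical
  induction s using Finset.induction_on with
  | empty => exact ⟨by simp, by simp, by simp⟩
  | insert a s ha ih =>
    simp_rw [Finset.sum_insert ha, Finset.prod_insert ha]
    exact (h a (by simp)).mul (ih fun i hi => h i (by simp [hi]))

theorem apply_add_eq_zero_iff (hf : IsThetaFun ω n α β f) (hα : α ≠ 0) (hβ : β ≠ 0) {γ : ℂ}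
    (hγ : γ ∈ periodLattice ω) (z : ℂ) : f (z + γ) = 0 ↔ f z = 0 := by
  -- The translations that preserve the zero set form a group, so it suffices to test the two
  -- generators of the lattice.
  let G : AddSubgroup ℂ :=
    { carrier := {γ | ∀ z, f (z + γ) = 0 ↔ f z = 0}
      zero_mem' := fun z => by simp
      add_mem' := fun {a b} ha hb z => by rw [← add_assoc, hb, ha]
      neg_mem' := fun {a} ha z => by rw [← ha (z + -a)]; simp }
  have h1 : (Real.pi : ℂ) ∈ G := fun z => by rw [hf.add_pi]; simp [hα]
  have h2 : (Real.pi * ω : ℂ) ∈ G := fun z => by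
    rw [hf.add_pi_mul]; simp [hβ, exp_ne_zero]
  obtain ⟨k, l, rfl⟩ := hγ
  have h3 := G.add_mem (G.zsmul_mem h1 k) (G.zsmul_mem h2 l)
  rw [zsmul_eq_mul, zsmul_eq_mul, ← mul_assoc] at h3
  exact h3 z

end IsThetaFun

theorem isThetaFun_theta {ω : ℂ} (hω : 0 < ω.im) (a : ℂ) :
    IsThetaFun ω 1 (-1) (-exp (-(I * Real.pi * ω) + 2 * I * a)) (fun z => theta ω (z - a)) where
  diff := (differentiable_theta hω).comp (differentiable_id.sub_const a)
  add_pi z := by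
    rw [show z + Real.pi - a = (z - a) + Real.pi by ring, theta_add_pi]; ring
  add_pi_mul z := by
    rw [show z + Real.pi * ω - a = (z - a) + Real.pi * ω by ring, theta_add_pi_mul,
      neg_mul _ (exp _), ← exp_add]
    congr 3
    push_cast
    ring

theorem theta_eq_zero_of_mem {ω z : ℂ} (hω : 0 < ω.im) (hz : z ∈ periodLattice ω) :
    theta ω z = 0 := by
  have h := (isThetaFun_theta hω 0).apply_add_eq_zero_iff (by simp)
    (neg_ne_zero.mpr (exp_ne_zero _)) hz 0
  simpa [theta_zero] using h

theorem theta_add_eq_zero_iff {ω γ : ℂ} (hω : 0 < ω.im) (hγ : γ ∈ periodLattice ω) (z : ℂ) :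
    theta ω (z + γ) = 0 ↔ theta ω z = 0 := by
  have h := (isThetaFun_theta hω 0).apply_add_eq_zero_iff (by simp)
    (neg_ne_zero.mpr (exp_ne_zero _)) hγ z
  simpa using h

/-- A function whose modulus is doubly periodic takes bounded values. -/
theorem isBounded_range_of_norm_periodic {ω : ℂ} (hω : 0 < ω.im) {g : ℂ → ℂ} (hg : Continuous g)
    (h1 : ∀ z, ‖g (z + Real.pi)‖ = ‖g z‖) (h2 : ∀ z, ‖g (z + Real.pi * ω)‖ = ‖g z‖) :
    Bornology.IsBounded (Set.range g) := by
  let G : AddSubgroup ℂ :=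
    { carrier := {γ | ∀ z, ‖g (z + γ)‖ = ‖g z‖}
      zero_mem' := fun z => by simp
      add_mem' := fun {a b} ha hb z => by rw [← add_assoc, hb, ha]
      neg_mem' := fun {a} ha z => by rw [← ha (z + -a)]; simp }
  have hG1 : (Real.pi : ℂ) ∈ G := h1
  have hG2 : (Real.pi * ω : ℂ) ∈ G := h2
  let φ : ℝ × ℝ → ℂ := fun p => p.1 * Real.pi + p.2 * (Real.pi * ω)
  have hφ : Continuous φ := by fun_prop
  have hK : IsCompact (g '' (φ '' (Set.Icc 0 1 ×ˢ Set.Icc 0 1))) :=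
    ((isCompact_Icc.prod isCompact_Icc).image hφ).image hg
  obtain ⟨M, hM⟩ := hK.isBounded.exists_norm_le
  refine isBounded_iff_forall_norm_le.mpr ⟨M, ?_⟩
  rintro _ ⟨z, rfl⟩
  have hpi := Real.pi_pos
  -- `a` and `b` are the real coordinates of `z` in the basis `π, πω`; their fractional parts bring
  -- `z` into the compact period parallelogram.
  set b : ℝ := z.im / (Real.pi * ω.im) with hb
  set a : ℝ := (z.re - b * Real.pi * ω.re) / Real.pi with ha
  have hz : z = φ (a, b) := by
    apply Complex.ext
    · simp [φ, ha]
      field_simp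
      ring
    · have : z.im = b * (Real.pi * ω.im) := by rw [hb]; field_simp
      simp [φ]
      linarith
  have hγ := G.add_mem (G.zsmul_mem hG1 ⌊a⌋) (G.zsmul_mem hG2 ⌊b⌋)
  have hz' : z = φ (Int.fract a, Int.fract b) +
      (⌊a⌋ • (Real.pi : ℂ) + ⌊b⌋ • (Real.pi * ω : ℂ)) := by
    rw [hz]
    simp only [φ, Int.fract, zsmul_eq_mul]
    push_cast
    ring
  rw [hz', hγ]
  refine hM _ ⟨_, ⟨_, ⟨⟨Int.fract_nonneg a, (Int.fract_lt_one a).le⟩,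
    ⟨Int.fract_nonneg b, (Int.fract_lt_one b).le⟩⟩, rfl⟩, rfl⟩

/-- After multiplication by a suitable exponential the modulus is doubly periodic, so Liouville's
theorem gives `f = c e^{irz}`. If `c ≠ 0`, the multiplier `1` forces `r` to be an even integer, and
the other multiplier then places `s` in the lattice. -/
theorem IsThetaFun.eq_zero_of_order_zero {ω : ℂ} (hω : 0 < ω.im) {s : ℂ} {f : ℂ → ℂ}
    (hf : IsThetaFun ω 0 1 (exp (2 * I * s)) f) (hs : s ∉ periodLattice ω) (z : ℂ) : f z = 0 := by
  have hpi := Real.pi_pos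
  have hpi' : (Real.pi : ℂ) ≠ 0 := by exact_mod_cast hpi.ne'
  -- The real number for which `e^{-irz}` has a multiplier of modulus `e^{2 Im s}` along `πω`,
  -- cancelling that of `f`; since `r` is real, the modulus along `π` stays `1`.
  set r : ℝ := 2 * s.im / (Real.pi * ω.im) with hr
  let g : ℂ → ℂ := fun z => f z * exp (-(I * r * z))
  have hg : Differentiable ℂ g := hf.diff.mul (by fun_prop)
  have hbd := isBounded_range_of_norm_periodic hω hg.continuous (fun z => by
      simp only [g, hf.add_pi, norm_mul, norm_exp]
      simp) (fun z => by
      simp only [g, hf.add_pi_mul, norm_mul, norm_exp]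
      have : Real.exp ((2 * I * s).re) * Real.exp ((-(I * r * (z + Real.pi * ω))).re) =
          Real.exp ((-(I * r * z)).re) := by
        rw [← Real.exp_add]
        congr 1
        have hr' : r * (Real.pi * ω.im) = 2 * s.im := by rw [hr]; field_simp
        clear_value r
        simp
        linarith
      rw [← this]
      simp only [CharP.cast_eq_zero, mul_zero, zero_mul, neg_zero, zero_re, Real.exp_zero]
      ring)
  have hc : ∀ z, g z = g 0 := fun z => hg.apply_eq_apply_of_bounded hbd z 0
  have hf' : ∀ z, f z = g 0 * exp (I * r * z) := fun z => by
    rw [← hc z]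
    simp only [g]
    rw [mul_assoc, ← exp_add]
    simp
  by_contra hne
  have hg0 : g 0 ≠ 0 := fun h => hne (by rw [hf' z, h, zero_mul])
  have e1 := hf.add_pi 0
  have e2 := hf.add_pi_mul 0
  rw [hf' (0 + Real.pi), hf' 0] at e1
  rw [hf' (0 + Real.pi * ω), hf' 0] at e2
  simp only [zero_add, mul_zero, exp_zero, mul_one, one_mul, Nat.cast_zero, neg_zero] at e1 e2
  have e1' : exp (I * r * Real.pi) = 1 := mul_left_cancel₀ hg0 (by rw [e1, mul_one])
  have e2' : exp (I * r * (Real.pi * ω)) = exp (2 * I * s) :=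
    mul_left_cancel₀ hg0 (by rw [e2, mul_comm])
  obtain ⟨k, hk⟩ := exp_eq_one_iff.mp e1'
  obtain ⟨l, hl⟩ := exp_eq_exp_iff_exists_int.mp e2'
  have hrk : (r : ℂ) = 2 * k := by
    have : (r : ℂ) * (I * Real.pi) = 2 * k * (I * Real.pi) := by linear_combination hk
    exact mul_right_cancel₀ (mul_ne_zero I_ne_zero hpi') this
  refine hs ⟨-l, k, ?_⟩
  rw [hrk] at hl
  have : (2 * I) * s = (2 * I) * ((-l : ℤ) * Real.pi + k * Real.pi * ω) := by
    push_cast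
    linear_combination -hl
  exact mul_left_cancel₀ (mul_ne_zero two_ne_zero I_ne_zero) this

theorem eventually_ne_zero_of_entire {g : ℂ → ℂ} (hg : Differentiable ℂ g) {z₀ : ℂ}
    (h : g z₀ ≠ 0) (p : ℂ) : ∀ᶠ z in 𝓝[≠] p, g z ≠ 0 := by
  have ha : AnalyticOnNhd ℂ g Set.univ := fun z _ => hg.analyticAt z
  rcases (hg.analyticAt p).eventually_eq_zero_or_eventually_ne_zero with h0 | h0
  · exact absurd (ha.eqOn_zero_of_preconnected_of_eventuallyEq_zero isPreconnected_univ
      (Set.mem_univ p) h0 (Set.mem_univ z₀)) h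
  · exact h0

/-- Zeros of a non-zero entire function are isolated, so the factor can be cancelled near `p` and
continuity covers `p` itself. It carries identities proved at generic parameters over to all
parameters. -/
theorem eq_of_mul_eq_mul_entire {g F G : ℂ → ℂ} (hg : Differentiable ℂ g) {z₀ : ℂ}
    (h : g z₀ ≠ 0) {p : ℂ} (hF : ContinuousAt F p) (hG : ContinuousAt G p)
    (hFG : ∀ᶠ z in 𝓝 p, g z * F z = g z * G z) : F p = G p := by
  have h1 : ∀ᶠ z in 𝓝[≠] p, F z = G z := by
    filter_upwards [eventually_ne_zero_of_entire hg h p, hFG.filter_mono nhdsWithin_le_nhds]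
      with z hz hz' using mul_left_cancel₀ hz hz'
  exact tendsto_nhds_unique (hF.tendsto.mono_left nhdsWithin_le_nhds)
    ((hG.tendsto.mono_left nhdsWithin_le_nhds).congr' (h1.mono fun z hz => hz.symm))

/-- Local divisibility of entire functions implies global divisibility. -/
theorem exists_entire_quotient {f g : ℂ → ℂ} (hg : Differentiable ℂ g) {z₀ : ℂ} (h : g z₀ ≠ 0)
    (hloc : ∀ p, ∃ q : ℂ → ℂ, AnalyticAt ℂ q p ∧ ∀ᶠ z in 𝓝 p, f z = g z * q z) :
    ∃ q : ℂ → ℂ, Differentiable ℂ q ∧ ∀ z, f z = g z * q z := by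
  choose q hq hfq using hloc
  have key (p : ℂ) : (fun z => q z z) =ᶠ[𝓝 p] q p := by
    filter_upwards [(hq p).eventually_analyticAt, (hfq p).eventually_nhds] with z hz hz'
    refine eq_of_mul_eq_mul_entire hg h (hq z).continuousAt hz.continuousAt ?_
    filter_upwards [hz', hfq z] with w h1 h2
    rw [← h1, ← h2]
  refine ⟨fun z => q z z, fun p => ?_, fun z => (hfq z).self_of_nhds⟩
  exact ((hq p).congr (key p).symm).differentiableAt

/-- A translation by a zero of `θ` multiplies `θ` by an entire function. -/
theorem exists_theta_add_eq_mul {ω : ℂ} (hω : 0 < ω.im) {z : ℂ} (hz : theta ω z = 0) :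
    ∃ q : ℂ → ℂ, Differentiable ℂ q ∧ ∀ ζ, theta ω (ζ + z) = theta ω ζ * q ζ := by
  obtain ⟨v, hv⟩ := exists_theta_ne_zero hω
  have hd := differentiable_theta hω
  have hloc : ∀ p, ∃ q : ℂ → ℂ, AnalyticAt ℂ q p ∧
      ∀ᶠ ζ in 𝓝 p, theta ω (ζ + z) = theta ω ζ * q ζ := by
    intro p
    -- Chosen so that `p - 2w - z = v`, a point where `θ` does not vanish; `y` is then generic with
    -- respect to `w`.
    set w := (p - z - v) / 2 with hw
    obtain ⟨y, hy1, hy2⟩ := ((eventually_ne_zero_of_entire (g := fun y => theta ω (y + w))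
      (hd.comp (differentiable_id.add_const w)) (z₀ := v - w) (by simpa using hv) 0).and
      (eventually_ne_zero_of_entire (g := fun y => theta ω (y - w))
      (hd.comp (differentiable_id.sub_const w)) (z₀ := v + w) (by simpa using hv) 0)).exists
    have hpv : theta ω (p - 2 * w - z) ≠ 0 := by
      rw [hw, show p - 2 * ((p - z - v) / 2) - z = v by ring]; exact hv
    have hA : Differentiable ℂ fun ζ => theta ω (ζ - 2 * w - z) :=
      hd.comp ((differentiable_id.sub_const _).sub_const _)
    have hB : Differentiable ℂ fun ζ => theta ω (ζ - 2 * w) :=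
      hd.comp (differentiable_id.sub_const _)
    refine ⟨fun ζ => theta ω (ζ - 2 * w) * (theta ω (y + w + z) * theta ω (y - w - z)) /
      (theta ω (ζ - 2 * w - z) * (theta ω (y + w) * theta ω (y - w))), ?_, ?_⟩
    · exact ((hB.analyticAt p).mul analyticAt_const).div
        ((hA.analyticAt p).mul analyticAt_const) (mul_ne_zero hpv (mul_ne_zero hy1 hy2))
    · filter_upwards [hA.continuous.continuousAt.eventually_ne hpv] with ζ hζ
      -- One of the three terms contains the factor `θ(z) = 0`, and the remaining two express `θ(ζ +
      -- z)` as a multiple of `θ(ζ)` with quotient holomorphic near `p`.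
      have hW := theta_weierstrass hω (ζ - w) y (w + z) w
      rw [show w + z - w = z by ring, hz, show ζ - w + (w + z) = ζ + z by ring,
        show ζ - w - (w + z) = ζ - 2 * w - z by ring, show ζ - w + w = ζ by ring,
        show ζ - w - w = ζ - 2 * w by ring, show y + (w + z) = y + w + z by ring,
        show y - (w + z) = y - w - z by ring] at hW
      rw [mul_div_assoc', eq_div_iff (mul_ne_zero hζ (mul_ne_zero hy1 hy2))]
      linear_combination -hW
  exact exists_entire_quotient hd hv hloc

/-- If `θ(z) = 0`, then `θ(ζ + z)/θ(ζ)` is entire with multipliers `1` and `e^{-2iz}`. For `z`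
outside the lattice such a function of order zero vanishes, which would make `θ` zero. -/
theorem theta_eq_zero_iff {ω : ℂ} (hω : 0 < ω.im) {z : ℂ} :
    theta ω z = 0 ↔ z ∈ periodLattice ω := by
  refine ⟨fun hz => ?_, theta_eq_zero_of_mem hω⟩
  obtain ⟨v, hv⟩ := exists_theta_ne_zero hω
  have hd := differentiable_theta hω
  obtain ⟨q, hq, hqe⟩ := exists_theta_add_eq_mul hω hz
  have hqT : IsThetaFun ω 0 1 (exp (2 * I * (-z))) q := by
    refine ⟨hq, fun ζ => ?_, fun ζ => ?_⟩
    · refine eq_of_mul_eq_mul_entire hd hv (F := fun ζ => q (ζ + Real.pi))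
        (G := fun ζ => 1 * q ζ) (hq.comp (differentiable_id.add_const _)).continuous.continuousAt
        (hq.const_mul 1).continuous.continuousAt (Eventually.of_forall fun ζ => ?_)
      have h1 := hqe (ζ + Real.pi)
      rw [theta_add_pi, show ζ + Real.pi + z = (ζ + z) + Real.pi by ring, theta_add_pi,
        hqe] at h1
      linear_combination h1
    · refine eq_of_mul_eq_mul_entire hd hv (F := fun ζ => q (ζ + Real.pi * ω))
        (G := fun ζ => exp (2 * I * (-z)) * exp (-(2 * I * (0 : ℕ) * ζ)) * q ζ)
        (hq.comp (differentiable_id.add_const _)).continuous.continuousAt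
        (Differentiable.continuous (𝕜 := ℂ) (by fun_prop)).continuousAt
        (Eventually.of_forall fun ζ => ?_)
      have h1 := hqe (ζ + Real.pi * ω)
      rw [theta_add_pi_mul, show ζ + Real.pi * ω + z = (ζ + z) + Real.pi * ω by ring,
        theta_add_pi_mul, hqe, show -(I * Real.pi * ω) - 2 * I * (ζ + z) =
          (-(I * Real.pi * ω) - 2 * I * ζ) + 2 * I * (-z) by ring, exp_add] at h1
      have he := exp_ne_zero (-(I * Real.pi * ω) - 2 * I * ζ)
      refine mul_left_cancel₀ he ?_
      simp only [Nat.cast_zero, mul_zero, zero_mul, neg_zero, exp_zero]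
      linear_combination h1
  by_contra hzΓ
  have h0 := hqT.eq_zero_of_order_zero hω (fun h => hzΓ (by simpa using neg_mem_periodLattice h))
  apply hv
  have := hqe (v - z)
  rwa [h0, mul_zero, sub_add_cancel] at this

/-- Differentiating the addition formula in `y` at `y = x` shows that `θ'(0) = 0` would make the
Wronskian of `thetaEven` and `thetaOdd` vanish. The two would be proportional on a disc, so `θ(z₁ +
z) θ(z₁ - z)` would vanish on that disc. -/
theorem deriv_theta_zero_ne_zero {ω : ℂ} (hω : 0 < ω.im) : deriv (theta ω) 0 ≠ 0 := by
  intro h0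
  obtain ⟨v, hv⟩ := exists_theta_ne_zero hω
  have hd := differentiable_theta hω
  have hE := differentiable_thetaEven hω
  have hO := differentiable_thetaOdd hω
  have hOne : ∃ z, thetaOdd ω z ≠ 0 := by
    by_contra! h
    have := theta_mul_theta hω v 0
    simp [h, hv] at this
  obtain ⟨z₁, hz₁⟩ := hOne
  have hW (x : ℂ) : thetaEven ω x * deriv (thetaOdd ω) x -
      thetaOdd ω x * deriv (thetaEven ω) x = 0 := by
    have h1 : HasDerivAt (fun y => theta ω (x + y) * theta ω (x - y))
        (deriv (theta ω) (x + x) * theta ω (x - x) +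
          theta ω (x + x) * -deriv (theta ω) (x - x)) x :=
      ((hd (x + x)).hasDerivAt.comp_const_add x x).mul
        ((hd (x - x)).hasDerivAt.comp_const_sub x x)
    have h2 : HasDerivAt (fun y => thetaEven ω x * thetaOdd ω y - thetaOdd ω x * thetaEven ω y)
        (thetaEven ω x * deriv (thetaOdd ω) x - thetaOdd ω x * deriv (thetaEven ω) x) x :=
      ((hO x).hasDerivAt.const_mul _).sub ((hE x).hasDerivAt.const_mul _)
    have h3 : (fun y => theta ω (x + y) * theta ω (x - y)) =
        fun y => thetaEven ω x * thetaOdd ω y - thetaOdd ω x * thetaEven ω y :=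
      funext (theta_mul_theta hω x)
    rw [h3] at h1
    rw [h2.unique h1, sub_self, theta_zero, h0]
    ring
  obtain ⟨ε, hε, hball⟩ := Metric.eventually_nhds_iff_ball.mp
    (hO.continuous.continuousAt.eventually_ne hz₁)
  have hquot : ∀ z ∈ Metric.ball z₁ ε, HasDerivAt (fun z => thetaEven ω z / thetaOdd ω z) 0 z := by
    intro z hz
    have := (hE z).hasDerivAt.fun_div (hO z).hasDerivAt (hball z hz)
    rwa [show deriv (thetaEven ω) z * thetaOdd ω z - thetaEven ω z * deriv (thetaOdd ω) z = 0 by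
      linear_combination -hW z, zero_div] at this
  have hconst : ∀ z ∈ Metric.ball z₁ ε,
      thetaEven ω z / thetaOdd ω z = thetaEven ω z₁ / thetaOdd ω z₁ := fun z hz =>
    Metric.isOpen_ball.is_const_of_deriv_eq_zero (convex_ball z₁ ε).isPreconnected
      (fun z hz => (hquot z hz).differentiableAt.differentiableWithinAt)
      (fun z hz => (hquot z hz).deriv) hz (Metric.mem_ball_self hε)
  have hprod : ∀ z ∈ Metric.ball z₁ ε, theta ω (z₁ + z) * theta ω (z₁ - z) = 0 := by
    intro z hz
    rw [theta_mul_theta hω]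
    have h1 := hconst z hz
    rw [div_eq_div_iff (hball z hz) hz₁] at h1
    linear_combination -h1
  have h1 := eventually_ne_zero_of_entire (g := fun z => theta ω (z₁ + z))
    (hd.comp (differentiable_id.const_add z₁)) (z₀ := v - z₁) (by simpa using hv) z₁
  have h2 := eventually_ne_zero_of_entire (g := fun z => theta ω (z₁ - z))
    (hd.comp (differentiable_id.const_sub z₁)) (z₀ := z₁ - v) (by simpa using hv) z₁
  have h3 : ∀ᶠ z in 𝓝[≠] z₁, z ∈ Metric.ball z₁ ε :=
    nhdsWithin_le_nhds (Metric.ball_mem_nhds z₁ hε)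
  obtain ⟨z, hz1, hz2, hz3⟩ := (h1.and (h2.and h3)).exists
  exact mul_ne_zero hz1 hz2 (hprod z hz3)

/-- Since `θ(ζ - γ)` is an entire multiple of `θ(ζ)`, a double zero at `γ` would be a double zero at
`0`. -/
theorem deriv_theta_ne_zero {ω : ℂ} (hω : 0 < ω.im) {γ : ℂ} (hγ : theta ω γ = 0) :
    deriv (theta ω) γ ≠ 0 := by
  intro h0
  have hd := differentiable_theta hω
  obtain ⟨q, hq, hqe⟩ := exists_theta_add_eq_mul hω (z := -γ) (by rw [theta_neg, hγ, neg_zero])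
  have h1 : HasDerivAt (fun ζ => theta ω (ζ + -γ)) (deriv (theta ω) (γ + -γ)) γ :=
    (hd _).hasDerivAt.comp_add_const γ (-γ)
  have h2 := (hd γ).hasDerivAt.fun_mul (hq γ).hasDerivAt
  rw [funext hqe] at h1
  have h3 := h1.unique h2
  rw [h0, hγ, add_neg_cancel] at h3
  exact deriv_theta_zero_ne_zero hω (by simpa using h3)

theorem exists_entire_quotient_theta {ω : ℂ} (hω : 0 < ω.im) {f : ℂ → ℂ}
    (hf : Differentiable ℂ f) {a : ℂ} (h : ∀ γ ∈ periodLattice ω, f (a + γ) = 0) :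
    ∃ q : ℂ → ℂ, Differentiable ℂ q ∧ ∀ z, f z = theta ω (z - a) * q z := by
  obtain ⟨v, hv⟩ := exists_theta_ne_zero hω
  have hT := (isThetaFun_theta hω a).diff
  refine exists_entire_quotient hT (z₀ := v + a) (by simpa using hv) fun p => ?_
  by_cases hp : theta ω (p - a) = 0
  · have hfp : f p = 0 := by simpa using h _ ((theta_eq_zero_iff hω).mp hp)
    have hder : deriv (fun z => theta ω (z - a)) p ≠ 0 := by
      rw [deriv_comp_sub_const]
      exact deriv_theta_ne_zero hω hp
    have hds {g : ℂ → ℂ} (hg : Differentiable ℂ g) : Differentiable ℂ (dslope g p) := by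
      rw [← differentiableOn_univ] at hg ⊢
      exact (Complex.differentiableOn_dslope univ_mem).mpr hg
    -- Both functions vanish at `p`, so their quotient is that of the difference quotients; the
    -- denominator is non-zero at `p` because zeros of `θ` are simple.
    refine ⟨fun z => dslope f p z / dslope (fun z => theta ω (z - a)) p z, ?_, ?_⟩
    · exact ((hds hf).analyticAt p).div ((hds hT).analyticAt p) (by rwa [dslope_same])
    · filter_upwards [(hds hT).continuous.continuousAt.eventually_ne
        (by rwa [dslope_same])] with z hz
      have h1 := sub_smul_dslope f p z
      have h2 := sub_smul_dslope (fun z => theta ω (z - a)) p z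
      simp only [hfp, hp, sub_zero, smul_eq_mul] at h1 h2
      rw [← h1, ← h2]
      field_simp
  · exact ⟨fun z => f z / theta ω (z - a), (hf.analyticAt p).div (hT.analyticAt p) hp, by
      filter_upwards [hT.continuous.continuousAt.eventually_ne hp] with z hz
      field_simp⟩

theorem exists_entire_quotient_prod_theta {ω : ℂ} (hω : 0 < ω.im) {ι : Type*} {s : Finset ι}
    {x : ι → ℂ} (hx : ∀ a ∈ s, ∀ b ∈ s, a ≠ b → x a - x b ∉ periodLattice ω) {f : ℂ → ℂ}
    (hf : Differentiable ℂ f) (h : ∀ a ∈ s, ∀ γ ∈ periodLattice ω, f (x a + γ) = 0) :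
    ∃ q : ℂ → ℂ, Differentiable ℂ q ∧ ∀ z, f z = (∏ a ∈ s, theta ω (z - x a)) * q z := by
  classical
  induction s using Finset.induction_on with
  | empty => exact ⟨f, hf, by simp⟩
  | insert a s ha ih =>
    obtain ⟨q, hq, hqe⟩ := ih
      (fun b hb c hc => hx b (Finset.mem_insert_of_mem hb) c (Finset.mem_insert_of_mem hc))
      (fun b hb => h b (Finset.mem_insert_of_mem hb))
    obtain ⟨r, hr, hre⟩ := exists_entire_quotient_theta hω hq (a := x a) (fun γ hγ => by
      have h1 := h a (Finset.mem_insert_self _ _) γ hγ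
      rw [hqe] at h1
      refine (mul_eq_zero.mp h1).resolve_left (Finset.prod_ne_zero_iff.mpr fun b hb => ?_)
      rw [add_sub_right_comm, Ne, theta_add_eq_zero_iff hω hγ, theta_eq_zero_iff hω]
      exact hx a (Finset.mem_insert_self _ _) b (Finset.mem_insert_of_mem hb)
        (fun hab => ha (hab ▸ hb)))
    exact ⟨r, hr, fun z => by rw [hqe, hre, Finset.prod_insert ha]; ring⟩

/-- A theta function of order `n` which vanishes at `n` distinct points in general position
vanishes identically. -/
theorem IsThetaFun.eq_zero_of_nodes {ω : ℂ} (hω : 0 < ω.im) {ι : Type*} [Fintype ι] {x : ι → ℂ}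
    {y τ : ℂ} (hx : ∀ a b, a ≠ b → x a - x b ∉ periodLattice ω) (hτ : τ ∉ periodLattice ω)
    {f : ℂ → ℂ} (hf : IsThetaFun ω (Fintype.card ι)
      ((-1) ^ Fintype.card ι * exp (-(I * y * Real.pi)))
      ((-1) ^ Fintype.card ι * exp (-(I * y * (Real.pi * ω)) -
        I * Real.pi * ω * Fintype.card ι + 2 * I * (∑ a, x a + τ))) f)
    (h0 : ∀ a, f (x a) = 0) (u : ℂ) : f u = 0 := by
  have h1 : ((-1 : ℂ) ^ Fintype.card ι) ≠ 0 := pow_ne_zero _ (by norm_num)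
  obtain ⟨q, hq, hqe⟩ := exists_entire_quotient_prod_theta hω (s := Finset.univ) (x := x)
    (fun a _ b _ => hx a b) hf.diff (fun a _ γ hγ => (hf.apply_add_eq_zero_iff
      (mul_ne_zero h1 (exp_ne_zero _)) (mul_ne_zero h1 (exp_ne_zero _)) hγ _).mpr (h0 a))
  obtain ⟨v, hv⟩ := exists_theta_ne_zero hω
  have hP := IsThetaFun.prod (s := Finset.univ) fun a (_ : a ∈ Finset.univ) =>
    isThetaFun_theta hω (x a)
  have hPe : ∏ a, -exp (-(I * Real.pi * ω) + 2 * I * x a) = (-1) ^ Fintype.card ι *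
      exp (-(I * Real.pi * ω * Fintype.card ι) + 2 * I * ∑ a, x a) := by
    rw [Finset.prod_neg, ← exp_sum, Finset.sum_add_distrib, Finset.mul_sum]
    simp [mul_comm]
  rw [hPe] at hP
  simp only [Finset.sum_const, Finset.prod_const, Finset.card_univ, smul_eq_mul, mul_one] at hP
  obtain ⟨w, hw⟩ : ∃ w, ∏ a, theta ω (w - x a) ≠ 0 := by
    have := (Filter.eventually_all (l := 𝓝[≠] (0 : ℂ))).mpr fun a =>
      eventually_ne_zero_of_entire (isThetaFun_theta hω (x a)).diff (z₀ := v + x a)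
        (by simpa using hv) 0
    obtain ⟨w, hw⟩ := this.exists
    exact ⟨w, Finset.prod_ne_zero_iff.mpr fun a _ => hw a⟩
  -- Dividing by the product over the nodes lowers the order from `n` to `0`, and `e^{iyz}` removes
  -- the twist by `y`. The remaining multiplier is `e^{2iτ}`, so `τ ∉ Γ` leaves only the zero
  -- function.
  have hQ : IsThetaFun ω 0 1 (exp (2 * I * τ)) (fun z => exp (I * y * z) * q z) := by
    have hQd : Differentiable ℂ (fun z => exp (I * y * z) * q z) :=
      Differentiable.mul (by fun_prop) hq
    refine ⟨hQd, fun z => ?_, fun z => ?_⟩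
    · refine eq_of_mul_eq_mul_entire hP.diff hw
        (F := fun z => exp (I * y * (z + Real.pi)) * q (z + Real.pi))
        (G := fun z => 1 * (exp (I * y * z) * q z))
        (hQd.comp (differentiable_id.add_const _)).continuous.continuousAt
        (hQd.const_mul 1).continuous.continuousAt (Eventually.of_forall fun z => ?_)
      have e1 := hf.add_pi z
      rw [hqe, hqe, hP.add_pi] at e1
      have e2 : exp (I * y * (z + Real.pi)) * exp (-(I * y * Real.pi)) = exp (I * y * z) := by
        rw [← exp_add]; congr 1; ring
      refine mul_left_cancel₀ h1 ?_
      rw [← e2]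
      have e3 : exp (I * y * Real.pi) * exp (-(I * y * Real.pi)) = 1 := by
        rw [← exp_add]; simp
      linear_combination exp (I * y * (z + Real.pi)) * e1
    · refine eq_of_mul_eq_mul_entire hP.diff hw
        (F := fun z => exp (I * y * (z + Real.pi * ω)) * q (z + Real.pi * ω))
        (G := fun z => exp (2 * I * τ) * exp (-(2 * I * (0 : ℕ) * z)) *
          (exp (I * y * z) * q z))
        (hQd.comp (differentiable_id.add_const _)).continuous.continuousAt
        (Differentiable.continuous (𝕜 := ℂ) (by fun_prop)).continuousAt
        (Eventually.of_forall fun z => ?_)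
      have e1 := hf.add_pi_mul z
      rw [hqe, hqe, hP.add_pi_mul] at e1
      have e2 : exp (I * y * (z + Real.pi * ω)) * exp (-(I * y * (Real.pi * ω)) -
          I * Real.pi * ω * Fintype.card ι + 2 * I * (∑ a, x a + τ)) =
          exp (-(I * Real.pi * ω * Fintype.card ι) + 2 * I * ∑ a, x a) *
            (exp (2 * I * τ) * exp (I * y * z)) := by
        rw [← exp_add, ← exp_add, ← exp_add]; congr 1; ring
      refine mul_left_cancel₀ (mul_ne_zero (mul_ne_zero h1 (exp_ne_zero
        (-(I * Real.pi * ω * Fintype.card ι) + 2 * I * ∑ a, x a)))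
        (exp_ne_zero (-(2 * I * Fintype.card ι * z)))) ?_
      simp only [Nat.cast_zero, mul_zero, zero_mul, neg_zero, exp_zero]
      linear_combination exp (I * y * (z + Real.pi * ω)) * e1 + (-1) ^ Fintype.card ι *
        exp (-(2 * I * Fintype.card ι * z)) * (∏ a, theta ω (z - x a)) * q z * e2
  have := hQ.eq_zero_of_order_zero hω hτ u
  rw [hqe, (mul_eq_zero.mp this).resolve_left (exp_ne_zero _), mul_zero]

/-- The theta functions of order `n` interpolating at the nodes `x`. -/
def thetaBasis (ω y τ : ℂ) {ι : Type*} [Fintype ι] [DecidableEq ι] (x : ι → ℂ) (a : ι) (u : ℂ) :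
    ℂ :=
  exp (I * y * (x a - u)) * (theta ω (τ - u + x a) / theta ω τ) *
    ∏ b ∈ Finset.univ.erase a, theta ω (u - x b) / theta ω (x a - x b)

section

variable {ω y τ : ℂ} {ι : Type*} [Fintype ι] [DecidableEq ι] {x : ι → ℂ}

/-- The zero at the omitted node `x a` is replaced by one at `τ + x a`. The zeros therefore sum to
`∑ x + τ` for every `a`, and all basis functions share the same multipliers. -/
theorem isThetaFun_thetaBasis (hω : 0 < ω.im) (a : ι) :
    IsThetaFun ω (Fintype.card ι) ((-1) ^ Fintype.card ι * exp (-(I * y * Real.pi)))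
      ((-1) ^ Fintype.card ι * exp (-(I * y * (Real.pi * ω)) -
        I * Real.pi * ω * Fintype.card ι + 2 * I * (∑ a, x a + τ))) (thetaBasis ω y τ x a) := by
  have hE : IsThetaFun ω 0 (exp (-(I * y * Real.pi))) (exp (-(I * y * (Real.pi * ω))))
      (fun u => exp (I * y * (x a - u))) := by
    refine ⟨by fun_prop, fun z => ?_, fun z => ?_⟩
    · rw [← exp_add]; congr 1; ring
    · rw [← exp_add, ← exp_add]; congr 1; push_cast; ring
  have hP := IsThetaFun.prod (s := Finset.univ.erase a) fun b (_ : b ∈ Finset.univ.erase a) =>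
    (isThetaFun_theta hω (x b)).const_mul (theta ω (x a - x b))⁻¹
  have h := (hE.mul ((isThetaFun_theta hω (τ + x a)).const_mul (-(theta ω τ)⁻¹))).mul hP
  have hcard : 1 ≤ Fintype.card ι := Fintype.card_pos_iff.mpr ⟨a⟩
  have hc : Finset.card (Finset.univ.erase a) = Fintype.card ι - 1 := by
    rw [Finset.card_erase_of_mem (Finset.mem_univ a), Finset.card_univ]
  have hsum : ∑ b, x b = x a + ∑ b ∈ Finset.univ.erase a, x b :=
    (Finset.add_sum_erase _ _ (Finset.mem_univ a)).symm
  have hs : (-1 : ℂ) ^ Fintype.card ι = -1 * (-1) ^ (Fintype.card ι - 1) := by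
    rw [← pow_succ', Nat.sub_add_cancel hcard]
  convert! h using 1
  · simp [hc]; omega
  · rw [Finset.prod_const, hc, hs]; ring
  · rw [Finset.prod_neg, ← exp_sum, Finset.sum_add_distrib, ← Finset.mul_sum, Finset.sum_const,
      hc, hs, hsum, nsmul_eq_mul, Nat.cast_sub hcard]
    have : ∀ A B C D : ℂ, exp A * -exp B * (C * exp D) = -1 * C * exp (A + B + D) := by
      intro A B C D
      rw [exp_add, exp_add]; ring
    rw [this]
    congr 2
    push_cast
    ring
  · funext u
    rw [thetaBasis, show τ - u + x a = -(u - (τ + x a)) by ring, theta_neg]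
    congr 1
    · ring
    · exact Finset.prod_congr rfl fun b _ => by rw [div_eq_inv_mul]

theorem thetaBasis_self (hω : 0 < ω.im) (hτ : τ ∉ periodLattice ω)
    (hx : ∀ a b, a ≠ b → x a - x b ∉ periodLattice ω) (a : ι) :
    thetaBasis ω y τ x a (x a) = 1 := by
  rw [thetaBasis, sub_self, mul_zero, exp_zero, sub_add_cancel, div_self
    (mt (theta_eq_zero_iff hω).mp hτ), Finset.prod_eq_one, mul_one, mul_one]
  intro b hb
  exact div_self (mt (theta_eq_zero_iff hω).mp (hx a b (Finset.ne_of_mem_erase hb).symm))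

theorem thetaBasis_of_ne {a c : ι} (h : c ≠ a) : thetaBasis ω y τ x a (x c) = 0 := by
  rw [thetaBasis, Finset.prod_eq_zero (Finset.mem_erase.mpr ⟨h, Finset.mem_univ c⟩), mul_zero]
  rw [sub_self, theta_zero, zero_div]

/-- Interpolation of theta functions of order `n` at `n` nodes. -/
theorem IsThetaFun.interpolation (hω : 0 < ω.im)
    (hx : ∀ a b, a ≠ b → x a - x b ∉ periodLattice ω) (hτ : τ ∉ periodLattice ω)
    {f : ℂ → ℂ} (hf : IsThetaFun ω (Fintype.card ι)
      ((-1) ^ Fintype.card ι * exp (-(I * y * Real.pi)))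
      ((-1) ^ Fintype.card ι * exp (-(I * y * (Real.pi * ω)) -
        I * Real.pi * ω * Fintype.card ι + 2 * I * (∑ a, x a + τ))) f) (u : ℂ) :
    f u = ∑ a, thetaBasis ω y τ x a u * f (x a) := by
  -- The difference from the interpolant has the same multipliers and vanishes at all `n` nodes.
  have hg := hf.sub (IsThetaFun.sum (s := Finset.univ) fun a (_ : a ∈ Finset.univ) =>
    (isThetaFun_thetaBasis (y := y) (τ := τ) (x := x) hω a).const_mul (f (x a)))
  have := hg.eq_zero_of_nodes hω hx hτ (fun c => by
    rw [Finset.sum_eq_single c (fun a _ hac => by rw [thetaBasis_of_ne hac.symm, mul_zero])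
      (by simp), thetaBasis_self hω hτ hx, mul_one, sub_self]) u
  rw [sub_eq_zero.mp this]
  exact Finset.sum_congr rfl fun a _ => mul_comm _ _

end

end
end SOS

/-! ### Theta identities between Boltzmann weights. -/

namespace SOS
noncomputable section

open Complex

/-- Leaves the twelve arguments free, so that they can be written as they occur in the weights. -/
theorem theta_weierstrass' {ω : ℂ} (hω : 0 < ω.im) (a b c d : ℂ)
    {p₁ p₂ p₃ p₄ q₁ q₂ q₃ q₄ r₁ r₂ r₃ r₄ : ℂ}
    (hp₁ : p₁ = a + b) (hp₂ : p₂ = a - b) (hp₃ : p₃ = c + d) (hp₄ : p₄ = c - d)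
    (hq₁ : q₁ = a + c) (hq₂ : q₂ = a - c) (hq₃ : q₃ = b + d) (hq₄ : q₄ = b - d)
    (hr₁ : r₁ = a + d) (hr₂ : r₂ = a - d) (hr₃ : r₃ = b + c) (hr₄ : r₄ = b - c) :
    theta ω p₁ * theta ω p₂ * (theta ω p₃ * theta ω p₄) -
      theta ω q₁ * theta ω q₂ * (theta ω q₃ * theta ω q₄) +
      theta ω r₁ * theta ω r₂ * (theta ω r₃ * theta ω r₄) = 0 := by
  subst hp₁ hp₂ hp₃ hp₄ hq₁ hq₂ hq₃ hq₄ hr₁ hr₂ hr₃ hr₄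
  exact theta_weierstrass hω a b c d

set_option linter.unusedSimpArgs false

namespace Model

variable (P : Model)

theorem wb_neg (u t : ℂ) :
    P.wb u (-t) = theta P.ω u * theta P.ω (t - P.η) / theta P.ω t := by
  rw [wb, show -t + P.η = -(t - P.η) by ring, theta_neg, theta_neg, mul_neg, neg_div_neg_eq]

theorem wc_neg (u t : ℂ) :
    P.wc u (-t) = theta P.ω P.η * theta P.ω (t - u) / theta P.ω t := by
  rw [wc, show -t + u = -(t - u) by ring, theta_neg, theta_neg, mul_neg, neg_div_neg_eq]

/-- The digits in these names are the indices `(h,k)`, `(i,j)`, `(i',j')` of the entry of the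
dynamical Yang-Baxter equation in question. Four products survive here, and two Weierstrass
relations are combined so that their common factor `θ(2t + η)` cancels. The case `11_10_10` is its
mirror image with `θ(2t - η)`; the other cases have three products and follow from a single
relation. -/
theorem weights_exchange_00_01_01 {t : ℂ} (hω : 0 < P.ω.im) (h0 : theta P.ω t ≠ 0) (h1 : theta P.ω (t + P.η) ≠ 0)
    (u v : ℂ) :
    P.wb (u - v) (t + P.η) * P.wa u * P.wb v (-(t + P.η)) +
      P.wc (u - v) (t + P.η) * P.wc u (-t) * P.wc v (t + P.η) =
    P.wb v (-t) * P.wa u * P.wb (u - v) t +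
      P.wc v (-t) * P.wc u (t + P.η) * P.wc (u - v) (-t) := by
  have hA : theta P.ω t * theta P.ω t *
        (theta P.ω t * theta P.ω (-(t + P.η + P.η))) -
      theta P.ω (t - P.η) * theta P.ω (t + P.η) *
        (theta P.ω (t + P.η) * theta P.ω (-(t + P.η))) +
      theta P.ω (t + t + P.η) * theta P.ω (-(P.η)) *
        (theta P.ω (-(P.η)) * theta P.ω P.η) = 0 :=
    theta_weierstrass' hω (t) (0) (-P.η)
      (t + P.η) (by ring) (by ring) (by ring) (by ring) (by ring) (by ring)
      (by ring) (by ring) (by ring) (by ring) (by ring) (by ring)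
  simp only [theta_neg] at hA
  have hB : theta P.ω (t - u) * theta P.ω t *
        (theta P.ω (t + P.η + v) * theta P.ω (-(t + P.η + (u - v)))) -
      theta P.ω (t - (u - v)) * theta P.ω (t - v) *
        (theta P.ω (t + P.η) * theta P.ω (-(t + P.η + u))) +
      theta P.ω (t + t + P.η) * theta P.ω (-(u + P.η)) *
        (theta P.ω (-(u - v)) * theta P.ω (-(v))) = 0 :=
    theta_weierstrass' hω (t - 1/2 * (u - v) - 1/2 * v) (-1/2 * (u - v) - 1/2 * v) (-1/2 * (u - v) + 1/2 * v)
      (t + P.η + 1/2 * (u - v) + 1/2 * v) (by ring) (by ring) (by ring) (by ring) (by ring) (by ring)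
      (by ring) (by ring) (by ring) (by ring) (by ring) (by ring)
  simp only [theta_neg] at hB
  simp only [wb_neg, wc_neg]
  simp only [wa, wb, wc, add_sub_cancel_right, sub_add_cancel]
  field_simp
  linear_combination (-(theta P.ω v * theta P.ω (u - v) * theta P.ω (u + P.η))) * hA +
    (-(theta P.ω P.η * theta P.ω P.η * theta P.ω P.η)) * hB

theorem weights_exchange_00_01_10 {t : ℂ} (hω : 0 < P.ω.im) (h0 : theta P.ω t ≠ 0) (h1 : theta P.ω (t + P.η) ≠ 0)
    (u v : ℂ) :
    P.wc (u - v) (t + P.η) * P.wb u (-t) * P.wa v =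
    P.wb v (-t) * P.wa u * P.wc (u - v) t +
      P.wc v (-t) * P.wc u (t + P.η) * P.wb (u - v) (-t) := by
  have h : theta P.ω v * theta P.ω (u + P.η) *
        (theta P.ω (t + (u - v)) * theta P.ω (-(t + P.η))) -
      theta P.ω u * theta P.ω (v + P.η) *
        (theta P.ω t * theta P.ω (-(t + P.η + (u - v)))) +
      theta P.ω (t + P.η + u) * theta P.ω (-(t - v)) *
        (theta P.ω (-(P.η)) * theta P.ω (-(u - v))) = 0 :=
    theta_weierstrass' hω (1/2 * P.η + 1/2 * (u - v) + v) (-1/2 * P.η - 1/2 * (u - v)) (-1/2 * P.η + 1/2 * (u - v))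
      (t + 1/2 * P.η + 1/2 * (u - v)) (by ring) (by ring) (by ring) (by ring) (by ring) (by ring)
      (by ring) (by ring) (by ring) (by ring) (by ring) (by ring)
  simp only [theta_neg] at h
  simp only [wb_neg, wc_neg]
  simp only [wa, wb, wc, add_sub_cancel_right, sub_add_cancel]
  field_simp
  linear_combination ((theta P.ω (t - P.η) * theta P.ω P.η)) * h

theorem weights_exchange_00_10_01 {t : ℂ} (hω : 0 < P.ω.im) (h0 : theta P.ω t ≠ 0) (h1 : theta P.ω (t + P.η) ≠ 0)
    (u v : ℂ) :
    P.wc (u - v) (-(t + P.η)) * P.wa u * P.wb v (-(t + P.η)) +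
      P.wb (u - v) (-(t + P.η)) * P.wc u (-t) * P.wc v (t + P.η) =
    P.wa v * P.wb u (-(t + P.η)) * P.wc (u - v) (-t) := by
  have h : theta P.ω v * theta P.ω (u + P.η) *
        (theta P.ω t * theta P.ω (t + P.η - (u - v))) -
      theta P.ω (t + P.η + v) * theta P.ω (-(t - u)) *
        (theta P.ω (-(P.η)) * theta P.ω (-(u - v))) +
      theta P.ω u * theta P.ω (v + P.η) *
        (theta P.ω (t - (u - v)) * theta P.ω (-(t + P.η))) = 0 :=
    theta_weierstrass' hω (1/2 * P.η + 1/2 * (u - v) + v) (-1/2 * P.η - 1/2 * (u - v)) (t + 1/2 * P.η - 1/2 * (u - v))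
      (-1/2 * P.η + 1/2 * (u - v)) (by ring) (by ring) (by ring) (by ring) (by ring) (by ring)
      (by ring) (by ring) (by ring) (by ring) (by ring) (by ring)
  simp only [theta_neg] at h
  simp only [wb_neg, wc_neg]
  simp only [wa, wb, wc, add_sub_cancel_right, sub_add_cancel]
  field_simp
  linear_combination ((theta P.ω P.η)) * h

theorem weights_exchange_01_01_00 {t : ℂ} (hω : 0 < P.ω.im) (h0 : theta P.ω t ≠ 0) (h1 : theta P.ω (t + P.η) ≠ 0)
    (u v : ℂ) :
    P.wb (u - v) (t + P.η) * P.wa u * P.wc v (-(t + P.η)) +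
      P.wc (u - v) (t + P.η) * P.wc u (-t) * P.wb v (t + P.η) =
    P.wc v (-t) * P.wb u (t + P.η) * P.wa (u - v) := by
  have h : theta P.ω u * theta P.ω ((u - v) + P.η) *
        (theta P.ω (t - v) * theta P.ω (-(t + P.η))) -
      theta P.ω (u - v) * theta P.ω (u + P.η) *
        (theta P.ω t * theta P.ω (-(t + P.η - v))) +
      theta P.ω (t + P.η + (u - v)) * theta P.ω (-(t - u)) *
        (theta P.ω (-(P.η)) * theta P.ω v) = 0 :=
    theta_weierstrass' hω (1/2 * P.η + (u - v) + 1/2 * v) (-1/2 * P.η + 1/2 * v) (-1/2 * P.η - 1/2 * v)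
      (t + 1/2 * P.η - 1/2 * v) (by ring) (by ring) (by ring) (by ring) (by ring) (by ring)
      (by ring) (by ring) (by ring) (by ring) (by ring) (by ring)
  simp only [theta_neg] at h
  simp only [wb_neg, wc_neg]
  simp only [wa, wb, wc, add_sub_cancel_right, sub_add_cancel]
  field_simp
  linear_combination ((theta P.ω P.η * theta P.ω (t + P.η + P.η))) * h

theorem weights_exchange_01_10_00 {t : ℂ} (hω : 0 < P.ω.im) (h0 : theta P.ω t ≠ 0) (h1 : theta P.ω (t + P.η) ≠ 0)
    (u v : ℂ) :
    P.wc (u - v) (-(t + P.η)) * P.wa u * P.wc v (-(t + P.η)) +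
      P.wb (u - v) (-(t + P.η)) * P.wc u (-t) * P.wb v (t + P.η) =
    P.wa v * P.wc u (-(t + P.η)) * P.wa (u - v) := by
  have h : theta P.ω (v + P.η) * theta P.ω ((u - v) + P.η) *
        (theta P.ω (t + P.η - u) * theta P.ω (-(t + P.η))) -
      theta P.ω P.η * theta P.ω (u + P.η) *
        (theta P.ω (t + P.η - (u - v)) * theta P.ω (-(t + P.η - v))) +
      theta P.ω (t + P.η + P.η) * theta P.ω (-(t - u)) *
        (theta P.ω (-(u - v)) * theta P.ω v) = 0 :=
    theta_weierstrass' hω (P.η + 1/2 * (u - v) + 1/2 * v) (-1/2 * (u - v) + 1/2 * v) (-1/2 * (u - v) - 1/2 * v)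
      (t + P.η - 1/2 * (u - v) - 1/2 * v) (by ring) (by ring) (by ring) (by ring) (by ring) (by ring)
      (by ring) (by ring) (by ring) (by ring) (by ring) (by ring)
  simp only [theta_neg] at h
  simp only [wb_neg, wc_neg]
  simp only [wa, wb, wc, add_sub_cancel_right, sub_add_cancel]
  field_simp
  linear_combination ((theta P.ω P.η)) * h

theorem weights_exchange_01_11_01 {t : ℂ} (hω : 0 < P.ω.im) (h2 : theta P.ω (t - P.η) ≠ 0) (h0 : theta P.ω t ≠ 0)
    (u v : ℂ) :
    P.wa (u - v) * P.wc u (-t) * P.wa v =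
    P.wb v (-t) * P.wc u (-(t - P.η)) * P.wb (u - v) t +
      P.wc v (-t) * P.wa u * P.wc (u - v) (-t) := by
  have h : theta P.ω v * theta P.ω (u - v) *
        (theta P.ω (t - P.η - u) * theta P.ω (-(t + P.η))) -
      theta P.ω (-(P.η)) * theta P.ω (u + P.η) *
        (theta P.ω (t - (u - v)) * theta P.ω (-(t - v))) +
      theta P.ω t * theta P.ω (-(t - u)) *
        (theta P.ω (-((u - v) + P.η)) * theta P.ω (v + P.η)) = 0 :=
    theta_weierstrass' hω (1/2 * (u - v) + 1/2 * v) (-1/2 * (u - v) + 1/2 * v) (-P.η - 1/2 * (u - v) - 1/2 * v)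
      (t - 1/2 * (u - v) - 1/2 * v) (by ring) (by ring) (by ring) (by ring) (by ring) (by ring)
      (by ring) (by ring) (by ring) (by ring) (by ring) (by ring)
  simp only [theta_neg] at h
  simp only [wb_neg, wc_neg]
  simp only [wa, wb, wc, add_sub_cancel_right, sub_add_cancel]
  field_simp
  linear_combination ((theta P.ω P.η)) * h

theorem weights_exchange_01_11_10 {t : ℂ} (hω : 0 < P.ω.im) (h2 : theta P.ω (t - P.η) ≠ 0) (h0 : theta P.ω t ≠ 0)
    (u v : ℂ) :
    P.wa (u - v) * P.wb u (-t) * P.wc v (-(t - P.η)) =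
    P.wb v (-t) * P.wc u (-(t - P.η)) * P.wc (u - v) t +
      P.wc v (-t) * P.wa u * P.wb (u - v) (-t) := by
  have h : theta P.ω v * theta P.ω P.η *
        (theta P.ω (t - P.η - u) * theta P.ω (-(t + (u - v)))) -
      theta P.ω (-(u - v)) * theta P.ω (u + P.η) *
        (theta P.ω (t - P.η) * theta P.ω (-(t - v))) +
      theta P.ω t * theta P.ω (-(t - P.η - v)) *
        (theta P.ω (-((u - v) + P.η)) * theta P.ω u) = 0 :=
    theta_weierstrass' hω (1/2 * P.η + 1/2 * v) (-1/2 * P.η + 1/2 * v) (-1/2 * P.η - (u - v) - 1/2 * v)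
      (t - 1/2 * P.η - 1/2 * v) (by ring) (by ring) (by ring) (by ring) (by ring) (by ring)
      (by ring) (by ring) (by ring) (by ring) (by ring) (by ring)
  simp only [theta_neg] at h
  simp only [wb_neg, wc_neg]
  simp only [wa, wb, wc, add_sub_cancel_right, sub_add_cancel]
  field_simp
  linear_combination ((theta P.ω P.η)) * h

theorem weights_exchange_10_00_01 {t : ℂ} (hω : 0 < P.ω.im) (h0 : theta P.ω t ≠ 0) (h1 : theta P.ω (t + P.η) ≠ 0)
    (u v : ℂ) :
    P.wa (u - v) * P.wb u t * P.wc v (t + P.η) =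
    P.wc v t * P.wa u * P.wb (u - v) t +
      P.wb v t * P.wc u (t + P.η) * P.wc (u - v) (-t) := by
  have h : theta P.ω u * theta P.ω ((u - v) + P.η) *
        (theta P.ω t * theta P.ω (-(t + P.η + v))) -
      theta P.ω (u - v) * theta P.ω (u + P.η) *
        (theta P.ω (t + v) * theta P.ω (-(t + P.η))) +
      theta P.ω (t + P.η + u) * theta P.ω (-(t - (u - v))) *
        (theta P.ω (-(P.η)) * theta P.ω v) = 0 :=
    theta_weierstrass' hω (1/2 * P.η + (u - v) + 1/2 * v) (-1/2 * P.η + 1/2 * v) (-1/2 * P.η - 1/2 * v)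
      (t + 1/2 * P.η + 1/2 * v) (by ring) (by ring) (by ring) (by ring) (by ring) (by ring)
      (by ring) (by ring) (by ring) (by ring) (by ring) (by ring)
  simp only [theta_neg] at h
  simp only [wb_neg, wc_neg]
  simp only [wa, wb, wc, add_sub_cancel_right, sub_add_cancel]
  field_simp
  linear_combination (-(theta P.ω P.η)) * h

theorem weights_exchange_10_00_10 {t : ℂ} (hω : 0 < P.ω.im) (h0 : theta P.ω t ≠ 0) (h1 : theta P.ω (t + P.η) ≠ 0)
    (u v : ℂ) :
    P.wa (u - v) * P.wc u t * P.wa v =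
    P.wc v t * P.wa u * P.wc (u - v) t +
      P.wb v t * P.wc u (t + P.η) * P.wb (u - v) (-t) := by
  have h : theta P.ω (v + P.η) * theta P.ω ((u - v) + P.η) *
        (theta P.ω t * theta P.ω (-(t + u))) -
      theta P.ω P.η * theta P.ω (u + P.η) *
        (theta P.ω (t + v) * theta P.ω (-(t + (u - v)))) +
      theta P.ω (t + P.η + u) * theta P.ω (-(t - P.η)) *
        (theta P.ω (-(u - v)) * theta P.ω v) = 0 :=
    theta_weierstrass' hω (P.η + 1/2 * (u - v) + 1/2 * v) (-1/2 * (u - v) + 1/2 * v) (-1/2 * (u - v) - 1/2 * v)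
      (t + 1/2 * (u - v) + 1/2 * v) (by ring) (by ring) (by ring) (by ring) (by ring) (by ring)
      (by ring) (by ring) (by ring) (by ring) (by ring) (by ring)
  simp only [theta_neg] at h
  simp only [wb_neg, wc_neg]
  simp only [wa, wb, wc, add_sub_cancel_right, sub_add_cancel]
  field_simp
  linear_combination (-(theta P.ω P.η)) * h

theorem weights_exchange_10_01_11 {t : ℂ} (hω : 0 < P.ω.im) (h2 : theta P.ω (t - P.η) ≠ 0) (h0 : theta P.ω t ≠ 0)
    (u v : ℂ) :
    P.wb (u - v) (t - P.η) * P.wc u t * P.wb v (-(t - P.η)) +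
      P.wc (u - v) (t - P.η) * P.wa u * P.wc v (t - P.η) =
    P.wa v * P.wc u (t - P.η) * P.wa (u - v) := by
  have h : theta P.ω v * theta P.ω (u - v) *
        (theta P.ω (t - P.η - P.η) * theta P.ω (-(t + u))) -
      theta P.ω (-(P.η)) * theta P.ω (u + P.η) *
        (theta P.ω (t - P.η + v) * theta P.ω (-(t - P.η + (u - v)))) +
      theta P.ω (t - P.η + u) * theta P.ω (-(t - P.η)) *
        (theta P.ω (-((u - v) + P.η)) * theta P.ω (v + P.η)) = 0 :=
    theta_weierstrass' hω (1/2 * (u - v) + 1/2 * v) (-1/2 * (u - v) + 1/2 * v) (-P.η - 1/2 * (u - v) - 1/2 * v)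
      (t - P.η + 1/2 * (u - v) + 1/2 * v) (by ring) (by ring) (by ring) (by ring) (by ring) (by ring)
      (by ring) (by ring) (by ring) (by ring) (by ring) (by ring)
  simp only [theta_neg] at h
  simp only [wb_neg, wc_neg]
  simp only [wa, wb, wc, add_sub_cancel_right, sub_add_cancel]
  field_simp
  linear_combination (-(theta P.ω P.η)) * h

theorem weights_exchange_10_10_11 {t : ℂ} (hω : 0 < P.ω.im) (h2 : theta P.ω (t - P.η) ≠ 0) (h0 : theta P.ω t ≠ 0)
    (u v : ℂ) :
    P.wc (u - v) (-(t - P.η)) * P.wc u t * P.wb v (-(t - P.η)) +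
      P.wb (u - v) (-(t - P.η)) * P.wa u * P.wc v (t - P.η) =
    P.wc v t * P.wb u (-(t - P.η)) * P.wa (u - v) := by
  have h : theta P.ω v * theta P.ω P.η *
        (theta P.ω (t - P.η - (u - v)) * theta P.ω (-(t + u))) -
      theta P.ω (-(u - v)) * theta P.ω (u + P.η) *
        (theta P.ω (t - P.η + v) * theta P.ω (-(t))) +
      theta P.ω (t + v) * theta P.ω (-(t - P.η)) *
        (theta P.ω (-((u - v) + P.η)) * theta P.ω u) = 0 :=
    theta_weierstrass' hω (1/2 * P.η + 1/2 * v) (-1/2 * P.η + 1/2 * v) (-1/2 * P.η - (u - v) - 1/2 * v)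
      (t - 1/2 * P.η + 1/2 * v) (by ring) (by ring) (by ring) (by ring) (by ring) (by ring)
      (by ring) (by ring) (by ring) (by ring) (by ring) (by ring)
  simp only [theta_neg] at h
  simp only [wb_neg, wc_neg]
  simp only [wa, wb, wc, add_sub_cancel_right, sub_add_cancel]
  field_simp
  linear_combination (-(theta P.ω P.η * theta P.ω (t - P.η - P.η))) * h

theorem weights_exchange_11_01_10 {t : ℂ} (hω : 0 < P.ω.im) (h2 : theta P.ω (t - P.η) ≠ 0) (h0 : theta P.ω t ≠ 0)
    (u v : ℂ) :
    P.wb (u - v) (t - P.η) * P.wc u t * P.wc v (-(t - P.η)) +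
      P.wc (u - v) (t - P.η) * P.wa u * P.wb v (t - P.η) =
    P.wa v * P.wb u (t - P.η) * P.wc (u - v) t := by
  have h : theta P.ω (u - v) * theta P.ω P.η *
        (theta P.ω (t - P.η - v) * theta P.ω (t + u)) -
      theta P.ω (t + (u - v)) * theta P.ω (-(t - P.η)) *
        (theta P.ω (-(v + P.η)) * theta P.ω u) +
      theta P.ω (-(v)) * theta P.ω (u + P.η) *
        (theta P.ω (t - P.η + (u - v)) * theta P.ω (-(t))) = 0 :=
    theta_weierstrass' hω (1/2 * P.η + 1/2 * (u - v)) (-1/2 * P.η + 1/2 * (u - v)) (t - 1/2 * P.η + 1/2 * (u - v))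
      (-1/2 * P.η - 1/2 * (u - v) - v) (by ring) (by ring) (by ring) (by ring) (by ring) (by ring)
      (by ring) (by ring) (by ring) (by ring) (by ring) (by ring)
  simp only [theta_neg] at h
  simp only [wb_neg, wc_neg]
  simp only [wa, wb, wc, add_sub_cancel_right, sub_add_cancel]
  field_simp
  linear_combination ((theta P.ω P.η)) * h

theorem weights_exchange_11_10_01 {t : ℂ} (hω : 0 < P.ω.im) (h2 : theta P.ω (t - P.η) ≠ 0) (h0 : theta P.ω t ≠ 0)
    (u v : ℂ) :
    P.wc (u - v) (-(t - P.η)) * P.wb u t * P.wa v =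
    P.wc v t * P.wc u (-(t - P.η)) * P.wb (u - v) t +
      P.wb v t * P.wa u * P.wc (u - v) (-t) := by
  have h : theta P.ω u * theta P.ω (v + P.η) *
        (theta P.ω (t - P.η - (u - v)) * theta P.ω t) -
      theta P.ω (t + v) * theta P.ω (-(t - P.η - u)) *
        (theta P.ω (-(P.η)) * theta P.ω (u - v)) +
      theta P.ω v * theta P.ω (u + P.η) *
        (theta P.ω (t - P.η) * theta P.ω (-(t - (u - v)))) = 0 :=
    theta_weierstrass' hω (1/2 * P.η + 1/2 * (u - v) + v) (-1/2 * P.η + 1/2 * (u - v)) (t - 1/2 * P.η - 1/2 * (u - v))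
      (-1/2 * P.η - 1/2 * (u - v)) (by ring) (by ring) (by ring) (by ring) (by ring) (by ring)
      (by ring) (by ring) (by ring) (by ring) (by ring) (by ring)
  simp only [theta_neg] at h
  simp only [wb_neg, wc_neg]
  simp only [wa, wb, wc, add_sub_cancel_right, sub_add_cancel]
  field_simp
  linear_combination ((theta P.ω P.η * theta P.ω (t + P.η))) * h

theorem weights_exchange_11_10_10 {t : ℂ} (hω : 0 < P.ω.im) (h2 : theta P.ω (t - P.η) ≠ 0) (h0 : theta P.ω t ≠ 0)
    (u v : ℂ) :
    P.wc (u - v) (-(t - P.η)) * P.wc u t * P.wc v (-(t - P.η)) +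
      P.wb (u - v) (-(t - P.η)) * P.wa u * P.wb v (t - P.η) =
    P.wc v t * P.wc u (-(t - P.η)) * P.wc (u - v) t +
      P.wb v t * P.wa u * P.wb (u - v) (-t) := by
  have hA : theta P.ω (t - P.η - P.η) * theta P.ω t *
        (theta P.ω t * theta P.ω (-(t))) -
      theta P.ω (t - P.η) * theta P.ω (t - P.η) *
        (theta P.ω (t - P.η) * theta P.ω (-(t + P.η))) +
      theta P.ω (t + t - P.η) * theta P.ω (-(P.η)) *
        (theta P.ω (-(P.η)) * theta P.ω (-(P.η))) = 0 :=
    theta_weierstrass' hω (t - P.η) (-P.η) (0)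
      (t) (by ring) (by ring) (by ring) (by ring) (by ring) (by ring)
      (by ring) (by ring) (by ring) (by ring) (by ring) (by ring)
  simp only [theta_neg] at hA
  have hB : theta P.ω (t - P.η - (u - v)) * theta P.ω (t - P.η - v) *
        (theta P.ω t * theta P.ω (-(t + u))) -
      theta P.ω (t - P.η - u) * theta P.ω (t - P.η) *
        (theta P.ω (t + v) * theta P.ω (-(t + (u - v)))) +
      theta P.ω (t + t - P.η) * theta P.ω (-(u + P.η)) *
        (theta P.ω (-(u - v)) * theta P.ω v) = 0 :=
    theta_weierstrass' hω (t - P.η - 1/2 * (u - v) - 1/2 * v) (-1/2 * (u - v) + 1/2 * v) (-1/2 * (u - v) - 1/2 * v)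
      (t + 1/2 * (u - v) + 1/2 * v) (by ring) (by ring) (by ring) (by ring) (by ring) (by ring)
      (by ring) (by ring) (by ring) (by ring) (by ring) (by ring)
  simp only [theta_neg] at hB
  simp only [wb_neg, wc_neg]
  simp only [wa, wb, wc, add_sub_cancel_right, sub_add_cancel]
  field_simp
  linear_combination (-(theta P.ω v * theta P.ω (u - v) * theta P.ω (u + P.η))) * hA +
    (-(theta P.ω P.η * theta P.ω P.η * theta P.ω P.η)) * hB


end Model
end
end SOS

/-! ### The dynamical Yang-Baxter equation. -/

namespace SOS
noncomputable section

open Complex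

namespace Model

variable (P : Model)

/-- The phase `e^{iyu}`. -/
def phase (u : ℂ) : ℂ := exp (I * P.y * u)

theorem phase_ne_zero (u : ℂ) : P.phase u ≠ 0 := exp_ne_zero _

theorem phase_sub (u v : ℂ) : P.phase (u - v) = P.phase u * (P.phase v)⁻¹ := by
  rw [phase, phase, phase, ← exp_neg, ← exp_add]; congr 1; ring

theorem exp_neg_phase (u : ℂ) : exp (-I * P.y * u) = (P.phase u)⁻¹ := by
  rw [phase, ← exp_neg]; congr 1; ring

/-- The site matrices, as matrices on the auxiliary space, are given by the entries of `R`. -/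
theorem R_apply (u t : ℂ) (s h r k : Fin 2) : P.R u t (s, h) (r, k) =
    if s = 0 ∧ h = 0 ∧ r = 0 ∧ k = 0 ∨ s = 1 ∧ h = 1 ∧ r = 1 ∧ k = 1 then P.wa u
    else if s = 0 ∧ h = 1 ∧ r = 0 ∧ k = 1 then P.phase P.η * P.wb u t
    else if s = 0 ∧ h = 1 ∧ r = 1 ∧ k = 0 then P.phase u * P.wc u t
    else if s = 1 ∧ h = 0 ∧ r = 0 ∧ k = 1 then (P.phase u)⁻¹ * P.wc u (-t)
    else if s = 1 ∧ h = 0 ∧ r = 1 ∧ k = 0 then (P.phase P.η)⁻¹ * P.wb u (-t)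
    else 0 := by
  rw [← exp_neg_phase, ← exp_neg_phase, R]
  fin_cases s <;> fin_cases h <;> fin_cases r <;> fin_cases k <;>
    simp [finProdFinEquiv, phase]

theorem R_eq_zero {u t : ℂ} {s h r k : Fin 2} (hne : (s : ℕ) + h ≠ r + k) :
    P.R u t (s, h) (r, k) = 0 := by
  rw [R_apply]
  fin_cases s <;> fin_cases h <;> fin_cases r <;> fin_cases k <;> simp at hne ⊢

/-- The local two-row matrix with the row `u` above the row `v`. -/
def twoRow (u v t : ℂ) (h k : Fin 2) : Matrix (Fin 2 × Fin 2) (Fin 2 × Fin 2) ℂ :=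
  Matrix.of fun p q => ∑ l, P.R u t (p.1, h) (q.1, l) *
    P.R v (t + P.η * sz q.1) (p.2, l) (q.2, k)

/-- The local two-row matrix with the row `v` above the row `u`. -/
def twoRow' (u v t : ℂ) (h k : Fin 2) : Matrix (Fin 2 × Fin 2) (Fin 2 × Fin 2) ℂ :=
  Matrix.of fun p q => ∑ l, P.R v t (p.2, h) (q.2, l) *
    P.R u (t + P.η * sz q.2) (p.1, l) (q.1, k)

theorem sz_zero : sz 0 = 1 := by simp [sz]

theorem sz_one : sz 1 = -1 := by simp [sz]; norm_num

/-- The dynamical Yang-Baxter equation. -/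
theorem R_mul_twoRow (hω : 0 < P.ω.im) {t : ℂ} (h0 : theta P.ω t ≠ 0)
    (h1 : theta P.ω (t + P.η) ≠ 0) (h2 : theta P.ω (t - P.η) ≠ 0) (u v : ℂ) (h k : Fin 2) :
    P.R (u - v) (t + P.η * sz h) * P.twoRow u v t h k =
      P.twoRow' u v t h k * P.R (u - v) t := by
  have hE := P.phase_ne_zero P.η
  have hU := P.phase_ne_zero u
  have hV := P.phase_ne_zero v
  ext ⟨i, j⟩ ⟨i', j'⟩
  simp only [Matrix.mul_apply, Fintype.sum_prod_type, Fin.sum_univ_two, twoRow, twoRow',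
    Matrix.of_apply]
  -- Ice rule: an entry which does not conserve the total spin vanishes on both sides.
  by_cases hne : (h : ℕ) + i + j ≠ k + i' + j'
  · fin_cases h <;> fin_cases i <;> fin_cases j <;> fin_cases k <;> fin_cases i' <;>
      fin_cases j' <;> simp at hne <;> simp [R_apply]
  fin_cases h <;> fin_cases i <;> fin_cases j <;> fin_cases k <;> fin_cases i' <;>
      fin_cases j' <;> simp at hne <;>
      simp [R_apply, sz_zero, sz_one, phase_sub, ← sub_eq_add_neg, -neg_add_rev, -neg_sub] <;>
      field_simp
  all_goals first
    | linear_combination P.weights_exchange_00_01_01 hω h0 h1 u v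
    | linear_combination P.weights_exchange_00_01_10 hω h0 h1 u v
    | linear_combination P.weights_exchange_00_10_01 hω h0 h1 u v
    | linear_combination P.weights_exchange_01_01_00 hω h0 h1 u v
    | linear_combination P.weights_exchange_01_10_00 hω h0 h1 u v
    | linear_combination P.weights_exchange_01_11_01 hω h2 h0 u v
    | linear_combination P.weights_exchange_01_11_10 hω h2 h0 u v
    | linear_combination P.weights_exchange_10_00_01 hω h0 h1 u v
    | linear_combination P.weights_exchange_10_00_10 hω h0 h1 u v
    | linear_combination P.weights_exchange_10_01_11 hω h2 h0 u v
    | linear_combination P.weights_exchange_10_10_11 hω h2 h0 u v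
    | linear_combination P.weights_exchange_11_01_10 hω h2 h0 u v
    | linear_combination P.weights_exchange_11_10_01 hω h2 h0 u v
    | linear_combination P.weights_exchange_11_10_10 hω h2 h0 u v
    -- The remaining entries are products of weights that agree without any theta identity.
    | (try simp only [wb_neg]
       try simp only [wb, add_sub_cancel_right, sub_add_cancel]
       try field_simp
       try ring)

end Model
end
end SOS

/-! ### Monodromy matrices by recursion on the chain, and their exchange relation. -/

namespace SOS
noncomputable section

open Complex

namespace Model

variable (P : Model)

/-- The entries of `R` for fixed states of the quantum site, as a matrix on the auxiliary space. -/
def siteL (u t : ℂ) (h k : Fin 2) : Matrix (Fin 2) (Fin 2) ℂ :=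
  Matrix.of fun s r => P.R u t (s, h) (r, k)

/-- The monodromy matrix of a chain, for fixed states of the quantum space, as a matrix on the
auxiliary space. -/
def path : (n : ℕ) → (Fin n → ℂ) → ℂ → ℂ → (Fin n → Fin 2) → (Fin n → Fin 2) →
    Matrix (Fin 2) (Fin 2) ℂ
  | 0, _, _, _, _, _ => 1
  | n + 1, ξ, u, t, h, k => path n (Fin.tail ξ) u (t + P.η * sz (h 0)) (Fin.tail h) (Fin.tail k) *
      P.siteL (u - ξ 0) t (h 0) (k 0)

/-- The two-row monodromy matrix of a chain. -/
def pathTwo : (n : ℕ) → (Fin n → ℂ) → ℂ → ℂ → ℂ → (Fin n → Fin 2) → (Fin n → Fin 2) →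
    Matrix (Fin 2 × Fin 2) (Fin 2 × Fin 2) ℂ
  | 0, _, _, _, _, _, _ => 1
  | n + 1, ξ, u, v, t, h, k =>
      pathTwo n (Fin.tail ξ) u v (t + P.η * sz (h 0)) (Fin.tail h) (Fin.tail k) *
        P.twoRow (u - ξ 0) (v - ξ 0) t (h 0) (k 0)

theorem sum_conf_succ {n : ℕ} (f : (Fin (n + 1) → Fin 2) → ℂ) :
    ∑ l, f l = ∑ a : Fin 2, ∑ l : Fin n → Fin 2, f (Fin.cons a l) := by
  rw [← Fintype.sum_prod_type' (f := fun a (l : Fin n → Fin 2) => f (Fin.cons a l))]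
  exact (Equiv.sum_comp (Fin.consEquiv fun _ => Fin 2) f).symm

theorem conf_succ_ext_iff {n : ℕ} {h k : Fin (n + 1) → Fin 2} :
    h = k ↔ h 0 = k 0 ∧ Fin.tail h = Fin.tail k := by
  constructor
  · rintro rfl; exact ⟨rfl, rfl⟩
  · rintro ⟨h0, h1⟩
    rw [← Fin.cons_self_tail h, ← Fin.cons_self_tail k, h0, h1]

theorem sum_reorder {A B C D : Type*} [Fintype A] [Fintype B] [Fintype C] [Fintype D]
    (f : A → B → C → D → ℂ) :
    ∑ a, ∑ b, ∑ c, ∑ d, f a b c d = ∑ c, ∑ d, ∑ b, ∑ a, f a b c d := by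
  calc ∑ a, ∑ b, ∑ c, ∑ d, f a b c d = ∑ a, ∑ c, ∑ b, ∑ d, f a b c d :=
        Finset.sum_congr rfl fun a _ => Finset.sum_comm
    _ = ∑ c, ∑ a, ∑ b, ∑ d, f a b c d := Finset.sum_comm
    _ = ∑ c, ∑ a, ∑ d, ∑ b, f a b c d :=
        Finset.sum_congr rfl fun c _ => Finset.sum_congr rfl fun a _ => Finset.sum_comm
    _ = ∑ c, ∑ d, ∑ a, ∑ b, f a b c d := Finset.sum_congr rfl fun c _ => Finset.sum_comm
    _ = ∑ c, ∑ d, ∑ b, ∑ a, f a b c d :=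
        Finset.sum_congr rfl fun c _ => Finset.sum_congr rfl fun d _ => Finset.sum_comm

/-- `pathTwo` multiplies site by site, whereas a product of operators multiplies row by row. The
dynamical parameters of the two orderings agree because each vertex conserves the sum of the spins
of its line and its site. -/
theorem pathTwo_apply (n : ℕ) (ξ : Fin n → ℂ) (u v t : ℂ) (h k : Fin n → Fin 2)
    (p q : Fin 2 × Fin 2) : P.pathTwo n ξ u v t h k p q =
      ∑ l, P.path n ξ u t h l p.1 q.1 * P.path n ξ v (t + P.η * sz q.1) l k p.2 q.2 := by
  induction n generalizing t p q with
  | zero =>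
    simp only [pathTwo, path, Finset.univ_unique, Finset.sum_singleton, Matrix.one_apply]
    obtain ⟨p1, p2⟩ := p
    obtain ⟨q1, q2⟩ := q
    by_cases h1 : p1 = q1 <;> by_cases h2 : p2 = q2 <;> simp [h1, h2]
  | succ n ih =>
    simp only [pathTwo, Matrix.mul_apply, sum_conf_succ, path, Fin.cons_zero, Fin.tail_cons, ih,
      twoRow, Matrix.of_apply, siteL, Fintype.sum_prod_type]
    simp only [Finset.sum_mul_sum]
    rw [Finset.sum_comm, sum_reorder, Finset.sum_comm]
    refine Finset.sum_congr rfl fun a _ => Finset.sum_congr rfl fun l _ =>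
      Finset.sum_congr rfl fun r _ => Finset.sum_congr rfl fun r' _ => ?_
    by_cases hr : (r : ℕ) + h 0 = q.1 + a
    · have hsz : sz r + sz (h 0) = sz q.1 + sz a := by
        have : ((r : ℕ) : ℂ) + (h 0 : ℕ) = (q.1 : ℕ) + (a : ℕ) := by exact_mod_cast hr
        simp only [sz]
        linear_combination -2 * this
      rw [show t + P.η * sz (h 0) + P.η * sz r = t + P.η * sz q.1 + P.η * sz a by
        linear_combination P.η * hsz]
      ring
    · rw [P.R_eq_zero hr]
      ring

theorem shift_ne_zero {t : ℂ} (ht : ∀ k : ℤ, theta P.ω (t + k * P.η) ≠ 0) (a : Fin 2) (k : ℤ) :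
    theta P.ω (t + P.η * sz a + k * P.η) ≠ 0 := by
  fin_cases a
  · have := ht (k + 1)
    simp only [Fin.zero_eta, sz_zero]; push_cast at this; convert this using 2; ring
  · have := ht (k - 1)
    simp only [Fin.mk_one, sz_one]; push_cast at this; convert this using 2; ring

/-- The exchange relation for two-row monodromy matrices. -/
theorem R_mul_pathTwo (hω : 0 < P.ω.im) (n : ℕ) (ξ : Fin n → ℂ) (u v : ℂ) {t : ℂ}
    (ht : ∀ k : ℤ, theta P.ω (t + k * P.η) ≠ 0) (h k : Fin n → Fin 2) :
    P.R (u - v) (t + P.η * ∑ m, sz (h m)) * P.pathTwo n ξ u v t h k =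
      (P.pathTwo n ξ v u t h k).submatrix Prod.swap Prod.swap * P.R (u - v) t := by
  induction n generalizing t with
  | zero =>
    simp only [pathTwo, Finset.univ_eq_empty, Finset.sum_empty, mul_zero, add_zero, mul_one]
    rw [Matrix.submatrix_one _ Prod.swap_injective, one_mul]
  | succ n ih =>
    have ht' := P.shift_ne_zero ht (h 0)
    have h1 := ih (Fin.tail ξ) ht' (Fin.tail h) (Fin.tail k)
    have h2 := P.R_mul_twoRow hω (by simpa using ht 0) (by simpa using ht 1)
      (by simpa [sub_eq_add_neg] using ht (-1)) (u - ξ 0) (v - ξ 0) (h 0) (k 0)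
    rw [sub_sub_sub_cancel_right] at h2
    have h3 : P.twoRow' (u - ξ 0) (v - ξ 0) t (h 0) (k 0) =
        (P.twoRow (v - ξ 0) (u - ξ 0) t (h 0) (k 0)).submatrix Prod.swap Prod.swap := rfl
    have h4 : t + P.η * ∑ m, sz (h m) = t + P.η * sz (h 0) + P.η * ∑ m, sz (Fin.tail h m) := by
      rw [Fin.sum_univ_succ]; simp only [Fin.tail]; ring
    simp only [pathTwo]
    rw [h4, ← mul_assoc, h1, mul_assoc, h2, h3, ← mul_assoc]
    congr 1
    exact Matrix.submatrix_mul_equiv _ _ _ (Equiv.prodComm (Fin 2) (Fin 2)) _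

/-- A matrix on a chain built from a family of matrices on the chain without its first site, which
acts diagonally on the first site. -/
def consMatrix {n : ℕ} (F : Fin 2 → Matrix (Fin 2 × (Fin n → Fin 2)) (Fin 2 × (Fin n → Fin 2)) ℂ) :
    Matrix (Fin 2 × (Fin (n + 1) → Fin 2)) (Fin 2 × (Fin (n + 1) → Fin 2)) ℂ :=
  Matrix.of fun p q => if p.2 0 = q.2 0 then
    F (q.2 0) (p.1, Fin.tail p.2) (q.1, Fin.tail q.2) else 0

theorem consMatrix_one {n : ℕ} : consMatrix (n := n) (fun _ => 1) = 1 := by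
  ext ⟨i, h⟩ ⟨j, k⟩
  simp only [consMatrix, Matrix.of_apply, Matrix.one_apply, Prod.mk.injEq, conf_succ_ext_iff]
  by_cases h0 : h 0 = k 0 <;> simp [h0]

theorem consMatrix_mul {n : ℕ}
    (F G : Fin 2 → Matrix (Fin 2 × (Fin n → Fin 2)) (Fin 2 × (Fin n → Fin 2)) ℂ) :
    consMatrix F * consMatrix G = consMatrix fun a => F a * G a := by
  ext ⟨i, h⟩ ⟨j, k⟩
  simp only [consMatrix, Matrix.mul_apply, Matrix.of_apply, Fintype.sum_prod_type, sum_conf_succ,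
    Fin.cons_zero, Fin.tail_cons]
  by_cases h0 : h 0 = k 0
  · simp only [h0, if_true]
    refine Finset.sum_congr rfl fun s _ => ?_
    rw [Finset.sum_eq_single (k 0)]
    · simp
    · intro a _ ha; simp [ha]
    · simp
  · simp only [h0, if_false]
    refine Finset.sum_eq_zero fun s _ => Finset.sum_eq_zero fun a _ =>
      Finset.sum_eq_zero fun l _ => ?_
    by_cases ha : h 0 = a
    · rw [if_neg (fun h' => h0 (ha.trans h')), mul_zero]
    · simp [ha]

theorem consMatrix_list_prod {n : ℕ}
    (l : List (Fin 2 → Matrix (Fin 2 × (Fin n → Fin 2)) (Fin 2 × (Fin n → Fin 2)) ℂ)) :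
    (l.map consMatrix).prod = consMatrix l.prod := by
  induction l with
  | nil => exact consMatrix_one.symm
  | cons F l ih => rw [List.map_cons, List.prod_cons, List.prod_cons, ih, consMatrix_mul]; rfl

/-- The model with the chain replaced. -/
abbrev withChain (n : ℕ) (ξ : Fin n → ℂ) : Model := { P with N := n, ξ := ξ }

theorem siteR_succ {n : ℕ} (ξ : Fin (n + 1) → ℂ) (u t : ℂ) (m : Fin n) :
    (P.withChain (n + 1) ξ).siteR u t m.succ =
      consMatrix fun a => (P.withChain n (Fin.tail ξ)).siteR u (t + P.η * sz a) m := by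
  ext ⟨i, h⟩ ⟨j, k⟩
  simp only [siteR, consMatrix, Matrix.of_apply]
  have e1 : (∀ l, l ≠ m.succ → h l = k l) ↔
      h 0 = k 0 ∧ ∀ l, l ≠ m → Fin.tail h l = Fin.tail k l := by
    rw [Fin.forall_fin_succ]
    simp [Fin.tail, (Fin.succ_ne_zero m).symm]
  have e2 : ∑ l ∈ Finset.univ.filter (fun l => l < m.succ), sz (k l) =
      sz (k 0) + ∑ l ∈ Finset.univ.filter (fun l => l < m), sz (Fin.tail k l) := by
    rw [Finset.sum_filter, Fin.sum_univ_succ, Finset.sum_filter]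
    simp [Fin.tail, Fin.succ_lt_succ_iff]
  rw [e2]
  by_cases h0 : h 0 = k 0
  · simp only [e1, h0, true_and, if_true]
    congr 1
    rw [show t + P.η * (sz (k 0) + ∑ l ∈ Finset.univ.filter (fun l => l < m), sz (Fin.tail k l)) =
      t + P.η * sz (k 0) + P.η * ∑ l ∈ Finset.univ.filter (fun l => l < m), sz (Fin.tail k l)
      by ring]
    rfl
  · simp only [e1, h0, false_and, if_false]

theorem siteR_zero {n : ℕ} (ξ : Fin (n + 1) → ℂ) (u t : ℂ) (i j : Fin 2)
    (h k : Fin (n + 1) → Fin 2) : (P.withChain (n + 1) ξ).siteR u t (0 : Fin (n + 1)) (i, h) (j, k) =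
      if Fin.tail h = Fin.tail k then P.R (u - ξ 0) t (i, h 0) (j, k 0) else 0 := by
  have e1 : (∀ l, l ≠ 0 → h l = k l) ↔ Fin.tail h = Fin.tail k := by
    rw [Fin.forall_fin_succ, funext_iff]
    simp [Fin.tail]
  simp only [siteR, Matrix.of_apply, e1]
  simp
  rfl

/-- The factor of the first site stands rightmost. All other factors act diagonally on that site and
see it only through the shift `t + η σᶻ`, so they form the monodromy matrix of the shorter chain. -/
theorem monodromy_withChain (n : ℕ) (ξ : Fin n → ℂ) (u t : ℂ) (i j : Fin 2) (h k : Fin n → Fin 2) :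
    (P.withChain n ξ).monodromy u t (i, h) (j, k) = P.path n ξ u t h k i j := by
  induction n generalizing t i j with
  | zero =>
    simp only [monodromy, path, List.ofFn_zero, List.reverse_nil, List.prod_nil, Matrix.one_apply,
      Prod.mk.injEq]
    simp [Subsingleton.elim h k]
  | succ n ih =>
    rw [monodromy, List.ofFn_succ, List.reverse_cons, List.prod_append, List.prod_singleton]
    have e1 : (List.ofFn fun m : Fin n => (P.withChain (n + 1) ξ).siteR u t m.succ).reverse =
        (((List.ofFn fun m : Fin n => fun a : Fin 2 =>
          (P.withChain n (Fin.tail ξ)).siteR u (t + P.η * sz a) m)).reverse).map consMatrix := by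
      rw [List.map_reverse, List.map_ofFn]
      congr 2
      funext m
      exact P.siteR_succ ξ u t m
    have e2 (a : Fin 2) : ((List.ofFn fun m : Fin n => fun a : Fin 2 =>
          (P.withChain n (Fin.tail ξ)).siteR u (t + P.η * sz a) m)).reverse.prod a =
        (P.withChain n (Fin.tail ξ)).monodromy u (t + P.η * sz a) := by
      rw [monodromy, Pi.list_prod_apply, List.map_reverse, List.map_ofFn]
      rfl
    change (_ * _ : Matrix (Fin 2 × (Fin (n + 1) → Fin 2)) (Fin 2 × (Fin (n + 1) → Fin 2)) ℂ) _ _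
      = _
    rw [e1, consMatrix_list_prod, Matrix.mul_apply]
    simp only [path, Matrix.mul_apply, Fintype.sum_prod_type, consMatrix, Matrix.of_apply,
      e2, ih]
    refine Finset.sum_congr rfl fun s _ => ?_
    -- The left factor fixes the first spin and the right factor fixes all the others, so only one
    -- intermediate configuration contributes.
    rw [Finset.sum_eq_single (Fin.cons (h 0) (Fin.tail k))]
    · simp only [Fin.cons_zero, if_true, Fin.tail_cons, siteL, Matrix.of_apply]
      congr 1
      exact (P.siteR_zero ξ u t s j _ k).trans (by simp)
    · intro l _ hl
      by_cases h0 : h 0 = l 0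
      · have : Fin.tail l ≠ Fin.tail k := fun h1 => hl (by
          rw [h0, ← h1, Fin.cons_self_tail])
        exact mul_eq_zero_of_right _ ((P.siteR_zero ξ u t s j l k).trans (if_neg this))
      · simp [h0]
    · simp

theorem monodromy_eq_path (u t : ℂ) (i j : Fin 2) (h k : P.Conf) :
    P.monodromy u t (i, h) (j, k) = P.path P.N P.ξ u t h k i j :=
  P.monodromy_withChain P.N P.ξ u t i j h k

end Model
end
end SOS

namespace SOS
noncomputable section

open Complex

theorem theta_sub_pi (ω z : ℂ) : theta ω (z - Real.pi) = -theta ω z := by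
  have := theta_add_pi ω (z - Real.pi)
  rw [sub_add_cancel] at this
  rw [this, neg_neg]

theorem theta_sub_pi_mul (ω z : ℂ) : theta ω (z - Real.pi * ω) =
    -exp (-(I * Real.pi * ω) + 2 * I * z) * theta ω z := by
  have := theta_add_pi_mul ω (z - Real.pi * ω)
  rw [sub_add_cancel] at this
  rw [this, neg_mul, neg_mul, mul_neg, neg_neg, ← mul_assoc, ← exp_add,
    show -(I * Real.pi * ω) + 2 * I * z + (-(I * Real.pi * ω) -
      2 * I * (z - Real.pi * ω)) = 0 by ring, exp_zero, one_mul]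

namespace Model

variable (P : Model)

/-! ### Properties of the `R`-matrix -/

/-- `sector` is a period. In the ratio only the part of the quasi-period multiplier that depends on
`z` survives, and for the four values of `(x,y)` it is `e^{2iyz}`. No condition on `t` is required:
if `θ(t) = 0`, both denominators vanish and both quotients are `0` by convention. -/
theorem theta_sub_sector_div (hx : P.x = 0 ∨ P.x = 1) (hy : P.y = 0 ∨ P.y = 1) (t z : ℂ) :
    theta P.ω (t - P.sector + z) / theta P.ω (t - P.sector) =
      P.phase z ^ 2 * (theta P.ω (t + z) / theta P.ω t) := by
  have h3 : -exp (-(I * Real.pi * P.ω) + 2 * I * (t + z)) =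
      exp (2 * I * z) * -exp (-(I * Real.pi * P.ω) + 2 * I * t) := by
    rw [mul_neg, ← exp_add]; congr 2; ring
  have h4 : -exp (-(I * Real.pi * P.ω) + 2 * I * t) ≠ 0 := neg_ne_zero.mpr (exp_ne_zero _)
  have h5 : exp (I * z) ^ 2 = exp (2 * I * z) := by
    rw [← exp_nat_mul]; congr 1; push_cast; ring
  rw [sector, phase]
  rcases hx with hx | hx <;> rcases hy with hy | hy <;> rw [hx, hy]
  · simp
  · simp only [Nat.cast_zero, Nat.cast_one, zero_mul, zero_add, one_mul, mul_one]
    rw [show t - Real.pi * P.ω + z = (t + z) - Real.pi * P.ω by ring, theta_sub_pi_mul, theta_sub_pi_mul, h3, h5,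
      mul_assoc, mul_div_assoc, mul_div_mul_left _ _ h4]
  · simp only [Nat.cast_zero, Nat.cast_one, zero_mul, add_zero, one_mul, mul_zero, exp_zero,
      one_pow]
    rw [show t - Real.pi + z = (t + z) - Real.pi by ring, theta_sub_pi, theta_sub_pi, neg_div_neg_eq]
  · simp only [Nat.cast_one, one_mul, mul_one]
    rw [show t - (Real.pi + Real.pi * P.ω) + z = ((t + z) - Real.pi * P.ω) - Real.pi by ring,
      show t - (Real.pi + Real.pi * P.ω) = (t - Real.pi * P.ω) - Real.pi by ring, theta_sub_pi, theta_sub_pi, theta_sub_pi_mul, theta_sub_pi_mul,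
      h3, h5, neg_div_neg_eq, mul_assoc, mul_div_assoc, mul_div_mul_left _ _ h4]

theorem phase_neg (u : ℂ) : P.phase (-u) = (P.phase u)⁻¹ := by
  rw [phase, phase, ← exp_neg]; congr 1; ring

/-- Flipping all spins exchanges `t` with `-t` in the weights. The additional translation by
`sector` produces squares of phases, which the prefactors `e^{±iyη}`, `e^{±iyu}` in `R` absorb
exactly. -/
theorem R_flip (hx : P.x = 0 ∨ P.x = 1) (hy : P.y = 0 ∨ P.y = 1) (w t : ℂ) (a b c d : Fin 2) :
    P.R w (-(t - P.sector)) (1 - a, 1 - b) (1 - c, 1 - d) = P.R w t (a, b) (c, d) := by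
  have hE := P.phase_ne_zero P.η
  have hU := P.phase_ne_zero w
  have h1 : P.wb w (t - P.sector) = P.phase P.η ^ 2 * P.wb w t := by
    rw [wb, mul_div_assoc, P.theta_sub_sector_div hx hy, wb]; ring
  have h2 : P.wc w (t - P.sector) = P.phase w ^ 2 * P.wc w t := by
    rw [wc, mul_div_assoc, P.theta_sub_sector_div hx hy, wc]; ring
  have h3 : P.wb w (-(t - P.sector)) = ((P.phase P.η)⁻¹) ^ 2 * P.wb w (-t) := by
    rw [wb_neg, wb_neg, mul_div_assoc, sub_eq_add_neg (t - P.sector), P.theta_sub_sector_div hx hy,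
      phase_neg, ← sub_eq_add_neg]
    ring
  have h4 : P.wc w (-(t - P.sector)) = ((P.phase w)⁻¹) ^ 2 * P.wc w (-t) := by
    rw [wc_neg, wc_neg, mul_div_assoc, sub_eq_add_neg (t - P.sector), P.theta_sub_sector_div hx hy,
      phase_neg, ← sub_eq_add_neg]
    ring
  fin_cases a <;> fin_cases b <;> fin_cases c <;> fin_cases d <;>
    simp [R_apply, h1, h2, h3, h4, -neg_sub] <;> field_simp

/-- By Weierstrass' relation the middle block has determinant `θ(w + η) θ(w - η)`, independent of
`t`; the phases cancel in it. -/
theorem exists_R_inverse (hω : 0 < P.ω.im) {w t : ℂ} (h0 : theta P.ω t ≠ 0)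
    (h1 : theta P.ω (w + P.η) ≠ 0) (h2 : theta P.ω (w - P.η) ≠ 0) :
    ∃ S : Matrix (Fin 2 × Fin 2) (Fin 2 × Fin 2) ℂ, P.R w t * S = 1 ∧ S * P.R w t = 1 := by
  have hE := P.phase_ne_zero P.η
  have hU := P.phase_ne_zero w
  have hdet : P.wb w t * P.wb w (-t) - P.wc w t * P.wc w (-t) =
      theta P.ω (w + P.η) * theta P.ω (w - P.η) := by
    have hW := theta_weierstrass hω t P.η w 0
    rw [wb_neg, wc_neg, wb, wc]
    simp only [add_zero, sub_zero] at hW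
    rw [show P.η + w = w + P.η by ring, show P.η - w = -(w - P.η) by ring, theta_neg] at hW
    field_simp
    linear_combination hW
  have hD : theta P.ω (w + P.η) * theta P.ω (w - P.η) ≠ 0 := mul_ne_zero h1 h2
  generalize theta P.ω (w + P.η) * theta P.ω (w - P.η) = D at hdet hD
  have ha : P.wa w ≠ 0 := h1
  let S : Matrix (Fin 2 × Fin 2) (Fin 2 × Fin 2) ℂ := Matrix.of fun p q =>
    if p = q ∧ p.1 = p.2 then (P.wa w)⁻¹
    else if p = (0, 1) ∧ q = (0, 1) then (P.phase P.η)⁻¹ * P.wb w (-t) / D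
    else if p = (0, 1) ∧ q = (1, 0) then -(P.phase w * P.wc w t) / D
    else if p = (1, 0) ∧ q = (0, 1) then -((P.phase w)⁻¹ * P.wc w (-t)) / D
    else if p = (1, 0) ∧ q = (1, 0) then P.phase P.η * P.wb w t / D
    else 0
  have hS : P.R w t * S = 1 := by
    ext ⟨a, b⟩ ⟨c, d⟩
    simp only [Matrix.mul_apply, Fintype.sum_prod_type, Fin.sum_univ_two, Matrix.one_apply, S,
      Matrix.of_apply]
    fin_cases a <;> fin_cases b <;> fin_cases c <;> fin_cases d <;>
      simp [R_apply, ha] <;> field_simp <;>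
      first | ring1 | linear_combination hdet
  exact ⟨S, hS, mul_eq_one_comm.mp hS⟩

/-! ### Quasi-periodicity of the monodromy matrix -/

/-- The exponent of the gauge factor for the quasi-period `πω`. -/
def gaugeExp (s : Fin 2) (t : ℂ) : ℂ :=
  -(I * t * sz s) + I * P.y * (Real.pi * P.ω) * ((1 + sz s) / 2)

/-- The multipliers of different entries differ by a gauge factor at the output minus one at the
input of the auxiliary line, evaluated at the local dynamical parameter. In this form the factors
telescope along the chain, leaving only its two ends in `isThetaFun_path`. -/
theorem isThetaFun_R (hω : 0 < P.ω.im) (ζ t : ℂ) (s h r k : Fin 2) :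
    IsThetaFun P.ω 1 (-exp (I * P.y * Real.pi * ((sz s - sz r) / 2)))
      (-exp (-(I * Real.pi * P.ω) + 2 * I * ζ - I * P.η + P.gaugeExp s (t + P.η * sz h) -
        P.gaugeExp r t)) (fun u => P.R (u - ζ) t (s, h) (r, k)) := by
  have hph : IsThetaFun P.ω 0 (exp (I * P.y * Real.pi)) (exp (I * P.y * (Real.pi * P.ω)))
      (fun u => P.phase (u - ζ)) := by
    refine ⟨by unfold phase; fun_prop, fun z => ?_, fun z => ?_⟩
    · rw [phase, phase, ← exp_add]; congr 1; ring
    · rw [phase, phase, ← exp_add, ← exp_add]; congr 1; push_cast; ring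
  have hph' : IsThetaFun P.ω 0 (exp (-(I * P.y * Real.pi))) (exp (-(I * P.y * (Real.pi * P.ω))))
      (fun u => (P.phase (u - ζ))⁻¹) := by
    simp_rw [← phase_neg]
    refine ⟨by unfold phase; fun_prop, fun z => ?_, fun z => ?_⟩
    · rw [phase, phase, ← exp_add]; congr 1; ring
    · rw [phase, phase, ← exp_add, ← exp_add]; congr 1; push_cast; ring
  have key {α β : ℂ} {f g : ℂ → ℂ} {α' β' : ℂ} (hf : IsThetaFun P.ω 1 α β f) (hα : α = α')
      (hβ : β = β') (hfg : ∀ u, f u = g u) : IsThetaFun P.ω 1 α' β' g := by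
    rw [← hα, ← hβ, ← funext hfg]; exact hf
  have hα (c : ℂ) (hc : c = 0) : (-1 : ℂ) = -exp c := by rw [hc, exp_zero]
  have hT (a : ℂ) := isThetaFun_theta hω a
  have hA := hT (ζ - P.η)
  have hB := (hT ζ)
  have hC := hph.mul (hT (ζ - t))
  have hC' := hph'.mul (hT (ζ + t))
  fin_cases s <;> fin_cases h <;> fin_cases r <;> fin_cases k <;>
    simp only [R_apply] <;> simp <;> try exact IsThetaFun.zero
  · refine key hA ?_ ?_ fun u => ?_
    · simp
    · simp only [gaugeExp, sz_zero]; congr 2; ring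
    · rw [wa]; congr 1; ring
  · refine key (hB.const_mul (P.phase P.η * (theta P.ω (t + P.η) / theta P.ω t))) ?_ ?_ fun u => ?_
    · simp
    · simp only [gaugeExp, sz_zero, sz_one]; congr 2; ring
    · rw [wb]; ring
  · refine key (hC.const_mul (theta P.ω P.η / theta P.ω t)) ?_ ?_ fun u => ?_
    · simp [sz_zero, sz_one]
    · simp only [gaugeExp, sz_zero, sz_one]; rw [mul_neg, ← exp_add]; congr 2; ring
    · rw [wc, show t + (u - ζ) = u - (ζ - t) by ring]; ring
  · refine key (hC'.const_mul (-theta P.ω P.η / theta P.ω t)) ?_ ?_ fun u => ?_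
    · simp [sz_zero, sz_one]; congr 1; ring
    · simp only [gaugeExp, sz_zero, sz_one]; rw [mul_neg, ← exp_add]; congr 2; ring
    · rw [wc_neg, show t - (u - ζ) = -(u - (ζ + t)) by ring, theta_neg]; ring
  · refine key (hB.const_mul ((P.phase P.η)⁻¹ * (theta P.ω (t - P.η) / theta P.ω t))) ?_ ?_
      fun u => ?_
    · simp
    · simp only [gaugeExp, sz_zero, sz_one]; congr 2; ring
    · rw [wb_neg]; ring
  · refine key hA ?_ ?_ fun u => ?_
    · simp
    · simp only [gaugeExp, sz_one]; congr 2; ring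
    · rw [wa]; congr 1; ring

theorem path_eq_zero (n : ℕ) {ξ : Fin n → ℂ} {u t : ℂ} {h k : Fin n → Fin 2} {i j : Fin 2}
    (hne : (i : ℕ) + ∑ m, (h m : ℕ) ≠ j + ∑ m, (k m : ℕ)) : P.path n ξ u t h k i j = 0 := by
  induction n generalizing t i j with
  | zero =>
    rw [path, Matrix.one_apply_ne]
    rintro rfl
    simp at hne
  | succ n ih =>
    rw [path, Matrix.mul_apply]
    refine Finset.sum_eq_zero fun s _ => ?_
    by_cases hs : (s : ℕ) + h 0 = j + k 0
    · rw [ih, zero_mul]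
      intro h1
      apply hne
      rw [Fin.sum_univ_succ, Fin.sum_univ_succ]
      simp only [Fin.tail] at h1
      omega
    · rw [siteL, Matrix.of_apply, P.R_eq_zero hs, mul_zero]

theorem isThetaFun_path (hω : 0 < P.ω.im) (n : ℕ) (ξ : Fin n → ℂ) (t : ℂ) (h k : Fin n → Fin 2)
    (i j : Fin 2) :
    IsThetaFun P.ω n ((-1) ^ n * exp (I * P.y * Real.pi * ((sz i - sz j) / 2)))
      ((-1) ^ n * exp (-(I * Real.pi * P.ω * n) + 2 * I * ∑ m, ξ m - I * P.η * n +
        P.gaugeExp i (t + P.η * ∑ m, sz (h m)) - P.gaugeExp j t))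
      (fun u => P.path n ξ u t h k i j) := by
  induction n generalizing t i j with
  | zero =>
    by_cases hij : i = j
    · subst hij
      simp only [path, Matrix.one_apply_eq]
      refine ⟨by fun_prop, fun z => ?_, fun z => ?_⟩ <;> simp
    · simp only [path, Matrix.one_apply_ne hij]
      exact IsThetaFun.zero
  | succ n ih =>
    simp only [path, Matrix.mul_apply, siteL, Matrix.of_apply]
    refine IsThetaFun.sum fun s _ => ?_
    have := (ih (Fin.tail ξ) (t + P.η * sz (h 0)) (Fin.tail h) (Fin.tail k) i s).mul
      (P.isThetaFun_R hω (ξ 0) t s (h 0) j (k 0))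
    have aux {A B C : ℂ} (hC : C = A + B) :
        (-1) ^ (n + 1) * exp C = (-1) ^ n * exp A * -exp B := by
      rw [hC, exp_add]; ring
    convert this using 1
    · exact aux (by ring)
    · refine aux ?_
      rw [Fin.sum_univ_succ, Fin.sum_univ_succ]
      simp only [Fin.tail]
      rw [show t + P.η * (sz (h 0) + ∑ m : Fin n, sz (h m.succ)) =
        t + P.η * sz (h 0) + P.η * ∑ m : Fin n, sz (h m.succ) by ring]
      push_cast
      ring

end Model
end
end SOS

namespace SOS
noncomputable section

open Complex

namespace Model

variable (P : Model)

/-! ### The monodromy matrix on the antiperiodic sector -/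

/-- The parameters satisfy the hypotheses of the main theorem. -/
structure IsAdmissible : Prop where
  x_eq : P.x = 0 ∨ P.x = 1
  y_eq : P.y = 0 ∨ P.y = 1
  im_pos : 0 < P.ω.im
  eta_notMem : P.η ∉ periodLattice P.ω
  t0_notMem : ∀ k : ℤ, P.t0 + k * P.η ∉ periodLattice P.ω

/-- The number of sites with label `1`. -/
def deg {n : ℕ} (h : Fin n → Fin 2) : ℕ := ∑ m, (h m : ℕ)

/-- The value of the dynamical parameter attached to a configuration in the antiperiodic sector. -/
def tconf (h : P.Conf) : ℂ := P.t0 + P.η * deg h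

theorem sum_sz {n : ℕ} (h : Fin n → Fin 2) : ∑ m, sz (h m) = n - 2 * (deg h : ℂ) := by
  simp only [sz, deg, Finset.sum_sub_distrib, Finset.mul_sum, Nat.cast_sum]
  simp

/-- The defining property of the sector: on leaving the chain, the dynamical parameter has become
the reflected value in `R_flip`. -/
theorem tconf_add (h : P.Conf) :
    P.tconf h + P.η * ∑ m, sz (h m) = -(P.tconf h - P.sector) := by
  rw [sum_sz, tconf, sector, t0]; ring

namespace IsAdmissible

variable {P} (hP : P.IsAdmissible)
include hP

theorem theta_eta_ne_zero : theta P.ω P.η ≠ 0 := fun h =>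
  hP.eta_notMem ((theta_eq_zero_iff hP.im_pos).mp h)

theorem theta_t0_add_ne_zero (k : ℤ) : theta P.ω (P.t0 + k * P.η) ≠ 0 := fun h =>
  hP.t0_notMem k ((theta_eq_zero_iff hP.im_pos).mp h)

theorem theta_tconf_add_ne_zero (h : P.Conf) (k : ℤ) :
    theta P.ω (P.tconf h + k * P.η) ≠ 0 := by
  have := hP.theta_t0_add_ne_zero (deg h + k)
  rw [tconf]; push_cast at this; convert this using 2; ring

end IsAdmissible

/-- The entries of the monodromy matrix, as matrices on the antiperiodic sector. -/
def opM (i j : Fin 2) (u : ℂ) : Matrix P.Conf P.Conf ℂ :=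
  Matrix.of fun h k => P.path P.N P.ξ u (P.tconf h) h k i j

theorem opM_eq_zero {i j : Fin 2} {u : ℂ} {h k : P.Conf} (hne : (i : ℕ) + deg h ≠ j + deg k) :
    P.opM i j u h k = 0 :=
  P.path_eq_zero P.N hne

/-- An off-diagonal entry changes the degree by one, hence moves `tconf` by `η σᶻ` of its column
index. This is the shift that the two-row matrix gives to its lower row, so the restriction to `𝓑`
and `𝓒` as first factor is essential. -/
theorem opM_mul (j i' j' : Fin 2) (u v : ℂ) (h k : P.Conf) :
    (P.opM (1 - j) j u * P.opM i' j' v) h k =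
      P.pathTwo P.N P.ξ u v (P.tconf h) h k (1 - j, i') (j, j') := by
  rw [pathTwo_apply, Matrix.mul_apply]
  refine Finset.sum_congr rfl fun l _ => ?_
  by_cases hl : (((1 - j : Fin 2) : ℕ) + deg h = j + deg l)
  · have : P.tconf l = P.tconf h + P.η * sz j := by
      have : (((1 - j : Fin 2) : ℕ) : ℂ) + deg h = (j : ℕ) + deg l := by exact_mod_cast hl
      rw [tconf, tconf, sz]
      fin_cases j <;> simp at this ⊢ <;> linear_combination -P.η * this
    simp only [opM, Matrix.of_apply, this]
  · rw [P.opM_eq_zero hl, zero_mul]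
    rw [P.path_eq_zero P.N hl, zero_mul]

theorem continuous_pathTwo (hω : 0 < P.ω.im) (n : ℕ) (ξ : Fin n → ℂ) (t : ℂ) (h k : Fin n → Fin 2)
    (p q : Fin 2 × Fin 2) :
    Continuous fun z : ℂ × ℂ => P.pathTwo n ξ z.1 z.2 t h k p q := by
  simp only [pathTwo_apply]
  refine continuous_finsetSum _ fun l _ => ?_
  exact ((P.isThetaFun_path hω n ξ t h l p.1 q.1).diff.continuous.comp continuous_fst).mul
    ((P.isThetaFun_path hω n ξ _ l k p.2 q.2).diff.continuous.comp continuous_snd)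

/-- Let `F` be the spin flip weighted by `G`. By `R_flip` and the ice rule, `F R(-(t - sector)) =
R(t) F` when `G` depends only on the total spin. Tracing the exchange relation against `F` then
removes both `R`-matrices and interchanges `u` and `v`. -/
theorem sum_pathTwo_comm (hP : P.IsAdmissible) {G : Fin 2 × Fin 2 → ℂ}
    (hG : ∀ p q : Fin 2 × Fin 2, (p.1 : ℕ) + p.2 = q.1 + q.2 → G p = G q) (u v : ℂ)
    (h k : P.Conf) :
    ∑ q, G q * P.pathTwo P.N P.ξ u v (P.tconf h) h k (1 - q) q =
      ∑ q, G q * P.pathTwo P.N P.ξ v u (P.tconf h) h k (1 - q) q := by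
  have hω := hP.im_pos
  have hflip (a : Fin 2 × Fin 2) : 1 - (1 - a) = a := by simp
  have hη : theta P.ω P.η ≠ 0 := hP.theta_eta_ne_zero
  have ht0 : theta P.ω (P.tconf h) ≠ 0 := by simpa using hP.theta_tconf_add_ne_zero h 0
  have main (u : ℂ) (h1 : theta P.ω (u - v + P.η) ≠ 0) (h2 : theta P.ω (u - v - P.η) ≠ 0) :
      ∑ q, G q * P.pathTwo P.N P.ξ u v (P.tconf h) h k (1 - q) q =
      ∑ q, G q * P.pathTwo P.N P.ξ v u (P.tconf h) h k (1 - q) q := by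
    obtain ⟨S, hS, hS'⟩ := P.exists_R_inverse hω ht0 h1 h2
    have hex := P.R_mul_pathTwo hω P.N P.ξ u v (hP.theta_tconf_add_ne_zero h) h k
    rw [tconf_add] at hex
    let F : Matrix (Fin 2 × Fin 2) (Fin 2 × Fin 2) ℂ := Matrix.of fun p q =>
      if q = 1 - p then G p else 0
    have htr (K : Matrix (Fin 2 × Fin 2) (Fin 2 × Fin 2) ℂ) :
        (F * K).trace = ∑ q, G q * K (1 - q) q := by
      simp [Matrix.trace, Matrix.mul_apply, F]
    have hF : F * P.R (u - v) (-(P.tconf h - P.sector)) = P.R (u - v) (P.tconf h) * F := by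
      ext p q
      have e1 : (F * P.R (u - v) (-(P.tconf h - P.sector))) p q =
          G p * P.R (u - v) (-(P.tconf h - P.sector)) (1 - p) q := by
        simp [Matrix.mul_apply, F]
      have e2 : (P.R (u - v) (P.tconf h) * F) p q = P.R (u - v) (P.tconf h) p (1 - q) * G (1 - q) := by
        rw [Matrix.mul_apply, Finset.sum_eq_single (1 - q)]
        · simp [F]
        · intro r _ hr
          have : q ≠ 1 - r := by rintro rfl; exact hr (hflip r).symm
          simp [F, this]
        · simp
      have e3 := P.R_flip hP.x_eq hP.y_eq (u - v) (P.tconf h) p.1 p.2 (1 - q.1) (1 - q.2)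
      have e4 : (1 - (1 - q.1), 1 - (1 - q.2)) = q := hflip q
      rw [e4] at e3
      rw [e1, e2]
      change G p * P.R (u - v) (-(P.tconf h - P.sector)) (1 - p.1, 1 - p.2) q =
        P.R (u - v) (P.tconf h) (p.1, p.2) (1 - q.1, 1 - q.2) * G (1 - q)
      rw [e3]
      by_cases hs : (p.1 : ℕ) + p.2 = (1 - q.1 : Fin 2) + (1 - q.2 : Fin 2)
      · rw [hG p (1 - q) hs]; ring
      · rw [P.R_eq_zero hs]; ring
    have e : (F * (P.pathTwo P.N P.ξ v u (P.tconf h) h k).submatrix Prod.swap Prod.swap).trace =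
        (F * P.pathTwo P.N P.ξ u v (P.tconf h) h k).trace := by
      have : (P.pathTwo P.N P.ξ v u (P.tconf h) h k).submatrix Prod.swap Prod.swap =
          P.R (u - v) (-(P.tconf h - P.sector)) * P.pathTwo P.N P.ξ u v (P.tconf h) h k * S := by
        rw [hex, mul_assoc, hS, mul_one]
      rw [this, ← mul_assoc, ← mul_assoc, hF, Matrix.trace_mul_comm, mul_assoc, ← mul_assoc, hS',
        one_mul]
    rw [htr, htr] at e
    rw [← e, ← Equiv.sum_comp (Equiv.prodComm (Fin 2) (Fin 2))]
    refine Finset.sum_congr rfl fun q _ => ?_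
    rw [hG (Equiv.prodComm _ _ q) q (by simp [add_comm])]
    rfl
  have hc (p q : Fin 2 × Fin 2) :=
    P.continuous_pathTwo hω P.N P.ξ (P.tconf h) h k p q
  -- The values of `u` where `R(u - v)` is singular are zeros of an entire function that is non-zero
  -- at `u = v`; continuity in `u` removes them.
  refine eq_of_mul_eq_mul_entire (g := fun u => theta P.ω (u - v + P.η) * theta P.ω (u - v - P.η))
    (F := fun u => ∑ q, G q * P.pathTwo P.N P.ξ u v (P.tconf h) h k (1 - q) q)
    (G := fun u => ∑ q, G q * P.pathTwo P.N P.ξ v u (P.tconf h) h k (1 - q) q)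
    (z₀ := v) ?_ ?_ (Continuous.continuousAt ?_) (Continuous.continuousAt ?_)
    (Filter.Eventually.of_forall fun z => ?_)
  · exact ((differentiable_theta hω).comp (by fun_prop)).mul
      ((differentiable_theta hω).comp (by fun_prop))
  · simp [theta_neg, hη]
  · exact continuous_finsetSum _ fun q _ => continuous_const.mul
      ((hc _ _).comp (continuous_id.prodMk continuous_const))
  · exact continuous_finsetSum _ fun q _ => continuous_const.mul
      ((hc _ _).comp (continuous_const.prodMk continuous_id))
  · by_cases h1 : theta P.ω (z - v + P.η) = 0
    · simp [h1]
    by_cases h2 : theta P.ω (z - v - P.η) = 0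
    · simp [h2]
    simp only [main z h1 h2]

/-- The twisted antiperiodic transfer matrix on the antiperiodic sector. -/
def transferMatrix (κ u : ℂ) : Matrix P.Conf P.Conf ℂ := κ⁻¹ • P.opM 0 1 u + κ • P.opM 1 0 u

theorem transferMatrix_mul (κ u v : ℂ) (h k : P.Conf) :
    (P.transferMatrix κ u * P.transferMatrix κ v) h k =
      ∑ q : Fin 2 × Fin 2, ((![κ, κ⁻¹] q.1) * (![κ, κ⁻¹] q.2)) *
        P.pathTwo P.N P.ξ u v (P.tconf h) h k (1 - q) q := by
  have e00 := P.opM_mul 0 1 0 u v h k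
  have e01 := P.opM_mul 0 0 1 u v h k
  have e10 := P.opM_mul 1 1 0 u v h k
  have e11 := P.opM_mul 1 0 1 u v h k
  rw [Fintype.sum_prod_type]
  simp only [Fin.sum_univ_two]
  simp only [sub_self, sub_zero] at e00 e01 e10 e11
  have f00 : (1 : Fin 2 × Fin 2) - (0, 0) = (1, 1) := rfl
  have f01 : (1 : Fin 2 × Fin 2) - (0, 1) = (1, 0) := rfl
  have f10 : (1 : Fin 2 × Fin 2) - (1, 0) = (0, 1) := rfl
  have f11 : (1 : Fin 2 × Fin 2) - (1, 1) = (0, 0) := rfl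
  rw [f00, f01, f10, f11, ← e00, ← e01, ← e10, ← e11]
  simp only [transferMatrix, add_mul, mul_add, Matrix.smul_mul, Matrix.mul_smul, Matrix.add_apply,
    Matrix.smul_apply, smul_eq_mul, Matrix.cons_val_zero, Matrix.cons_val_one]
  ring

theorem commute_transferMatrix (hP : P.IsAdmissible) {κ : ℂ} (hκ : κ ≠ 0) (u v : ℂ) :
    Commute (P.transferMatrix κ u) (P.transferMatrix κ v) := by
  ext h k
  rw [transferMatrix_mul, transferMatrix_mul]
  refine P.sum_pathTwo_comm hP ?_ u v h k
  rintro ⟨a, b⟩ ⟨c, d⟩ hs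
  fin_cases a <;> fin_cases b <;> fin_cases c <;> fin_cases d <;> simp at hs ⊢ <;> field_simp

theorem commute_opC (hP : P.IsAdmissible) (u v : ℂ) : Commute (P.opM 1 0 u) (P.opM 1 0 v) := by
  ext h k
  -- This weight keeps only `q = (0,0)`, that is, the product of two entries `C`.
  have := P.sum_pathTwo_comm hP (G := fun q => if (q.1 : ℕ) + q.2 = 0 then 1 else 0)
    (fun p q hpq => by simp only [hpq]) u v h k
  simp only [Fintype.sum_prod_type, Fin.sum_univ_two] at this
  simp at this
  have e := P.opM_mul 0 1 0
  simp only [sub_zero] at e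
  rw [e, e]
  exact this

/-- The space of theta functions containing the entries of `B` and `C`. -/
def IsSectorThetaFun (f : ℂ → ℂ) : Prop :=
  IsThetaFun P.ω P.N ((-1) ^ P.N * exp (-(I * P.y * Real.pi)))
    ((-1) ^ P.N * exp (-(I * P.y * (Real.pi * P.ω)) - I * Real.pi * P.ω * P.N +
      2 * I * (∑ a, P.ξ a + P.t0))) f

/-- Between `tconf h` and its reflected value, the `t`-dependence of the two gauge factors cancels
for off-diagonal entries. What remains for `B` and for `C` differs by multiples of `2πi` in the
exponents, since `x` and `y` are integers, so all these entries share one pair of multipliers. -/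
theorem isSectorThetaFun_opM (hP : P.IsAdmissible) (h k : P.Conf) :
    P.IsSectorThetaFun (fun u => P.opM 0 1 u h k) ∧
      P.IsSectorThetaFun (fun u => P.opM 1 0 u h k) := by
  have haux {A B : ℂ} (m : ℤ) (hAB : A = B + m * (2 * Real.pi * I)) : exp A = exp B := by
    rw [hAB, exp_add, exp_int_mul_two_pi_mul_I, mul_one]
  have h01 := P.isThetaFun_path hP.im_pos P.N P.ξ (P.tconf h) h k 0 1
  have h10 := P.isThetaFun_path hP.im_pos P.N P.ξ (P.tconf h) h k 1 0
  rw [tconf_add, sz_zero, sz_one] at h01 h10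
  simp only [gaugeExp, sz_zero, sz_one] at h01 h10
  have hβ : exp (-(I * P.y * (Real.pi * P.ω)) - I * Real.pi * P.ω * P.N +
      2 * I * (∑ a, P.ξ a + P.t0)) = exp (-(I * Real.pi * P.ω * P.N) + 2 * I * ∑ m, P.ξ m -
        I * P.η * P.N + I * P.x * Real.pi) := by
    congr 1; simp only [t0]; ring
  rw [IsSectorThetaFun, IsSectorThetaFun, hβ]
  have h01' : IsThetaFun P.ω P.N ((-1) ^ P.N * exp (-(I * P.y * Real.pi)))
      ((-1) ^ P.N * exp (-(I * Real.pi * P.ω * P.N) + 2 * I * ∑ m, P.ξ m -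
        I * P.η * P.N + I * P.x * Real.pi)) (fun u => P.opM 0 1 u h k) := by
    convert h01 using 2
    · exact haux (-P.y) (by push_cast; ring)
    · exact haux P.x (by simp only [sector]; push_cast; ring)
    · rfl
  have h10' : IsThetaFun P.ω P.N ((-1) ^ P.N * exp (-(I * P.y * Real.pi)))
      ((-1) ^ P.N * exp (-(I * Real.pi * P.ω * P.N) + 2 * I * ∑ m, P.ξ m -
        I * P.η * P.N + I * P.x * Real.pi)) (fun u => P.opM 1 0 u h k) := by
    convert h10 using 2
    · exact haux 0 (by push_cast; ring)
    · exact haux 0 (by simp only [sector]; push_cast; ring)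
    · rfl
  exact ⟨h01', h10'⟩

theorem isSectorThetaFun_transferMatrix (hP : P.IsAdmissible) (κ : ℂ) (h k : P.Conf) :
    P.IsSectorThetaFun (fun u => P.transferMatrix κ u h k) :=
  ((P.isSectorThetaFun_opM hP h k).1.const_mul κ⁻¹).add
    ((P.isSectorThetaFun_opM hP h k).2.const_mul κ)

end Model
end
end SOS

namespace SOS
noncomputable section

open Complex

set_option linter.unusedSimpArgs false

namespace Model

variable (P : Model)

/-! ### Fusion -/

/-- The singlet vector. -/
def singlet (p : Fin 2 × Fin 2) : ℂ := if p = (0, 1) then 1 else if p = (1, 0) then -1 else 0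

/-- The local quantum determinant: at spectral parameters differing by `η` the singlet is an
invariant line, and the site is left unchanged. The `θ(t)` ratios telescope along the chain in
`pathTwo_singlet`. -/
theorem twoRow_singlet (hω : 0 < P.ω.im) {t : ℂ} (h0 : theta P.ω t ≠ 0)
    (h1 : theta P.ω (t + P.η) ≠ 0) (h2 : theta P.ω (t - P.η) ≠ 0) (v : ℂ) (h k : Fin 2)
    (p : Fin 2 × Fin 2) :
    P.twoRow v (v - P.η) t h k p (0, 1) - P.twoRow v (v - P.η) t h k p (1, 0) =
      if h = k then P.phase (-(P.η * sz h)) * (theta P.ω (v + P.η) * theta P.ω (v - P.η)) *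
        (theta P.ω t / theta P.ω (t + P.η * sz h)) * singlet p else 0 := by
  have hE := P.phase_ne_zero P.η
  have hU := P.phase_ne_zero v
  have hW : theta P.ω (t + P.η) * theta P.ω (t - P.η) * (theta P.ω v * theta P.ω v) -
      theta P.ω (t + v) * theta P.ω (t - v) * (theta P.ω P.η * theta P.ω P.η) +
      theta P.ω t * theta P.ω t * (theta P.ω (v + P.η) * theta P.ω (-(v - P.η))) = 0 :=
    theta_weierstrass' hω t P.η v 0 rfl rfl (by ring) (by ring) rfl rfl (by ring) (by ring)
      (by ring) (by ring) (by ring) (by ring)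
  rw [theta_neg] at hW
  have e1 : t + P.η + (v - P.η) = t + v := by ring
  have e2 : t - P.η - (v - P.η) = t - v := by ring
  obtain ⟨i, j⟩ := p
  simp only [twoRow, Matrix.of_apply, Fin.sum_univ_two]
  fin_cases h <;> fin_cases k <;> fin_cases i <;> fin_cases j <;>
    simp [R_apply, sz_zero, sz_one, singlet, phase_sub, phase_neg, ← sub_eq_add_neg,
      -neg_add_rev, -neg_sub] <;>
    (try simp only [wb_neg, wc_neg]) <;>
    (try simp only [wa, wb, wc, sub_add_cancel, add_sub_cancel_right, e1, e2]) <;>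
    (try field_simp)
  · linear_combination -hW
  · ring
  · ring
  · linear_combination hW

theorem pathTwo_singlet (hω : 0 < P.ω.im) (n : ℕ) (ξ : Fin n → ℂ) (v : ℂ) {t : ℂ}
    (ht : ∀ k : ℤ, theta P.ω (t + k * P.η) ≠ 0) (h k : Fin n → Fin 2) (p : Fin 2 × Fin 2) :
    P.pathTwo n ξ v (v - P.η) t h k p (0, 1) - P.pathTwo n ξ v (v - P.η) t h k p (1, 0) =
      if h = k then P.phase (-(P.η * ∑ m, sz (h m))) *
        (∏ m, theta P.ω (v - ξ m + P.η) * theta P.ω (v - ξ m - P.η)) *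
        (theta P.ω t / theta P.ω (t + P.η * ∑ m, sz (h m))) * singlet p else 0 := by
  induction n generalizing t with
  | zero =>
    have h0 : theta P.ω t ≠ 0 := by simpa using ht 0
    rw [if_pos (Subsingleton.elim h k)]
    simp only [pathTwo, Finset.univ_eq_empty, Finset.sum_empty, Finset.prod_empty, mul_zero,
      neg_zero, add_zero, div_self h0, mul_one, phase, exp_zero, one_mul, singlet,
      Matrix.one_apply]
    by_cases h1 : p = (0, 1)
    · subst h1; simp
    · simp only [h1, if_false, zero_sub]; split_ifs <;> simp
  | succ n ih =>
    have ht' := P.shift_ne_zero ht (h 0)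
    have h1 := ih (Fin.tail ξ) ht' (Fin.tail h) (Fin.tail k)
    have h2 := P.twoRow_singlet hω (by simpa using ht 0) (by simpa using ht 1)
      (by simpa [sub_eq_add_neg] using ht (-1)) (v - ξ 0) (h 0) (k 0)
    rw [sub_right_comm] at h2
    simp only [pathTwo, Matrix.mul_apply]
    rw [← Finset.sum_sub_distrib]
    simp only [← mul_sub, h2]
    have h3 : theta P.ω (t + P.η * sz (h 0)) ≠ 0 := by simpa using ht' 0
    by_cases hk : h 0 = k 0
    · simp only [hk, if_true]
      rw [hk] at h1 h3
      have e (a b c : ℂ) (K : Fin 2 × Fin 2 → ℂ) :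
          ∑ x, K x * (a * b * c * singlet x) = a * b * c * (K (0, 1) - K (1, 0)) := by
        simp only [Fintype.sum_prod_type, Fin.sum_univ_two, singlet]
        simp; ring
      rw [e, h1]
      by_cases hkt : Fin.tail h = Fin.tail k
      · rw [if_pos hkt, if_pos (conf_succ_ext_iff.mpr ⟨hk, hkt⟩), Fin.sum_univ_succ,
          Fin.prod_univ_succ, hk]
        have e1 : t + P.η * (sz (k 0) + ∑ m : Fin n, sz (h m.succ)) =
            t + P.η * sz (k 0) + P.η * ∑ m, sz (Fin.tail h m) := by simp only [Fin.tail]; ring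
        have e2 : P.phase (-(P.η * (sz (k 0) + ∑ m : Fin n, sz (h m.succ)))) =
            P.phase (-(P.η * sz (k 0))) * P.phase (-(P.η * ∑ m, sz (Fin.tail h m))) := by
          simp only [phase, ← exp_add, Fin.tail]; congr 1; ring
        rw [e1, e2]
        simp only [Fin.tail, sub_right_comm v P.η (ξ 0)]
        field_simp
      · rw [if_neg hkt, if_neg fun h' => hkt (conf_succ_ext_iff.mp h').2, mul_zero]
    · rw [if_neg fun h' => hk (conf_succ_ext_iff.mp h').1]
      simp [hk]

theorem phase_zero : P.phase 0 = 1 := by simp [phase]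

/-- Here `b` vanishes in the upper row and `a` in the lower one, which leaves a matrix of rank at
most one with image in the singlet line. -/
theorem twoRow_zero_apply {t : ℂ} (h0 : theta P.ω t ≠ 0)
    (h1 : theta P.ω (t + P.η) ≠ 0) (h2 : theta P.ω (t - P.η) ≠ 0) (h k : Fin 2) :
    ∃ χ : Fin 2 × Fin 2 → ℂ, ∀ p q, P.twoRow 0 (0 - P.η) t h k p q = singlet p * χ q := by
  have hE := P.phase_ne_zero P.η
  refine ⟨fun q => P.twoRow 0 (0 - P.η) t h k (0, 1) q, ?_⟩
  rintro ⟨i, j⟩ ⟨i', j'⟩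
  simp only [twoRow, Matrix.of_apply, Fin.sum_univ_two]
  fin_cases h <;> fin_cases k <;> fin_cases i <;> fin_cases j <;> fin_cases i' <;> fin_cases j' <;>
    simp [R_apply, sz_zero, sz_one, singlet, phase_sub, phase_neg, ← sub_eq_add_neg,
      -neg_add_rev, -neg_sub] <;>
    (try simp only [wb_neg, wc_neg]) <;>
    (try simp only [wa, wb, wc, sub_add_cancel, add_sub_cancel_right, neg_add_cancel,
      theta_zero, theta_neg, add_zero, sub_zero, ← sub_eq_add_neg, zero_mul, mul_zero, zero_div,
      zero_add, phase_zero]) <;>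
    (try field_simp) <;> (try simp)

/-- Site `a` projects onto the singlet, the factors to its left preserve the singlet, and the
factors to its right only alter the covector `χ`. -/
theorem pathTwo_eq_singlet_mul (hω : 0 < P.ω.im) (n : ℕ) (ξ : Fin n → ℂ) (a : Fin n) {t : ℂ}
    (ht : ∀ k : ℤ, theta P.ω (t + k * P.η) ≠ 0) (h k : Fin n → Fin 2) :
    ∃ χ : Fin 2 × Fin 2 → ℂ, ∀ p q,
      P.pathTwo n ξ (ξ a) (ξ a - P.η) t h k p q = singlet p * χ q := by
  induction n generalizing t with
  | zero => exact a.elim0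
  | succ n ih =>
    have ht' := P.shift_ne_zero ht (h 0)
    simp only [pathTwo, Matrix.mul_apply]
    rcases Fin.eq_zero_or_eq_succ a with rfl | ⟨b, rfl⟩
    · obtain ⟨χ, hχ⟩ := P.twoRow_zero_apply (by simpa using ht 0) (by simpa using ht 1)
        (by simpa [sub_eq_add_neg] using ht (-1)) (h 0) (k 0)
      rw [sub_right_comm, sub_self]
      have h1 := P.pathTwo_singlet hω n (Fin.tail ξ) (ξ 0) ht' (Fin.tail h) (Fin.tail k)
      simp only [hχ]
      have e (c : ℂ) (K : Fin 2 × Fin 2 → ℂ) :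
          ∑ x, K x * (singlet x * c) = (K (0, 1) - K (1, 0)) * c := by
        simp only [Fintype.sum_prod_type, Fin.sum_univ_two, singlet]
        simp; ring
      simp only [e, h1]
      by_cases hk : Fin.tail h = Fin.tail k
      · simp only [hk, if_true]
        exact ⟨fun q => _ * χ q, fun p q => by rw [mul_comm _ (singlet p), mul_assoc]⟩
      · simp only [hk, if_false]
        exact ⟨0, fun p q => by simp⟩
    · obtain ⟨χ, hχ⟩ := ih (Fin.tail ξ) b ht' (Fin.tail h) (Fin.tail k)
      simp only [Fin.tail] at hχ
      simp only [Fin.tail, hχ]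
      exact ⟨fun q => _, fun p q => by simp only [mul_assoc]; rw [← Finset.mul_sum]⟩

/-- The scalar by which the fused transfer matrices act. -/
def fusedScalar (a : Fin P.N) : ℂ :=
  (-1) ^ (P.x + P.y + P.x * P.y) * P.fa (P.ξ a) * P.fd (P.ξ a - P.η)

/-- On the sector `η ∑ σᶻ = sector - 2 tconf h`, so the phase cancels the quasi-period factor of the
theta ratio. Only the sign `(-1)^{x+y+xy}` remains, whatever `h` is. -/
theorem fusedScalar_eq (hP : P.IsAdmissible) (a : Fin P.N) (h : P.Conf) :
    -(P.phase (-(P.η * ∑ m, sz (h m))) *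
      (∏ m, theta P.ω (P.ξ a - P.ξ m + P.η) * theta P.ω (P.ξ a - P.ξ m - P.η)) *
      (theta P.ω (P.tconf h) / theta P.ω (P.tconf h + P.η * ∑ m, sz (h m)))) =
      P.fusedScalar a := by
  have h0 : theta P.ω (P.tconf h) ≠ 0 := by simpa using hP.theta_tconf_add_ne_zero h 0
  have e1 : P.fa (P.ξ a) * P.fd (P.ξ a - P.η) =
      ∏ m, theta P.ω (P.ξ a - P.ξ m + P.η) * theta P.ω (P.ξ a - P.ξ m - P.η) := by
    rw [fa, fd, fa, ← Finset.prod_mul_distrib]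
    refine Finset.prod_congr rfl fun m _ => ?_
    rw [wa, wa]; congr 2; ring
  have e2 : P.η * ∑ m, sz (h m) = -(2 * P.tconf h) + P.sector := by
    linear_combination P.tconf_add h
  rw [fusedScalar, mul_assoc ((-1) ^ _), e1, tconf_add, e2, theta_neg]
  generalize (∏ m, theta P.ω (P.ξ a - P.ξ m + P.η) * theta P.ω (P.ξ a - P.ξ m - P.η)) = D
  generalize P.tconf h = t at *
  have h3 := exp_ne_zero (-(I * Real.pi * P.ω) + 2 * I * t)
  rw [phase, sector]
  rcases hP.x_eq with hx | hx <;> rcases hP.y_eq with hy | hy <;> rw [hx, hy]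
  · simp; field_simp
  · simp only [Nat.cast_zero, Nat.cast_one, zero_mul, zero_add, one_mul, mul_one, mul_zero,
      theta_sub_pi_mul]
    rw [show I * -(-(2 * t) + Real.pi * P.ω) = -(I * Real.pi * P.ω) + 2 * I * t by ring]
    field_simp
    ring
  · simp only [Nat.cast_zero, Nat.cast_one, zero_mul, add_zero, one_mul, mul_zero, exp_zero,
      theta_sub_pi]
    field_simp
  · simp only [Nat.cast_one, one_mul, mul_one]
    rw [show t - (Real.pi + Real.pi * P.ω) = (t - Real.pi * P.ω) - Real.pi by ring,
      theta_sub_pi, theta_sub_pi_mul,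
      show I * -(-(2 * t) + (Real.pi + Real.pi * P.ω)) =
        (-(I * Real.pi * P.ω) + 2 * I * t) + (-(Real.pi * I)) by ring, exp_add, exp_neg,
      exp_pi_mul_I]
    field_simp
    ring

theorem sum_pathTwo_fused (hP : P.IsAdmissible) {G : Fin 2 × Fin 2 → ℂ}
    (hG : G (0, 1) = G (1, 0)) (a : Fin P.N) (h k : P.Conf) :
    ∑ q, G q * P.pathTwo P.N P.ξ (P.ξ a) (P.ξ a - P.η) (P.tconf h) h k (1 - q) q =
      if h = k then G (1, 0) * P.fusedScalar a else 0 := by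
  have ht := hP.theta_tconf_add_ne_zero h
  obtain ⟨χ, hχ⟩ := P.pathTwo_eq_singlet_mul hP.im_pos P.N P.ξ a ht h k
  have h1 := P.pathTwo_singlet hP.im_pos P.N P.ξ (P.ξ a) ht h k (0, 1)
  rw [hχ, hχ] at h1
  have f00 : (1 : Fin 2 × Fin 2) - (0, 0) = (1, 1) := rfl
  have f01 : (1 : Fin 2 × Fin 2) - (0, 1) = (1, 0) := rfl
  have f10 : (1 : Fin 2 × Fin 2) - (1, 0) = (0, 1) := rfl
  have f11 : (1 : Fin 2 × Fin 2) - (1, 1) = (0, 0) := rfl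
  rw [Fintype.sum_prod_type]
  simp only [Fin.sum_univ_two, hχ, f00, f01, f10, f11, hG]
  have s01 : singlet (0, 1) = 1 := by simp [singlet]
  have s10 : singlet (1, 0) = -1 := by simp [singlet]
  have s00 : singlet (0, 0) = 0 := by simp [singlet]
  have s11 : singlet (1, 1) = 0 := by simp [singlet]
  rw [s01] at h1
  rw [s00, s01, s10, s11]
  by_cases hk : h = k
  · rw [if_pos hk] at h1 ⊢
    rw [← P.fusedScalar_eq hP a h]
    linear_combination -G (1, 0) * h1
  · rw [if_neg hk] at h1 ⊢
    linear_combination -G (1, 0) * h1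

theorem transferMatrix_mul_fused (hP : P.IsAdmissible) {κ : ℂ} (hκ : κ ≠ 0) (a : Fin P.N) :
    P.transferMatrix κ (P.ξ a) * P.transferMatrix κ (P.ξ a - P.η) =
      P.fusedScalar a • (1 : Matrix P.Conf P.Conf ℂ) := by
  ext h k
  rw [transferMatrix_mul, P.sum_pathTwo_fused hP (by simp [mul_comm]), Matrix.smul_apply,
    Matrix.one_apply]
  split_ifs <;> simp [hκ]

/-- The product `C C` corresponds to the index pair `(1,1)`, which has no singlet component. -/
theorem opC_mul_fused (hP : P.IsAdmissible) (a : Fin P.N) :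
    P.opM 1 0 (P.ξ a) * P.opM 1 0 (P.ξ a - P.η) = 0 := by
  ext h k
  have := P.sum_pathTwo_fused hP (G := fun q => if (q.1 : ℕ) + q.2 = 0 then 1 else 0)
    (by simp) a h k
  simp only [Fintype.sum_prod_type, Fin.sum_univ_two] at this
  simp at this
  have e := P.opM_mul 0 1 0
  simp only [sub_zero] at e
  rw [e]
  exact this

end Model
end
end SOS

namespace SOS
noncomputable section

open Complex Matrix

/-! ### Configurations -/

/-- The induction pattern of all SOV recursions: one label at a time is raised from `0` to `1`. -/
theorem conf_induction {n : ℕ} {p : (Fin n → Fin 2) → Prop} (h0 : p 0)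
    (hs : ∀ h b, h b = 0 → p h → p (Function.update h b 1)) (h : Fin n → Fin 2) : p h := by
  have key : ∀ s : Finset (Fin n), p fun b => if b ∈ s then 1 else 0 := by
    intro s
    induction s using Finset.induction_on with
    | empty => exact h0
    | insert b s hb ih =>
      have := hs _ b (by simp [hb]) ih
      convert this using 1
      funext c
      by_cases hc : c = b <;> simp [hc]
  convert key (Finset.univ.filter fun b => h b = 1)
  rename_i b
  have : h b = 0 ∨ h b = 1 := by
    generalize h b = c
    fin_cases c <;> simp
  rcases this with hb | hb <;> simp [hb]

theorem conf_induction_one {n : ℕ} {p : (Fin n → Fin 2) → Prop} (h1 : p 1)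
    (hs : ∀ h b, h b = 0 → p (Function.update h b 1) → p h) (h : Fin n → Fin 2) : p h := by
  have hflip (g : Fin n → Fin 2) : 1 - (1 - g) = g := by simp
  have := conf_induction (p := fun h => p (1 - h)) (by simpa using h1) (fun h b hb ih => ?_) (1 - h)
  · simpa using this
  · refine hs _ b (by simp) ?_
    convert ih using 1
    funext c
    by_cases hc : c = b
    · subst hc; simp [hb]
    · simp [hc]

theorem list_prod_map_update_mul {α M : Type*} [DecidableEq α] [Monoid M] {f : α → M} {x : M}
    {b : α} (hx : ∀ a, Commute x (f a)) {l : List α} (hl : l.Nodup) (hb : b ∈ l) :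
    (l.map (Function.update f b (f b * x))).prod = (l.map f).prod * x := by
  induction l with
  | nil => simp at hb
  | cons a l ih =>
    rw [List.nodup_cons] at hl
    rw [List.map_cons, List.map_cons, List.prod_cons, List.prod_cons]
    by_cases hab : a = b
    · subst hab
      have e : l.map (Function.update f a (f a * x)) = l.map f :=
        List.map_congr_left fun c hc =>
          Function.update_of_ne (fun h => hl.1 (by rwa [h] at hc)) _ _
      have hcomm : Commute x (l.map f).prod := Commute.list_prod_right _ _ fun y hy => by
        obtain ⟨c, -, rfl⟩ := List.mem_map.mp hy
        exact hx c
      rw [Function.update_self, e, mul_assoc, hcomm.eq, mul_assoc]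
    · rw [Function.update_of_ne hab, ih hl.2 ((List.mem_cons.mp hb).resolve_left (Ne.symm hab)),
        mul_assoc]

theorem list_prod_ofFn_update_mul {n : ℕ} {M : Type*} [Monoid M] {f : Fin n → M} {x : M}
    (b : Fin n) (hx : ∀ a, Commute x (f a)) :
    (List.ofFn (Function.update f b (f b * x))).prod = (List.ofFn f).prod * x := by
  rw [List.ofFn_eq_map, List.ofFn_eq_map]
  exact list_prod_map_update_mul hx (List.nodup_finRange n) (List.mem_finRange b)

namespace Model

variable (P : Model)

theorem deg_update {n : ℕ} {h : Fin n → Fin 2} {b : Fin n} (hb : h b = 0) :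
    deg (Function.update h b 1) = deg h + 1 := by
  unfold deg
  rw [← Finset.add_sum_erase _ _ (Finset.mem_univ b), ← Finset.add_sum_erase _ _ (Finset.mem_univ b),
    Function.update_self, hb]
  rw [Finset.sum_congr rfl fun c hc => by
    rw [Function.update_of_ne (Finset.ne_of_mem_erase hc)]]
  simp [add_comm]

/-! ### Separation of variables: covectors annihilated by a column of the monodromy matrix -/

/-- On the reference state `D` is a product of weights `b`, and the one at site `b` contains `θ(0)`.
-/
theorem path_zero_zero {n : ℕ} (ξ : Fin n → ℂ) (b : Fin n) (t : ℂ) :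
    P.path n ξ (ξ b) t 0 0 1 1 = 0 := by
  induction n generalizing t with
  | zero => exact b.elim0
  | succ n ih =>
    have e : P.siteL (ξ b - ξ 0) t ((0 : Fin (n + 1) → Fin 2) 0) ((0 : Fin (n + 1) → Fin 2) 0) 0 1 =
        0 := P.R_eq_zero (by simp)
    rw [path, Matrix.mul_apply, Fin.sum_univ_two, e, mul_zero, zero_add]
    rcases Fin.eq_zero_or_eq_succ b with rfl | ⟨c, rfl⟩
    · rw [siteL, Matrix.of_apply, sub_self, R_apply]
      simp [wb, theta_zero]
    · exact mul_eq_zero_of_left (ih (Fin.tail ξ) c _) _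

theorem single_zero_vecMul_opM (b : Fin P.N) (i : Fin 2) :
    Pi.single (0 : P.Conf) (1 : ℂ) ᵥ* P.opM i 1 (P.ξ b) = 0 := by
  funext k
  rw [Matrix.single_one_vecMul]
  by_cases hk : (i : ℕ) + deg (0 : P.Conf) = (1 : Fin 2) + deg k
  · have h0 : deg (0 : P.Conf) = 0 := by simp [deg]
    rw [h0] at hk
    have hi : i = 1 := by
      fin_cases i
      · simp at hk; omega
      · rfl
    subst hi
    have hk0 : k = 0 := by
      have : deg k = 0 := by simpa using hk
      funext m
      have := (Finset.sum_eq_zero_iff.mp this) m (Finset.mem_univ m)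
      exact Fin.ext this
    subst hk0
    exact P.path_zero_zero P.ξ b _
  · exact P.opM_eq_zero hk

/-- Support in a single degree makes the dynamical parameter a number, so the exchange relation can
be contracted with `φ`. The hypotheses remove half of the columns of each two-row matrix; comparing
the remaining columns and inverting `R` gives the claim. Both rows `i` must be carried along,
because `R` mixes `B` with `D`. -/
theorem vecMul_opC_vecMul_opM (hP : P.IsAdmissible) {φ : P.Conf → ℂ} {m : ℕ}
    (hφ : ∀ h, deg h ≠ m → φ h = 0) {u v : ℂ} (h1 : theta P.ω (u - v) ≠ 0)
    (h2 : theta P.ω (u - v + P.η) ≠ 0) (h3 : theta P.ω (u - v - P.η) ≠ 0)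
    (hu : ∀ i, φ ᵥ* P.opM i 1 u = 0) (hv : ∀ i, φ ᵥ* P.opM i 1 v = 0) (i : Fin 2) :
    (φ ᵥ* P.opM 1 0 u) ᵥ* P.opM i 1 v = 0 := by
  set t := P.t0 + P.η * m with ht
  have htc (h : P.Conf) (hh : φ h ≠ 0) : P.tconf h = t := by
    rw [tconf, ht, not_imp_comm.mp (hφ h) hh]
  have hθ (k : ℤ) : theta P.ω (t + k * P.η) ≠ 0 := by
    have := hP.theta_t0_add_ne_zero (m + k)
    rw [ht]; push_cast at this; convert this using 2; ring
  have hθ' : theta P.ω (-(t - P.sector)) ≠ 0 := by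
    have := hP.theta_t0_add_ne_zero (P.N - m)
    push_cast at this
    convert this using 2
    rw [ht, sector]; simp only [t0]; ring
  let K (u v : ℂ) (k : P.Conf) : Matrix (Fin 2 × Fin 2) (Fin 2 × Fin 2) ℂ :=
    ∑ h, φ h • P.pathTwo P.N P.ξ u v (P.tconf h) h k
  have hK (u v : ℂ) (k : P.Conf) (p q : Fin 2 × Fin 2) :
      K u v k p q = ∑ h, φ h * P.pathTwo P.N P.ξ u v (P.tconf h) h k p q := by
    simp only [K, Matrix.sum_apply, Matrix.smul_apply, smul_eq_mul]
  have hcol {u v : ℂ} (hu : ∀ i, φ ᵥ* P.opM i 1 u = 0) (k : P.Conf) (p : Fin 2 × Fin 2)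
      (r : Fin 2) : K u v k p (1, r) = 0 := by
    have e : K u v k p (1, r) = ∑ l, (φ ᵥ* P.opM p.1 1 u) l *
        P.path P.N P.ξ v (t + P.η * sz 1) l k p.2 r := by
      simp only [hK, pathTwo_apply, Matrix.vecMul, dotProduct, Finset.mul_sum, Finset.sum_mul]
      rw [Finset.sum_comm]
      refine Finset.sum_congr rfl fun l _ => Finset.sum_congr rfl fun h _ => ?_
      by_cases hh : φ h = 0
      · simp [hh]
      · rw [htc h hh, opM, Matrix.of_apply, htc h hh]; ring
    rw [e, hu]; simp
  have hex (k : P.Conf) : P.R (u - v) (-(t - P.sector)) * K u v k =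
      (K v u k).submatrix Prod.swap Prod.swap * P.R (u - v) t := by
    have e1 : P.R (u - v) (-(t - P.sector)) * K u v k =
        ∑ h, φ h • (P.R (u - v) (-(P.tconf h - P.sector)) *
          P.pathTwo P.N P.ξ u v (P.tconf h) h k) := by
      simp only [K, Matrix.mul_sum, Matrix.mul_smul]
      refine Finset.sum_congr rfl fun h _ => ?_
      by_cases hh : φ h = 0
      · simp [hh]
      · rw [htc h hh]
    have e2 : (K v u k).submatrix Prod.swap Prod.swap * P.R (u - v) t =
        ∑ h, φ h • ((P.pathTwo P.N P.ξ v u (P.tconf h) h k).submatrix Prod.swap Prod.swap *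
          P.R (u - v) (P.tconf h)) := by
      have : (K v u k).submatrix Prod.swap Prod.swap =
          ∑ h, φ h • (P.pathTwo P.N P.ξ v u (P.tconf h) h k).submatrix Prod.swap Prod.swap := by
        ext p q
        simp only [K, Matrix.submatrix_apply, Matrix.sum_apply, Matrix.smul_apply]
      rw [this, Matrix.sum_mul]
      refine Finset.sum_congr rfl fun h _ => ?_
      by_cases hh : φ h = 0
      · simp [hh]
      · rw [htc h hh, Matrix.smul_mul]
    rw [e1, e2]
    refine Finset.sum_congr rfl fun h _ => ?_
    rw [← P.R_mul_pathTwo hP.im_pos P.N P.ξ u v (hP.theta_tconf_add_ne_zero h) h k, tconf_add]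
  obtain ⟨S, -, hS⟩ := P.exists_R_inverse hP.im_pos hθ' h2 h3
  funext k
  set K' := (K v u k).submatrix Prod.swap Prod.swap with hK'
  have c1 (p : Fin 2 × Fin 2) (r : Fin 2) : K' p (r, 1) = 0 := hcol hv k _ r
  have hR : P.R (u - v) t (1, 0) (1, 0) ≠ 0 := by
    have := hθ (-1)
    have h0 := hθ 0
    simp [← sub_eq_add_neg] at this h0
    simp [R_apply, wb_neg, P.phase_ne_zero, h1, this, h0]
  have mulR (p : Fin 2 × Fin 2) (r s : Fin 2) : (K' * P.R (u - v) t) p (r, s) =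
      K' p (0, 0) * P.R (u - v) t (0, 0) (r, s) + K' p (1, 0) * P.R (u - v) t (1, 0) (r, s) := by
    simp only [Matrix.mul_apply, Fintype.sum_prod_type, Fin.sum_univ_two, c1, zero_mul, add_zero]
  -- In column `(1,0)` of the exchange relation the left side vanishes by `hu`, and the right side
  -- is this entry times a non-zero weight `b(u - v)`.
  have c2 (p : Fin 2 × Fin 2) : K' p (1, 0) = 0 := by
    have e := mulR p 1 0
    rw [← hex, Matrix.mul_apply, P.R_eq_zero (s := 0) (h := 0) (r := 1) (k := 0) (by simp), mul_zero,
      zero_add] at e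
    simp only [hcol hu, mul_zero, Finset.sum_const_zero] at e
    exact (mul_eq_zero.mp e.symm).resolve_right hR
  have c3 (p : Fin 2 × Fin 2) : (P.R (u - v) (-(t - P.sector)) * K u v k) p (0, 1) = 0 := by
    rw [hex, mulR, c2, P.R_eq_zero (s := 0) (h := 0) (r := 0) (k := 1) (by simp)]; simp
  have c4 (p : Fin 2 × Fin 2) : K u v k p (0, 1) = 0 := by
    have : K u v k = S * (P.R (u - v) (-(t - P.sector)) * K u v k) := by
      rw [← mul_assoc, hS, one_mul]
    rw [this, Matrix.mul_apply]
    simp only [c3, mul_zero, Finset.sum_const_zero]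
  rw [Matrix.vecMul_vecMul]
  have e := c4 (1, i)
  rw [hK] at e
  simp only [Matrix.vecMul, dotProduct, Pi.zero_apply]
  have := P.opM_mul 0 i 1 u v
  simp only [sub_zero] at this
  simp only [this]
  exact e

end Model
end
end SOS

namespace SOS
noncomputable section

open Complex Matrix

namespace Model

variable (P : Model)

/-! ### Interpolation at the nodes attached to a configuration -/

/-- The node `ξ_a - η h_a`. -/
def node (h : P.Conf) (a : Fin P.N) : ℂ := P.ξ a - P.η * ((h a : ℕ) : ℂ)

/-- The interpolation basis for the nodes attached to `h`. -/
def nodeBasis (h : P.Conf) (a : Fin P.N) (u : ℂ) : ℂ :=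
  thetaBasis P.ω P.y (P.tconf h) (P.node h) a u

theorem node_of_eq_zero {h : P.Conf} {a : Fin P.N} (ha : h a = 0) : P.node h a = P.ξ a := by
  simp [node, ha]

theorem node_of_eq_one {h : P.Conf} {a : Fin P.N} (ha : h a = 1) : P.node h a = P.ξ a - P.η := by
  simp [node, ha]

/-- Raising a label moves its node by `-η` and `tconf` by `+η`. Hence the node bases of all
configurations lie in one theta space, and the nodes may be adapted to `h`. -/
theorem sum_node_add (h : P.Conf) : ∑ a, P.node h a + P.tconf h = ∑ a, P.ξ a + P.t0 := by
  simp only [node, tconf, deg, Finset.sum_sub_distrib, ← Finset.mul_sum, Nat.cast_sum]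
  ring

namespace IsAdmissible

variable {P} (hP : P.IsAdmissible)
include hP

theorem tconf_notMem (h : P.Conf) : P.tconf h ∉ periodLattice P.ω := by
  have := hP.theta_tconf_add_ne_zero h 0
  rw [Int.cast_zero, zero_mul, add_zero] at this
  exact fun hm => this ((theta_eq_zero_iff hP.im_pos).mpr hm)

theorem isSectorThetaFun_nodeBasis (h : P.Conf) (a : Fin P.N) :
    P.IsSectorThetaFun (P.nodeBasis h a) := by
  have := isThetaFun_thetaBasis (y := P.y) (τ := P.tconf h) (x := P.node h) hP.im_pos a
  rw [Fintype.card_fin, sum_node_add] at this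
  exact this

variable (hI : P.InhomogeneityCondition)
include hI

theorem theta_sub_ne_zero {a b : Fin P.N} (hab : a ≠ b) : theta P.ω (P.ξ a - P.ξ b) ≠ 0 := by
  have := hI a b hab 0 (by simp)
  rw [Int.cast_zero, zero_mul, add_zero] at this
  exact fun h => this ((theta_eq_zero_iff hP.im_pos).mp h)

theorem theta_sub_add_ne_zero {a b : Fin P.N} (hab : a ≠ b) :
    theta P.ω (P.ξ a - P.ξ b + P.η) ≠ 0 := by
  have := hI a b hab 1 (by simp)
  rw [Int.cast_one, one_mul] at this
  exact fun h => this ((theta_eq_zero_iff hP.im_pos).mp h)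

theorem theta_sub_sub_ne_zero {a b : Fin P.N} (hab : a ≠ b) :
    theta P.ω (P.ξ a - P.ξ b - P.η) ≠ 0 := by
  have := hI a b hab (-1) (by simp)
  rw [Int.cast_neg, Int.cast_one, neg_one_mul, ← sub_eq_add_neg] at this
  exact fun h => this ((theta_eq_zero_iff hP.im_pos).mp h)

theorem node_sub_node_notMem (h : P.Conf) {a b : Fin P.N} (hab : a ≠ b) :
    P.node h a - P.node h b ∉ periodLattice P.ω := by
  rw [← theta_eq_zero_iff hP.im_pos]
  have key (c d : Fin 2) : theta P.ω (P.ξ a - P.η * ((c : ℕ) : ℂ) - (P.ξ b - P.η * ((d : ℕ) : ℂ)))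
      ≠ 0 := by
    fin_cases c <;> fin_cases d <;> simp
    · exact hP.theta_sub_ne_zero hI hab
    · rw [show P.ξ a - (P.ξ b - P.η) = P.ξ a - P.ξ b + P.η by ring]
      exact hP.theta_sub_add_ne_zero hI hab
    · rw [sub_right_comm]
      exact hP.theta_sub_sub_ne_zero hI hab
    · exact hP.theta_sub_ne_zero hI hab
  exact key (h a) (h b)

theorem interpolation (h : P.Conf) {f : ℂ → ℂ} (hf : P.IsSectorThetaFun f) (u : ℂ) :
    f u = ∑ a, P.nodeBasis h a u * f (P.node h a) := by
  refine IsThetaFun.interpolation (y := P.y) (τ := P.tconf h) (x := P.node h) hP.im_pos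
    (fun a b hab => hP.node_sub_node_notMem hI h hab) (hP.tconf_notMem h) ?_ u
  rw [Fintype.card_fin, sum_node_add]
  exact hf

theorem interpolation_matrix (h : P.Conf) {M : ℂ → Matrix P.Conf P.Conf ℂ}
    (hM : ∀ k l, P.IsSectorThetaFun fun u => M u k l) (u : ℂ) :
    M u = ∑ a, P.nodeBasis h a u • M (P.node h a) := by
  ext k l
  rw [hP.interpolation hI h (hM k l) u, Matrix.sum_apply]
  rfl

theorem nodeBasis_ne_zero {h : P.Conf} {b : Fin P.N} (hb : h b = 0) :
    P.nodeBasis h b (P.ξ b - P.η) ≠ 0 := by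
  rw [nodeBasis, thetaBasis, P.node_of_eq_zero hb]
  have h1 := hP.theta_tconf_add_ne_zero h 1
  have h0 := hP.theta_tconf_add_ne_zero h 0
  simp only [Int.cast_one, one_mul, Int.cast_zero, zero_mul, add_zero] at h1 h0
  refine mul_ne_zero (mul_ne_zero (exp_ne_zero _) (div_ne_zero ?_ h0))
    (Finset.prod_ne_zero_iff.mpr fun c hc => ?_)
  · convert h1 using 2; ring
  · have hcb := Finset.ne_of_mem_erase hc
    have h2 := hP.node_sub_node_notMem hI h hcb.symm
    rw [P.node_of_eq_zero hb, ← theta_eq_zero_iff hP.im_pos] at h2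
    refine div_ne_zero ?_ h2
    have key (d : Fin 2) : theta P.ω (P.ξ b - P.η - (P.ξ c - P.η * ((d : ℕ) : ℂ))) ≠ 0 := by
      fin_cases d
      · have := hP.theta_sub_sub_ne_zero hI hcb.symm
        simp; rwa [sub_right_comm]
      · have := hP.theta_sub_ne_zero hI hcb.symm
        simpa using this
    exact key (h c)

theorem fd_ne_zero (a : Fin P.N) : P.fd (P.ξ a - P.η) ≠ 0 := by
  rw [fd, fa]
  refine Finset.prod_ne_zero_iff.mpr fun b _ => ?_
  rw [wa, show P.ξ a - P.η - P.η - P.ξ b + P.η = P.ξ a - P.ξ b - P.η by ring]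
  by_cases hab : a = b
  · rw [hab, sub_self, zero_sub, theta_neg]
    exact neg_ne_zero.mpr hP.theta_eta_ne_zero
  · exact hP.theta_sub_sub_ne_zero hI hab

theorem faxy_ne_zero (a : Fin P.N) : P.faxy (P.ξ a) ≠ 0 := by
  rw [faxy, fa]
  refine mul_ne_zero (pow_ne_zero _ (by norm_num)) (Finset.prod_ne_zero_iff.mpr fun b _ => ?_)
  rw [wa]
  by_cases hab : a = b
  · rw [hab, sub_self, zero_add]
    exact hP.theta_eta_ne_zero
  · exact hP.theta_sub_add_ne_zero hI hab

end IsAdmissible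

theorem fusedScalar_eq_mul (a : Fin P.N) :
    P.fusedScalar a = P.faxy (P.ξ a) * P.fd (P.ξ a - P.η) := rfl

end Model
end
end SOS

namespace SOS
noncomputable section

open Complex Matrix

/-- The matrix of pairings is diagonal with non-zero entries, so the square matrix of the `L h` is
invertible. -/
theorem eq_zero_of_biorthogonal {ι : Type*} [Fintype ι] [DecidableEq ι] {L R : ι → ι → ℂ}
    (h0 : ∀ h k, h ≠ k → L h ⬝ᵥ R k = 0) (h1 : ∀ h, L h ⬝ᵥ R h ≠ 0) {w : ι → ℂ}
    (hw : ∀ h, L h ⬝ᵥ w = 0) : w = 0 := by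
  have e : Matrix.of L * (Matrix.of R)ᵀ = Matrix.diagonal fun h => L h ⬝ᵥ R h := by
    ext h k
    by_cases hk : h = k
    · subst hk; simp [Matrix.mul_apply, dotProduct]
    · rw [Matrix.diagonal_apply_ne _ hk, ← h0 h k hk]; simp [Matrix.mul_apply, dotProduct]
  have hdet : (Matrix.of L).det ≠ 0 := by
    have := congrArg Matrix.det e
    rw [Matrix.det_mul, Matrix.det_diagonal] at this
    exact left_ne_zero_of_mul (this ▸ Finset.prod_ne_zero_iff.mpr fun h _ => h1 h)
  exact Matrix.eq_zero_of_mulVec_eq_zero hdet (funext hw)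

namespace Model

variable (P : Model)

/-! ### The SOV basis on the antiperiodic sector -/

/-- The coordinates of the left SOV state. -/
def leftVec (ν : ℂ) (h : P.Conf) : P.Conf → ℂ :=
  (ν⁻¹ • Pi.single (0 : P.Conf) (1 : ℂ)) ᵥ*
    (List.ofFn fun n => ((P.fd (P.ξ n - P.η))⁻¹ • P.opM 1 0 (P.ξ n)) ^ (h n : ℕ)).prod

/-- The coordinates of the right SOV state. -/
def rightVec (ν : ℂ) (h : P.Conf) : P.Conf → ℂ :=
  (List.ofFn fun n => ((P.fd (P.ξ n - P.η))⁻¹ • P.opM 1 0 (P.ξ n - P.η)) ^ (1 - (h n : ℕ))).prod *ᵥ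
    (ν⁻¹ • Pi.single (1 : P.Conf) (1 : ℂ))

namespace IsAdmissible

variable {P} (hP : P.IsAdmissible)
include hP

theorem leftVec_update (ν : ℂ) {h : P.Conf} {b : Fin P.N} (hb : h b = 0) :
    P.leftVec ν (Function.update h b 1) =
      (P.fd (P.ξ b - P.η))⁻¹ • (P.leftVec ν h ᵥ* P.opM 1 0 (P.ξ b)) := by
  rw [leftVec, leftVec, Matrix.vecMul_vecMul, ← Matrix.vecMul_smul, ← Matrix.mul_smul,
    ← list_prod_ofFn_update_mul b (x := (P.fd (P.ξ b - P.η))⁻¹ • P.opM 1 0 (P.ξ b))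
      (fun a => (((P.commute_opC hP _ _).smul_left _).smul_right _).pow_right _)]
  congr 3
  funext n
  by_cases hn : n = b
  · subst hn; simp [hb]
  · simp [hn]

theorem rightVec_eq (ν : ℂ) {h : P.Conf} {b : Fin P.N} (hb : h b = 0) :
    P.rightVec ν h = (P.fd (P.ξ b - P.η))⁻¹ •
      (P.opM 1 0 (P.ξ b - P.η) *ᵥ P.rightVec ν (Function.update h b 1)) := by
  have hc (a : Fin P.N) : Commute ((P.fd (P.ξ b - P.η))⁻¹ • P.opM 1 0 (P.ξ b - P.η))
      (((P.fd (P.ξ a - P.η))⁻¹ • P.opM 1 0 (P.ξ a - P.η)) ^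
        (1 - (Function.update h b 1 a : ℕ))) :=
    (((P.commute_opC hP _ _).smul_left _).smul_right _).pow_right _
  rw [rightVec, rightVec, Matrix.mulVec_mulVec, ← Matrix.smul_mulVec, ← Matrix.smul_mul]
  have hcomm := Commute.list_prod_right
    (List.ofFn fun a => ((P.fd (P.ξ a - P.η))⁻¹ • P.opM 1 0 (P.ξ a - P.η)) ^
        (1 - (Function.update h b 1 a : ℕ))) _ (fun y hy => by
          obtain ⟨a, rfl⟩ := List.mem_ofFn.mp hy
          exact hc a)
  rw [hcomm.eq, ← list_prod_ofFn_update_mul b hc]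
  congr 3
  funext n
  by_cases hn : n = b
  · subst hn; simp [hb]
  · simp [hn]

theorem leftVec_eq_zero (ν : ℂ) (h k : P.Conf) (hk : deg k ≠ deg h) : P.leftVec ν h k = 0 := by
  induction h using conf_induction generalizing k with
  | h0 =>
    have h0 : deg (0 : P.Conf) = 0 := by simp [deg]
    have hk0 : k ≠ 0 := by rintro rfl; exact hk rfl
    simp [leftVec, hk0]
  | hs h b hb ih =>
    rw [hP.leftVec_update ν hb, Pi.smul_apply, Matrix.vecMul, dotProduct,
      Finset.sum_eq_zero, smul_zero]
    intro l _
    rw [deg_update hb] at hk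
    by_cases hl : deg l = deg h
    · rw [P.opM_eq_zero, mul_zero]
      simp; omega
    · rw [ih l hl, zero_mul]

theorem rightVec_eq_zero (ν : ℂ) (h k : P.Conf) (hk : deg k ≠ deg h) : P.rightVec ν h k = 0 := by
  induction h using conf_induction_one generalizing k with
  | h1 =>
    have hk0 : k ≠ 1 := by rintro rfl; exact hk rfl
    simp [rightVec, hk0]
  | hs h b hb ih =>
    rw [hP.rightVec_eq ν hb, Pi.smul_apply, Matrix.mulVec, dotProduct,
      Finset.sum_eq_zero, smul_zero]
    intro l _
    rw [deg_update hb] at ih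
    by_cases hl : deg l = deg h + 1
    · rw [P.opM_eq_zero, zero_mul]
      simp; omega
    · rw [ih l hl, mul_zero]

/-- The covector contains a factor `C(ξ_b)`, which by commutativity may be placed last; then `C(ξ_b)
C(ξ_b - η) = 0`. -/
theorem leftVec_vecMul_opC_sub (ν : ℂ) {h : P.Conf} {b : Fin P.N} (hb : h b = 1) :
    P.leftVec ν h ᵥ* P.opM 1 0 (P.ξ b - P.η) = 0 := by
  have e : Function.update (Function.update h b 0) b 1 = h := by
    rw [Function.update_idem, ← hb, Function.update_eq_self]
  rw [← e, hP.leftVec_update ν (by simp), Matrix.smul_vecMul, Matrix.vecMul_vecMul,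
    P.opC_mul_fused hP, Matrix.vecMul_zero, smul_zero]

theorem pairing_eq_zero_of_apply (ν : ℂ) {h k : P.Conf} {b : Fin P.N} (hb : h b = 1) (kb : k b = 0) :
    P.leftVec ν h ⬝ᵥ P.rightVec ν k = 0 := by
  rw [hP.rightVec_eq ν kb, dotProduct_smul, Matrix.dotProduct_mulVec,
    hP.leftVec_vecMul_opC_sub ν hb, zero_dotProduct, smul_zero]

/-- Different degrees have disjoint supports. For equal degrees some site has `h_b = 1` and `k_b =
0`, and the factor `C(ξ_b - η)` in the right state annihilates the covector. -/
theorem pairing_eq_zero (ν : ℂ) {h k : P.Conf} (hhk : h ≠ k) :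
    P.leftVec ν h ⬝ᵥ P.rightVec ν k = 0 := by
  by_cases hd : deg h = deg k
  · obtain ⟨b, hb⟩ : ∃ b, k b < h b := by
      by_contra! hle
      refine hhk (funext fun b => ?_)
      have := (Finset.sum_eq_sum_iff_of_le (s := Finset.univ)
        (f := fun m => (h m : ℕ)) (g := fun m => (k m : ℕ)) (fun m _ => hle m)).mp hd b
        (Finset.mem_univ b)
      exact Fin.ext this
    refine hP.pairing_eq_zero_of_apply ν (b := b) ?_ ?_ <;> omega
  · refine Finset.sum_eq_zero fun l _ => ?_
    by_cases hl : deg l = deg h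
    · rw [hP.rightVec_eq_zero ν k l (by omega), mul_zero]
    · rw [hP.leftVec_eq_zero ν h l hl, zero_mul]

variable (hI : P.InhomogeneityCondition)
include hI

theorem leftVec_vecMul_opM (ν : ℂ) (h : P.Conf) (b : Fin P.N) (hb : h b = 0) (i : Fin 2) :
    P.leftVec ν h ᵥ* P.opM i 1 (P.ξ b) = 0 := by
  induction h using conf_induction generalizing b i with
  | h0 =>
    have : P.leftVec ν 0 = ν⁻¹ • Pi.single (0 : P.Conf) (1 : ℂ) := by simp [leftVec]
    rw [this, Matrix.smul_vecMul, P.single_zero_vecMul_opM, smul_zero]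
  | hs h c hc ih =>
    have hbc : b ≠ c := by
      rintro rfl
      simp at hb
    rw [Function.update_of_ne hbc] at hb
    rw [hP.leftVec_update ν hc, Matrix.smul_vecMul,
      P.vecMul_opC_vecMul_opM hP (fun k hk => hP.leftVec_eq_zero ν h k hk)
        (hP.theta_sub_ne_zero hI hbc.symm) (hP.theta_sub_add_ne_zero hI hbc.symm)
        (hP.theta_sub_sub_ne_zero hI hbc.symm) (ih c hc) (ih b hb), smul_zero]

theorem leftVec_vecMul_opC (ν : ℂ) {h : P.Conf} {b : Fin P.N} (hb : h b = 0) :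
    P.leftVec ν h ᵥ* P.opM 1 0 (P.ξ b) =
      P.fd (P.ξ b - P.η) • P.leftVec ν (Function.update h b 1) := by
  rw [hP.leftVec_update ν hb, smul_smul, mul_inv_cancel₀ (hP.fd_ne_zero hI b), one_smul]

theorem leftVec_vecMul_transfer (ν κ : ℂ) {h : P.Conf} {b : Fin P.N} (hb : h b = 0) :
    P.leftVec ν h ᵥ* P.transferMatrix κ (P.ξ b) =
      (κ * P.fd (P.ξ b - P.η)) • P.leftVec ν (Function.update h b 1) := by
  rw [transferMatrix, Matrix.vecMul_add, Matrix.vecMul_smul, Matrix.vecMul_smul,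
    hP.leftVec_vecMul_opM hI ν h b hb, hP.leftVec_vecMul_opC hI ν hb, smul_zero, zero_add, smul_smul]

/-- Apply `T(ξ_b - η)` to the raising relation: fusion makes the left side a scalar multiple of the
original covector, so `𝓑(ξ_b - η)` never has to be computed. -/
theorem leftVec_update_vecMul_transfer (ν : ℂ) {κ : ℂ} (hκ : κ ≠ 0) {h : P.Conf} {b : Fin P.N}
    (hb : h b = 0) : P.leftVec ν (Function.update h b 1) ᵥ* P.transferMatrix κ (P.ξ b - P.η) =
      (κ⁻¹ * P.faxy (P.ξ b)) • P.leftVec ν h := by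
  have hd := hP.fd_ne_zero hI b
  have h1 := congrArg (fun w => (κ * P.fd (P.ξ b - P.η))⁻¹ •
    (w ᵥ* P.transferMatrix κ (P.ξ b - P.η))) (hP.leftVec_vecMul_transfer hI ν κ hb)
  simp only [Matrix.vecMul_vecMul, P.transferMatrix_mul_fused hP hκ, Matrix.vecMul_smul,
    Matrix.vecMul_one, Matrix.smul_vecMul, smul_smul,
    inv_mul_cancel₀ (mul_ne_zero hκ hd), one_smul] at h1
  rw [← h1, fusedScalar_eq_mul]
  congr 1
  field_simp

theorem fusedScalar_ne_zero (a : Fin P.N) : P.fusedScalar a ≠ 0 :=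
  mul_ne_zero (hP.faxy_ne_zero hI a) (hP.fd_ne_zero hI a)

theorem leftVec_ne_zero {ν : ℂ} (hν : ν ≠ 0) (h : P.Conf) : P.leftVec ν h ≠ 0 := by
  induction h using conf_induction with
  | h0 =>
    intro h
    have := congrFun h 0
    simp [leftVec, hν] at this
  | hs h b hb ih =>
    intro h0
    have := hP.leftVec_update_vecMul_transfer hI ν one_ne_zero hb
    rw [h0, Matrix.zero_vecMul] at this
    exact ih ((smul_eq_zero.mp this.symm).resolve_left
      (mul_ne_zero (by simp) (hP.faxy_ne_zero hI b)))

/-- The right state contributes `C(ξ_b - η)`; interpolate it at the nodes of `h`. At a node with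
`h_c = 1` the covector is annihilated, at one with `h_c = 0` the label `c` is raised, and
biorthogonality leaves only `c = b`. -/
theorem pairing_self (ν : ℂ) {h : P.Conf} {b : Fin P.N} (hb : h b = 0) :
    P.leftVec ν h ⬝ᵥ P.rightVec ν h = P.nodeBasis h b (P.ξ b - P.η) *
      (P.leftVec ν (Function.update h b 1) ⬝ᵥ P.rightVec ν (Function.update h b 1)) := by
  rw [hP.rightVec_eq ν hb, dotProduct_smul, Matrix.dotProduct_mulVec,
    hP.interpolation_matrix hI h (fun k l => (P.isSectorThetaFun_opM hP k l).2) (P.ξ b - P.η),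
    Matrix.vecMul_sum, sum_dotProduct, Finset.sum_eq_single b]
  · rw [Matrix.vecMul_smul, P.node_of_eq_zero hb, hP.leftVec_vecMul_opC hI ν hb, smul_dotProduct,
      smul_dotProduct, smul_eq_mul, smul_eq_mul, smul_eq_mul]
    have := hP.fd_ne_zero hI b
    field_simp
  · intro c _ hcb
    rw [Matrix.vecMul_smul, smul_dotProduct]
    rcases (show h c = 0 ∨ h c = 1 by omega) with hc | hc
    · rw [P.node_of_eq_zero hc, hP.leftVec_vecMul_opC hI ν hc, smul_dotProduct,
        hP.pairing_eq_zero ν, smul_zero, smul_zero]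
      intro he
      have := congrFun he c
      rw [Function.update_self, Function.update_of_ne hcb, hc] at this
      exact absurd this (by decide)
    · rw [P.node_of_eq_one hc, hP.leftVec_vecMul_opC_sub ν hc, zero_dotProduct, smul_zero]
  · simp

theorem pairing_ne_zero {ν : ℂ} (hν : ν ≠ 0) (h : P.Conf) :
    P.leftVec ν h ⬝ᵥ P.rightVec ν h ≠ 0 := by
  induction h using conf_induction_one with
  | h1 =>
    have h1 : P.rightVec ν 1 = ν⁻¹ • Pi.single (1 : P.Conf) (1 : ℂ) := by simp [rightVec]
    rw [h1, dotProduct_smul, dotProduct_single, mul_one]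
    refine smul_ne_zero (inv_ne_zero hν) fun h0 => hP.leftVec_ne_zero hI hν 1 (funext fun k => ?_)
    by_cases hk : k = 1
    · rw [hk, h0]; rfl
    · refine hP.leftVec_eq_zero ν 1 k fun hd => hk (funext fun b => ?_)
      have := (Finset.sum_eq_sum_iff_of_le (s := Finset.univ)
        (f := fun m => (k m : ℕ)) (g := fun m => ((1 : P.Conf) m : ℕ))
        (fun m _ => by simp; omega)).mp hd b (Finset.mem_univ b)
      exact Fin.ext this
  | hs h b hb ih =>
    rw [hP.pairing_self hI ν hb]
    exact mul_ne_zero (hP.nodeBasis_ne_zero hI hb) ih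

theorem eq_zero_of_leftVec_dotProduct {ν : ℂ} (hν : ν ≠ 0) {w : P.Conf → ℂ}
    (hw : ∀ h, P.leftVec ν h ⬝ᵥ w = 0) : w = 0 :=
  eq_zero_of_biorthogonal (fun _ _ => hP.pairing_eq_zero ν) (hP.pairing_ne_zero hI hν) hw

theorem eq_zero_of_rightVec_dotProduct {ν : ℂ} (hν : ν ≠ 0) {w : P.Conf → ℂ}
    (hw : ∀ h, P.rightVec ν h ⬝ᵥ w = 0) : w = 0 :=
  eq_zero_of_biorthogonal (R := P.leftVec ν)
    (fun h k hk => by rw [dotProduct_comm]; exact hP.pairing_eq_zero ν hk.symm)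
    (fun h => by rw [dotProduct_comm]; exact hP.pairing_ne_zero hI hν h) hw

/-- The right-hand counterpart of the annihilation by `𝓑(ξ_b)`, deduced by pairing with the complete
family of left covectors and interpolating `𝓑` at the nodes of `k`. -/
theorem opB_mulVec_rightVec {ν : ℂ} (hν : ν ≠ 0) {h : P.Conf} {b : Fin P.N} (hb : h b = 1) :
    P.opM 0 1 (P.ξ b - P.η) *ᵥ P.rightVec ν h = 0 := by
  refine hP.eq_zero_of_leftVec_dotProduct hI hν fun k => ?_
  rw [Matrix.dotProduct_mulVec,
    hP.interpolation_matrix hI k (fun k l => (P.isSectorThetaFun_opM hP k l).1) (P.ξ b - P.η),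
    Matrix.vecMul_sum, sum_dotProduct]
  refine Finset.sum_eq_zero fun c _ => ?_
  rw [Matrix.vecMul_smul, smul_dotProduct]
  rcases (show k c = 0 ∨ k c = 1 by omega) with hc | hc
  · rw [P.node_of_eq_zero hc, hP.leftVec_vecMul_opM hI ν k c hc, zero_dotProduct, smul_zero]
  rw [P.node_of_eq_one hc]
  -- If `k_b = 1` and `c ≠ b`, the evaluation point is node `b` and the basis function of `c`
  -- vanishes there. Otherwise lowering `k_c` gives a configuration with label `0` at `b`, which is
  -- orthogonal to the state of `h`.
  by_cases hkb : k b = 1 ∧ c ≠ b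
  · rw [nodeBasis, ← P.node_of_eq_one hkb.1, thetaBasis_of_ne hkb.2.symm, zero_smul]
  · have e : Function.update (Function.update k c 0) c 1 = k := by
      rw [Function.update_idem, ← hc, Function.update_eq_self]
    have h1 := hP.leftVec_update_vecMul_transfer hI ν one_ne_zero (h := Function.update k c 0)
      (b := c) (by simp)
    rw [e, transferMatrix, Matrix.vecMul_add, Matrix.vecMul_smul, Matrix.vecMul_smul,
      hP.leftVec_vecMul_opC_sub ν hc, smul_zero, add_zero, inv_one, one_smul] at h1
    rw [h1, smul_dotProduct, hP.pairing_eq_zero ν, smul_zero, smul_zero]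
    intro he
    have := congrFun he b
    rw [hb] at this
    by_cases hcb : c = b
    · rw [hcb, Function.update_self] at this; exact absurd this (by decide)
    · rw [Function.update_of_ne (Ne.symm hcb)] at this
      exact hkb ⟨this, hcb⟩

theorem transfer_mulVec_rightVec_update {ν : ℂ} (hν : ν ≠ 0) (κ : ℂ) {h : P.Conf} {b : Fin P.N}
    (hb : h b = 0) : P.transferMatrix κ (P.ξ b - P.η) *ᵥ P.rightVec ν (Function.update h b 1) =
      (κ * P.fd (P.ξ b - P.η)) • P.rightVec ν h := by
  rw [hP.rightVec_eq ν hb, transferMatrix, Matrix.add_mulVec, Matrix.smul_mulVec,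
    Matrix.smul_mulVec, hP.opB_mulVec_rightVec hI hν (by simp), smul_zero, zero_add, smul_smul,
    mul_inv_cancel_right₀ (hP.fd_ne_zero hI b)]

theorem transfer_mulVec_rightVec {ν : ℂ} (hν : ν ≠ 0) {κ : ℂ} (hκ : κ ≠ 0) {h : P.Conf}
    {b : Fin P.N} (hb : h b = 0) : P.transferMatrix κ (P.ξ b) *ᵥ P.rightVec ν h =
      (κ⁻¹ * P.faxy (P.ξ b)) • P.rightVec ν (Function.update h b 1) := by
  have hd := hP.fd_ne_zero hI b
  have h1 := congrArg (fun w => (κ * P.fd (P.ξ b - P.η))⁻¹ •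
    (P.transferMatrix κ (P.ξ b) *ᵥ w)) (hP.transfer_mulVec_rightVec_update hI hν κ hb)
  simp only [Matrix.mulVec_mulVec, P.transferMatrix_mul_fused hP hκ, Matrix.smul_mulVec,
    Matrix.one_mulVec, Matrix.mulVec_smul, smul_smul,
    inv_mul_cancel₀ (mul_ne_zero hκ hd), one_smul] at h1
  rw [← h1, fusedScalar_eq_mul]
  congr 1
  field_simp

end IsAdmissible

end Model
end
end SOS

namespace SOS
noncomputable section

open Complex Matrix

theorem prod_pow_update {n : ℕ} (f : Fin n → ℂ) {h : Fin n → Fin 2} {b : Fin n} (hb : h b = 0) :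
    ∏ a, f a ^ (Function.update h b 1 a : ℕ) = f b * ∏ a, f a ^ (h a : ℕ) := by
  rw [← Finset.mul_prod_erase _ _ (Finset.mem_univ b), ← Finset.mul_prod_erase Finset.univ
    (fun a => f a ^ (h a : ℕ)) (Finset.mem_univ b), Function.update_self, hb]
  rw [Finset.prod_congr rfl fun c hc => by
    rw [Function.update_of_ne (Finset.ne_of_mem_erase hc)]]
  simp

namespace Model

variable {P : Model}

/-! ### Joint eigenvectors of theta families with an SOV basis -/

theorem nodeBasis_zero (a : Fin P.N) (u : ℂ) : P.nodeBasis 0 a u =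
    exp (I * P.y * (P.ξ a - u)) * (theta P.ω (P.t0 - u + P.ξ a) / theta P.ω P.t0) *
      (∏ b ∈ Finset.univ.erase a, theta P.ω (u - P.ξ b) / theta P.ω (P.ξ a - P.ξ b)) := by
  have h0 : P.tconf 0 = P.t0 := by simp [tconf, deg]
  simp only [nodeBasis, thetaBasis, h0, P.node_of_eq_zero (h := 0) rfl]

namespace IsAdmissible

variable (hP : P.IsAdmissible)
include hP

theorem isSectorThetaFun_of_mem {t : ℂ → ℂ} (ht : t ∈ P.discreteSolutions) :
    P.IsSectorThetaFun t := by
  have e : t = fun u => ∑ a, t (P.ξ a) * P.nodeBasis 0 a u := by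
    funext u
    rw [ht.1 u]
    exact Finset.sum_congr rfl fun a _ => by rw [nodeBasis_zero, mul_comm]
  rw [e]
  exact IsThetaFun.sum fun a _ => (hP.isSectorThetaFun_nodeBasis 0 a).const_mul _

variable (hI : P.InhomogeneityCondition)
include hI

/-- Interpolation and fusion are identities between matrices; applied to a common eigenvector they
become identities for the eigenvalue. -/
theorem mem_discreteSolutions {T : ℂ → Matrix P.Conf P.Conf ℂ}
    (hT : ∀ k l, P.IsSectorThetaFun fun u => T u k l)
    (hf : ∀ a, T (P.ξ a) * T (P.ξ a - P.η) = P.fusedScalar a • (1 : Matrix P.Conf P.Conf ℂ))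
    {t : ℂ → ℂ} {w : P.Conf → ℂ} (hw : w ≠ 0) (hTw : ∀ u, T u *ᵥ w = t u • w) :
    t ∈ P.discreteSolutions := by
  refine ⟨fun u => smul_left_injective ℂ hw ?_, fun a => smul_left_injective ℂ hw ?_⟩
  · simp only
    rw [← hTw, hP.interpolation_matrix hI 0 hT u, Matrix.sum_mulVec, Finset.sum_smul]
    refine Finset.sum_congr rfl fun a _ => ?_
    rw [P.node_of_eq_zero rfl, Matrix.smul_mulVec, hTw, smul_smul, nodeBasis_zero]
  · have := congrArg (· *ᵥ w) (hf a)
    simp only [← Matrix.mulVec_mulVec, hTw, Matrix.mulVec_smul, smul_smul, Matrix.smul_mulVec,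
      Matrix.one_mulVec] at this
    rw [mul_comm] at this
    exact this

end IsAdmissible

/-- Raising one label multiplies the component by `t(ξ_b)/s_b`, so one component determines all the
others. This is the source of simplicity. -/
theorem dotProduct_of_eigenvector {T : ℂ → Matrix P.Conf P.Conf ℂ} {r : P.Conf → P.Conf → ℂ}
    {s : Fin P.N → ℂ} (hs : ∀ b, s b ≠ 0)
    (h0 : ∀ h b, h b = 0 → r h ᵥ* T (P.ξ b) = s b • r (Function.update h b 1))
    {t : ℂ → ℂ} {w : P.Conf → ℂ} (hTw : ∀ u, T u *ᵥ w = t u • w) (h : P.Conf) :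
    r h ⬝ᵥ w = (∏ a, (t (P.ξ a) / s a) ^ (h a : ℕ)) * (r 0 ⬝ᵥ w) := by
  induction h using conf_induction with
  | h0 => simp
  | hs h b hb ih =>
    have e : s b * (r (Function.update h b 1) ⬝ᵥ w) = t (P.ξ b) * (r h ⬝ᵥ w) := by
      rw [← smul_eq_mul, ← smul_dotProduct, ← h0 h b hb, ← Matrix.dotProduct_mulVec, hTw,
        dotProduct_smul, smul_eq_mul]
    rw [prod_pow_update _ hb, mul_assoc, ← ih, div_mul_eq_mul_div, ← e,
      mul_div_cancel_left₀ _ (hs b)]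

/-- Both `T` and `t` are interpolated at the nodes of `h`, so for each `h` only points where `T`
raises or lowers a label occur. Raising matches the factorized components by construction, lowering
by the discrete equation. The family `T` is general so that the transposed transfer matrix with the
right SOV states is covered too. -/
theorem IsAdmissible.eigenvector_of_dotProduct (hP : P.IsAdmissible)
    (hI : P.InhomogeneityCondition) {T : ℂ → Matrix P.Conf P.Conf ℂ}
    (hT : ∀ k l, P.IsSectorThetaFun fun u => T u k l) {r : P.Conf → P.Conf → ℂ}
    {s s' : Fin P.N → ℂ} (hs : ∀ b, s b ≠ 0) (hss : ∀ b, s b * s' b = P.fusedScalar b)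
    (h0 : ∀ h b, h b = 0 → r h ᵥ* T (P.ξ b) = s b • r (Function.update h b 1))
    (h1 : ∀ h b, h b = 0 → r (Function.update h b 1) ᵥ* T (P.ξ b - P.η) = s' b • r h)
    (hr : ∀ w, (∀ h, r h ⬝ᵥ w = 0) → w = 0) {t : ℂ → ℂ} (ht : t ∈ P.discreteSolutions)
    {w : P.Conf → ℂ} {c : ℂ} (hw : ∀ h, r h ⬝ᵥ w = c * ∏ a, (t (P.ξ a) / s a) ^ (h a : ℕ)) (u : ℂ) :
    T u *ᵥ w = t u • w := by
  rw [← sub_eq_zero]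
  refine hr _ fun h => ?_
  rw [dotProduct_sub, dotProduct_smul, sub_eq_zero, Matrix.dotProduct_mulVec,
    hP.interpolation_matrix hI h hT u, Matrix.vecMul_sum, sum_dotProduct,
    hP.interpolation hI h (hP.isSectorThetaFun_of_mem ht) u, Finset.sum_smul]
  refine Finset.sum_congr rfl fun b _ => ?_
  rw [Matrix.vecMul_smul, smul_dotProduct, mul_smul]
  congr 1
  have hsb := hs b
  rcases (show h b = 0 ∨ h b = 1 by omega) with hb | hb
  · rw [P.node_of_eq_zero hb, h0 h b hb, smul_dotProduct, hw, hw, prod_pow_update _ hb, smul_eq_mul,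
      smul_eq_mul]
    field_simp
  · have e : Function.update (Function.update h b 0) b 1 = h := by
      rw [Function.update_idem, ← hb, Function.update_eq_self]
    have hg : Function.update h b 0 b = 0 := by simp
    have h2 := h1 _ b hg
    have h3 := prod_pow_update (fun a => t (P.ξ a) / s a) hg
    rw [e] at h2 h3
    rw [P.node_of_eq_one hb, h2, smul_dotProduct, hw, hw, h3, smul_eq_mul, smul_eq_mul]
    have h4 : t (P.ξ b) * t (P.ξ b - P.η) = s b * s' b := (ht.2 b).trans (hss b).symm
    field_simp
    linear_combination -(c * ∏ a, (t (P.ξ a) / s a) ^ (Function.update h b 0 a : ℕ)) * h4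

end Model
end
end SOS

namespace SOS
noncomputable section

open Complex Matrix

namespace Model

variable (P : Model)

/-! ### The theta functions `vartheta` and the determinants of the matrices `Theta` -/

/-- The exponent of the terms of `vartheta`. -/
def varthetaExp (j : ℕ) (n : ℤ) (u : ℂ) : ℂ :=
  I * Real.pi * P.N * P.ω * ((n : ℂ) + 1 / 2 - j / P.N) ^ 2 +
    2 * I * P.N * ((n : ℂ) + 1 / 2 - j / P.N) * (u - Real.pi / 2)

theorem vartheta_eq_jacobiTheta₂ (hN : 0 < P.N) (j : ℕ) (u : ℂ) :
    P.vartheta j u = exp (P.varthetaExp j 0 u) *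
      jacobiTheta₂ (P.N * P.ω * (1 / 2 - j / P.N) + P.N * (u / Real.pi - 1 / 2)) (P.N * P.ω) := by
  have hN' : (P.N : ℂ) ≠ 0 := by exact_mod_cast hN.ne'
  have hpi : (Real.pi : ℂ) ≠ 0 := by exact_mod_cast Real.pi_ne_zero
  rw [vartheta, jacobiTheta₂, ← tsum_mul_left]
  refine tsum_congr fun n => ?_
  rw [jacobiTheta₂_term, ← exp_add, varthetaExp]
  congr 1
  push_cast
  field_simp
  ring

theorem differentiable_vartheta (hN : 0 < P.N) (hω : 0 < P.ω.im) (j : ℕ) :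
    Differentiable ℂ (P.vartheta j) := by
  rw [funext (P.vartheta_eq_jacobiTheta₂ hN j)]
  have hτ : 0 < ((P.N : ℂ) * P.ω).im := by
    rw [← ofReal_natCast, im_ofReal_mul]
    exact mul_pos (by exact_mod_cast hN) hω
  intro u
  refine DifferentiableAt.mul (by unfold varthetaExp; fun_prop) ?_
  exact DifferentiableAt.comp (g := fun w => jacobiTheta₂ w (P.N * P.ω)) u
    (differentiableAt_jacobiTheta₂_fst _ hτ) (by fun_prop)

theorem vartheta_ne_zero (hN : 0 < P.N) (hω : 0 < P.ω.im) (j : ℕ) : P.vartheta j ≠ 0 := by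
  have hN' : (P.N : ℂ) ≠ 0 := by exact_mod_cast hN.ne'
  have hpi : (Real.pi : ℂ) ≠ 0 := by exact_mod_cast Real.pi_ne_zero
  have hτ : 0 < ((P.N : ℂ) * P.ω).im := by
    rw [← ofReal_natCast, im_ofReal_mul]
    exact mul_pos (by exact_mod_cast hN) hω
  obtain ⟨z, hz⟩ := jacobiTheta₂_ne_zero hτ
  intro h
  have := congrFun h (Real.pi * ((z - P.N * P.ω * (1 / 2 - j / P.N)) / P.N + 1 / 2))
  rw [vartheta_eq_jacobiTheta₂ P hN, Pi.zero_apply] at this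
  refine hz ?_
  convert (mul_eq_zero.mp this).resolve_left (exp_ne_zero _) using 2
  field_simp
  ring

theorem vartheta_add_pi_div (hN : 0 < P.N) (j : ℕ) (u : ℂ) :
    P.vartheta j (u + Real.pi / P.N) =
      exp (2 * Real.pi * I * (1 / 2 - j / P.N)) * P.vartheta j u := by
  have hN' : (P.N : ℂ) ≠ 0 := by exact_mod_cast hN.ne'
  rw [vartheta, vartheta, ← tsum_mul_left]
  refine tsum_congr fun n => ?_
  rw [← exp_add]
  refine exp_eq_exp_iff_exists_int.mpr ⟨n, ?_⟩
  field_simp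
  ring

theorem isThetaFun_vartheta (hN : 0 < P.N) (hω : 0 < P.ω.im) (j : ℕ) (s : ℂ) :
    IsThetaFun P.ω P.N ((-1) ^ P.N)
      ((-1) ^ P.N * exp (-(I * Real.pi * P.ω * P.N) + 2 * I * (P.N * s)))
      (fun u => P.vartheta j (u - s)) := by
  have hN' : (P.N : ℂ) ≠ 0 := by exact_mod_cast hN.ne'
  have hneg : (-1 : ℂ) ^ P.N = exp (P.N * (Real.pi * I)) := by rw [exp_nat_mul, exp_pi_mul_I]
  refine ⟨(P.differentiable_vartheta hN hω j).comp (by fun_prop), fun u => ?_, fun u => ?_⟩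
  · rw [vartheta, vartheta, ← tsum_mul_left, hneg]
    refine tsum_congr fun n => ?_
    rw [← exp_add]
    refine exp_eq_exp_iff_exists_int.mpr ⟨P.N * n - j, ?_⟩
    push_cast
    field_simp
    ring
  · rw [vartheta, vartheta, ← tsum_mul_left, hneg,
      ← (Equiv.addRight (1 : ℤ)).tsum_eq (fun n : ℤ => exp _ * _ * _ * _)]
    refine tsum_congr fun n => ?_
    rw [← exp_add, ← exp_add, ← exp_add]
    congr 1
    simp only [Equiv.coe_addRight]
    push_cast
    ring

/-- These functions are eigenvectors of translation by `π/N`, with pairwise distinct eigenvalues. -/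
theorem linearIndependent_vartheta (hN : 0 < P.N) (hω : 0 < P.ω.im) :
    LinearIndependent ℂ fun j : Fin P.N => P.vartheta j := by
  have hN' : (P.N : ℂ) ≠ 0 := by exact_mod_cast hN.ne'
  let S : Module.End ℂ (ℂ → ℂ) := LinearMap.funLeft ℂ ℂ fun u => u + Real.pi / P.N
  refine Module.End.eigenvectors_linearIndependent' S
    (fun j : Fin P.N => exp (2 * Real.pi * I * (1 / 2 - j / P.N))) ?_ _ fun j =>
      ⟨Module.End.mem_eigenspace_iff.mpr (funext fun u => P.vartheta_add_pi_div hN j u),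
        P.vartheta_ne_zero hN hω j⟩
  intro i j hij
  obtain ⟨m, hm⟩ := exp_eq_exp_iff_exists_int.mp hij
  have h2 : (2 * Real.pi * I : ℂ) ≠ 0 := two_pi_I_ne_zero
  have h3 : (1 / 2 - i / P.N : ℂ) = 1 / 2 - j / P.N + m := by
    apply mul_left_cancel₀ h2
    linear_combination hm
  have h4 : (j : ℂ) = i + m * P.N := by
    field_simp at h3
    linear_combination h3 / 2
  have h5 : ((j : ℕ) : ℤ) = (i : ℕ) + m * P.N := by exact_mod_cast h4
  have hi := i.2
  have hj := j.2
  have hm0 : m = 0 := by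
    rcases lt_trichotomy m 0 with h | h | h
    · nlinarith
    · exact h
    · nlinarith
  rw [hm0] at h5
  exact Fin.ext (by omega)

/-- The shift in the arguments of the matrices `Theta`. -/
def nodeCenter : ℂ := (∑ k, P.ξ k + P.t0) / P.N

/-- The centre is chosen so that `N` times it is `∑ ξ + t₀`. The functions thus have the multipliers
of the sector space with `y = 0`, whose nodes may again be those of any `h`. -/
theorem isThetaFun_vartheta_node (hN : 0 < P.N) (hω : 0 < P.ω.im) (h : P.Conf) (j : ℕ) :
    IsThetaFun P.ω (Fintype.card (Fin P.N))
      ((-1) ^ Fintype.card (Fin P.N) * exp (-(I * 0 * Real.pi)))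
      ((-1) ^ Fintype.card (Fin P.N) * exp (-(I * 0 * (Real.pi * P.ω)) -
        I * Real.pi * P.ω * Fintype.card (Fin P.N) + 2 * I * (∑ a, P.node h a + P.tconf h)))
      (fun u => P.vartheta j (u - P.nodeCenter)) := by
  have hN' : (P.N : ℂ) ≠ 0 := by exact_mod_cast hN.ne'
  have := P.isThetaFun_vartheta hN hω j P.nodeCenter
  rw [nodeCenter, mul_div_cancel₀ _ hN'] at this
  rw [Fintype.card_fin, sum_node_add]
  simpa [nodeCenter] using this

namespace IsAdmissible

variable {P} (hP : P.IsAdmissible) (hI : P.InhomogeneityCondition) (hN : 0 < P.N)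
include hP hI hN

/-- A kernel vector would give a combination of the `ϑ_j` vanishing at all `N` nodes of `h`, hence
identically, against linear independence. -/
theorem det_Theta_ne_zero (h : P.Conf) : (P.Theta h).det ≠ 0 := by
  intro h0
  obtain ⟨v, hv, hv0⟩ := Matrix.exists_mulVec_eq_zero_iff.mpr h0
  have hg : ∀ u, ∑ j, v j * P.vartheta j (u - P.nodeCenter) = 0 := by
    refine IsThetaFun.eq_zero_of_nodes (y := 0) (τ := P.tconf h) (x := P.node h) hP.im_pos
      (fun a b hab => hP.node_sub_node_notMem hI h hab) (hP.tconf_notMem h)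
      (IsThetaFun.sum fun j _ => (P.isThetaFun_vartheta_node hN hP.im_pos h j).const_mul (v j))
      fun a => ?_
    have := congrFun hv0 a
    simp only [Matrix.mulVec, dotProduct, Theta, Matrix.of_apply, Pi.zero_apply] at this
    rw [← this]
    exact Finset.sum_congr rfl fun j _ => mul_comm _ _
  refine hv (funext fun j => ?_)
  refine Fintype.linearIndependent_iff.mp (P.linearIndependent_vartheta hN hP.im_pos) v ?_ j
  funext u
  have := hg (u + P.nodeCenter)
  simpa using this

/-- As a function of the argument in row `b`, the determinant is a theta function of order `N` which
vanishes at the other nodes by equality of two rows. It is therefore a multiple of one interpolation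
function; that function is taken with `y = 0`, which accounts for the phase. -/
theorem det_Theta_update {h : P.Conf} {b : Fin P.N} (hb : h b = 0) :
    P.phase P.η * (P.Theta (Function.update h b 1)).det =
      P.nodeBasis h b (P.ξ b - P.η) * (P.Theta h).det := by
  let f : ℂ → ℂ := fun u =>
    ((P.Theta h).updateRow b fun j => P.vartheta j (u - P.nodeCenter)).det
  have hf : f = fun u => ∑ j : Fin P.N, (P.Theta h)ᵀ.adjugate b j *
      P.vartheta j (u - P.nodeCenter) := by
    funext u
    simp only [f]
    rw [← Matrix.cramer_transpose_apply, Matrix.cramer_eq_adjugate_mulVec]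
    rfl
  have h1 := IsThetaFun.interpolation (y := 0) (τ := P.tconf h) (x := P.node h) (f := f) hP.im_pos
      (fun a b hab => hP.node_sub_node_notMem hI h hab) (hP.tconf_notMem h) (by
        rw [hf]
        exact IsThetaFun.sum fun j _ => (P.isThetaFun_vartheta_node hN hP.im_pos h j).const_mul _)
      (P.ξ b - P.η)
  have h2 : f (P.ξ b - P.η) = (P.Theta (Function.update h b 1)).det := by
    simp only [f]
    congr 1
    ext i j
    by_cases hi : i = b
    · subst hi; simp [Theta, nodeCenter]
    · simp [Theta, hi]
  have h3 (a : Fin P.N) : (fun j : Fin P.N => P.vartheta j (P.node h a - P.nodeCenter)) =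
      P.Theta h a := rfl
  rw [h2, Finset.sum_eq_single b] at h1
  · have h4 : f (P.node h b) = (P.Theta h).det := by
      simp only [f, h3, Matrix.updateRow_eq_self]
    rw [h1, h4, nodeBasis, thetaBasis, thetaBasis, P.node_of_eq_zero hb, phase]
    simp
    ring
  · intro a _ hab
    have : f (P.node h a) = 0 := by
      simp only [f, h3]
      exact Matrix.det_zero_of_row_eq hab (by simp [hab])
    rw [this, mul_zero]
  · simp

end IsAdmissible

end Model
end
end SOS

namespace SOS
noncomputable section

open Complex Matrix

/-! ### Joint eigenvectors of commuting families -/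

/-- Let `J` be the ideal generated by the `g i`. If `J V = V`, Nakayama's lemma gives `r ∈ 1 + J`
killing `V`; but `J` kills `w`, so `r w = w ≠ 0`. Hence `J V` is proper and some non-zero functional
vanishes on it. -/
theorem exists_dual_of_smul_eq_zero {A V ι : Type*} [CommRing A] [Algebra ℂ A] [AddCommGroup V]
    [Module ℂ V] [Module A V] [IsScalarTower ℂ A V] [FiniteDimensional ℂ V] (g : ι → A)
    {w : V} (hw : w ≠ 0) (h : ∀ i, g i • w = 0) :
    ∃ φ : Module.Dual ℂ V, φ ≠ 0 ∧ ∀ i x, φ (g i • x) = 0 := by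
  have : Module.Finite A V := Module.Finite.of_restrictScalars_finite ℂ A V
  obtain ⟨J, hJdef⟩ : ∃ J : Ideal A, J = Ideal.span (Set.range g) := ⟨_, rfl⟩
  have hJ : ∀ a ∈ J, a • w = 0 := by
    intro a ha
    rw [hJdef] at ha
    induction ha using Submodule.span_induction with
    | mem x hx => obtain ⟨i, rfl⟩ := hx; exact h i
    | zero => exact zero_smul A w
    | add x y _ _ hx hy => rw [add_smul, hx, hy, add_zero]
    | smul a x _ hx => rw [smul_assoc, hx, smul_zero]
  have hne : J • (⊤ : Submodule A V) ≠ ⊤ := by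
    intro htop
    obtain ⟨r, hr, hr0⟩ := Submodule.exists_sub_one_mem_and_smul_eq_zero_of_fg_of_le_smul J
      (⊤ : Submodule A V) Module.Finite.fg_top htop.ge
    have h1 := hJ _ hr
    rw [sub_smul, hr0 w trivial, one_smul, zero_sub, neg_eq_zero] at h1
    exact hw h1
  have hlt : (J • (⊤ : Submodule A V)).restrictScalars ℂ < ⊤ :=
    lt_top_iff_ne_top.mpr fun h' => hne ((Submodule.restrictScalars_eq_top_iff ℂ A V).mp h')
  obtain ⟨φ, hφ, hker⟩ := Submodule.exists_le_ker_of_lt_top _ hlt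
  refine ⟨φ, hφ, fun i x => ?_⟩
  have hm : g i • x ∈ J • (⊤ : Submodule A V) :=
    Submodule.smul_mem_smul (hJdef ▸ Ideal.subset_span ⟨i, rfl⟩) Submodule.mem_top
  exact hker hm
open scoped IsMulCommutative in
theorem exists_dual_of_common_kernel {V ι : Type*} [AddCommGroup V] [Module ℂ V]
    [FiniteDimensional ℂ V] {F : ι → Module.End ℂ V} (hc : ∀ i j, F i * F j = F j * F i)
    {w : V} (hw : w ≠ 0) (h : ∀ i, F i w = 0) :
    ∃ φ : Module.Dual ℂ V, φ ≠ 0 ∧ ∀ i x, φ (F i x) = 0 := by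
  have := Algebra.isMulCommutative_adjoin ℂ (s := Set.range F) (by
    rintro _ ⟨i, rfl⟩ _ ⟨j, rfl⟩
    exact hc i j)
  exact exists_dual_of_smul_eq_zero (A := Algebra.adjoin ℂ (Set.range F))
    (fun i => ⟨F i, Algebra.subset_adjoin ⟨i, rfl⟩⟩) hw h

theorem exists_left_eigenvector {ι : Type*} [Fintype ι] [DecidableEq ι] {M : ℂ → Matrix ι ι ℂ}
    (hc : ∀ u v, Commute (M u) (M v)) {t : ℂ → ℂ} {w : ι → ℂ} (hw : w ≠ 0)
    (h : ∀ u, M u *ᵥ w = t u • w) : ∃ φ : ι → ℂ, φ ≠ 0 ∧ ∀ u, φ ᵥ* M u = t u • φ := by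
  obtain ⟨φ, hφ, hφ0⟩ := exists_dual_of_common_kernel
    (F := fun u => Matrix.toLin' (M u - t u • (1 : Matrix ι ι ℂ))) (fun u v => by
      have : Commute (M u - t u • (1 : Matrix ι ι ℂ)) (M v - t v • (1 : Matrix ι ι ℂ)) :=
        ((hc u v).sub_right ((Commute.one_right _).smul_right _)).sub_left
          ((Commute.one_left _).smul_left _)
      simp only [Module.End.mul_eq_comp, ← Matrix.toLin'_mul, this.eq]) hw (fun u => by
      rw [Matrix.toLin'_apply, Matrix.sub_mulVec, h, Matrix.smul_mulVec, Matrix.one_mulVec,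
        sub_self])
  have hφv (x : ι → ℂ) : φ x = (fun i => φ (Pi.single i 1)) ⬝ᵥ x := by
    conv_lhs => rw [pi_eq_sum_univ' x]
    simp only [map_sum, map_smul, dotProduct, smul_eq_mul]
    refine Finset.sum_congr rfl fun i _ => ?_
    rw [mul_comm]
  refine ⟨fun i => φ (Pi.single i 1), fun h0 => hφ (LinearMap.ext fun x => by
    rw [hφv, h0, zero_dotProduct]; rfl), fun u => ?_⟩
  refine dotProduct_eq _ _ fun x => ?_
  have := hφ0 u x
  rw [Matrix.toLin'_apply, Matrix.sub_mulVec, Matrix.smul_mulVec, Matrix.one_mulVec, map_sub,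
    map_smul, sub_eq_zero, hφv, hφv x, Matrix.dotProduct_mulVec] at this
  rw [this, smul_dotProduct]

namespace Model

variable {P : Model}

/-- `B` joins configurations whose degrees differ by one in one direction, `C` in the other, so the
diagonal matrix `(κ/κ')^deg` intertwines the two twists. -/
theorem transferMatrix_rescale {κ κ' : ℂ} (hκ : κ ≠ 0) (hκ' : κ' ≠ 0) (u : ℂ) (h k : P.Conf) :
    P.transferMatrix κ' u h k * (κ / κ') ^ deg k = (κ / κ') ^ deg h * P.transferMatrix κ u h k := by
  simp only [transferMatrix, Matrix.add_apply, Matrix.smul_apply, smul_eq_mul]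
  by_cases h1 : deg h = deg k + 1
  · rw [P.opM_eq_zero (i := 1) (j := 0) (by simp; omega), h1, pow_succ]
    field_simp
    ring
  · rw [P.opM_eq_zero (i := 0) (j := 1) (by simp; omega)]
    by_cases h2 : deg k = deg h + 1
    · rw [h2, pow_succ]
      field_simp
      ring
    · rw [P.opM_eq_zero (i := 1) (j := 0) (by simp; omega)]
      simp

theorem exists_right_eigenvector_rescale {κ κ' : ℂ} (hκ : κ ≠ 0) (hκ' : κ' ≠ 0) {t : ℂ → ℂ}
    (h : ∃ w : P.Conf → ℂ, w ≠ 0 ∧ ∀ u, P.transferMatrix κ u *ᵥ w = t u • w) :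
    ∃ w : P.Conf → ℂ, w ≠ 0 ∧ ∀ u, P.transferMatrix κ' u *ᵥ w = t u • w := by
  obtain ⟨w, hw, hTw⟩ := h
  have hc : κ / κ' ≠ 0 := div_ne_zero hκ hκ'
  refine ⟨fun k => (κ / κ') ^ deg k * w k, fun h0 => hw (funext fun k => ?_), fun u => ?_⟩
  · exact (mul_eq_zero.mp (congrFun h0 k)).resolve_left (pow_ne_zero _ hc)
  · funext h
    have := congrFun (hTw u) h
    simp only [Matrix.mulVec, dotProduct, Pi.smul_apply, smul_eq_mul, ← mul_assoc,
      transferMatrix_rescale hκ hκ'] at this ⊢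
    simp only [mul_assoc, ← Finset.mul_sum, this]
    ring

/-! ### The eigenstates -/

theorem span_eq_of_dotProduct {T : ℂ → Matrix P.Conf P.Conf ℂ} {r : P.Conf → P.Conf → ℂ}
    {s : Fin P.N → ℂ} (hs : ∀ b, s b ≠ 0)
    (h0 : ∀ h b, h b = 0 → r h ᵥ* T (P.ξ b) = s b • r (Function.update h b 1))
    (hr : ∀ w, (∀ h, r h ⬝ᵥ w = 0) → w = 0) {t : ℂ → ℂ} {ψ : P.Conf → ℂ} {c : ℂ} (hc : c ≠ 0)
    (hψ : ∀ h, r h ⬝ᵥ ψ = c * ∏ a, (t (P.ξ a) / s a) ^ (h a : ℕ))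
    {w : P.Conf → ℂ} (hTw : ∀ u, T u *ᵥ w = t u • w) : w = ((r 0 ⬝ᵥ w) / c) • ψ := by
  rw [← sub_eq_zero]
  refine hr _ fun h => ?_
  rw [dotProduct_sub, dotProduct_smul, hψ, dotProduct_of_eigenvector hs h0 hTw, smul_eq_mul]
  field_simp
  ring

/-- The coordinates of the factorized right state. -/
def rightPsiVec (P : Model) (ν κ : ℂ) (q : Fin P.N → Fin 2 → ℂ) : P.Conf → ℂ :=
  ∑ h : P.Conf,
    ((∏ a, (κ⁻¹ * exp (I * P.y * P.η) *
        (P.faxy (P.ξ a) / P.fd (P.ξ a - P.η))) ^ (h a : ℕ) * q a (h a)) *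
      (P.Theta h).det) • P.rightVec ν h

/-- The coordinates of the factorized left state. -/
def leftPsiVec (P : Model) (ν κ : ℂ) (q : Fin P.N → Fin 2 → ℂ) : P.Conf → ℂ :=
  ∑ h : P.Conf,
    ((∏ a, (κ * exp (I * P.y * P.η)) ^ (h a : ℕ) * q a (h a)) *
      (P.Theta h).det) • P.leftVec ν h

namespace IsAdmissible

variable (hP : P.IsAdmissible) (hI : P.InhomogeneityCondition) (hN : 0 < P.N)
include hP hI

theorem quotient_eq {t : ℂ → ℂ} (ht : t ∈ P.discreteSolutions) (a : Fin P.N) :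
    t (P.ξ a) ≠ 0 ∧ t (P.ξ a - P.η) ≠ 0 ∧
      P.fd (P.ξ a - P.η) / t (P.ξ a - P.η) = t (P.ξ a) / P.faxy (P.ξ a) := by
  have h1 : t (P.ξ a) * t (P.ξ a - P.η) = P.faxy (P.ξ a) * P.fd (P.ξ a - P.η) := ht.2 a
  have h2 := hP.fusedScalar_ne_zero hI a
  rw [fusedScalar_eq_mul, ← h1] at h2
  have h3 := left_ne_zero_of_mul h2
  have h4 := right_ne_zero_of_mul h2
  have h5 := hP.faxy_ne_zero hI a
  refine ⟨h3, h4, ?_⟩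
  field_simp
  linear_combination -h1

include hN

/-- The pairing and `det Θ` obey inverse recursions up to the phase. So `det Θ` is, up to phases and
a constant, the inverse norm of the SOV states, and inserting it makes the components of the
eigenstates pure products. -/
theorem det_mul_pairing (ν : ℂ) (h : P.Conf) :
    (∏ a : Fin P.N, P.phase P.η ^ (h a : ℕ)) * (P.Theta h).det *
      (P.leftVec ν h ⬝ᵥ P.rightVec ν h) =
      (P.Theta 0).det * (P.leftVec ν 0 ⬝ᵥ P.rightVec ν 0) := by
  induction h using conf_induction with
  | h0 => simp
  | hs h b hb ih =>
    rw [← ih, prod_pow_update _ hb, hP.pairing_self hI ν hb]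
    linear_combination (∏ a : Fin P.N, P.phase P.η ^ (h a : ℕ)) *
      (P.leftVec ν (Function.update h b 1) ⬝ᵥ P.rightVec ν (Function.update h b 1)) *
      hP.det_Theta_update hI hN hb

theorem coeff_mul_pairing (ν : ℂ) (f : Fin P.N → ℂ) {q : Fin P.N → Fin 2 → ℂ}
    (hq : ∀ a, q a 0 ≠ 0) (h : P.Conf) :
    (∏ a, (f a * P.phase P.η) ^ (h a : ℕ) * q a (h a)) * (P.Theta h).det *
      (P.leftVec ν h ⬝ᵥ P.rightVec ν h) =
      ((∏ a, q a 0) * ((P.Theta 0).det * (P.leftVec ν 0 ⬝ᵥ P.rightVec ν 0))) *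
        ∏ a, (f a * (q a 1 / q a 0)) ^ (h a : ℕ) := by
  rw [← hP.det_mul_pairing hI hN ν h]
  have e : ∏ a, (f a * P.phase P.η) ^ (h a : ℕ) * q a (h a) =
      (∏ a, q a 0) * (∏ a, (f a * (q a 1 / q a 0)) ^ (h a : ℕ)) *
        ∏ a : Fin P.N, P.phase P.η ^ (h a : ℕ) := by
    rw [← Finset.prod_mul_distrib, ← Finset.prod_mul_distrib]
    refine Finset.prod_congr rfl fun a _ => ?_
    have := hq a
    rcases (show h a = 0 ∨ h a = 1 by omega) with ha | ha
    · simp [ha]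
    · simp [ha]; field_simp
  rw [e]; ring

theorem coeff_ne_zero {ν : ℂ} (hν : ν ≠ 0) {q : Fin P.N → Fin 2 → ℂ} (hq : ∀ a, q a 0 ≠ 0) :
    (∏ a, q a 0) * ((P.Theta 0).det * (P.leftVec ν 0 ⬝ᵥ P.rightVec ν 0)) ≠ 0 :=
  mul_ne_zero (Finset.prod_ne_zero_iff.mpr fun a _ => hq a)
    (mul_ne_zero (hP.det_Theta_ne_zero hI hN 0) (hP.pairing_ne_zero hI hν 0))

theorem leftVec_dotProduct_rightPsiVec (ν : ℂ) {κ : ℂ} (hκ : κ ≠ 0) {t : ℂ → ℂ}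
    (ht : t ∈ P.discreteSolutions) {q : Fin P.N → Fin 2 → ℂ} (hq : ∀ a, q a 0 ≠ 0 ∧
      q a 1 / q a 0 = P.fd (P.ξ a - P.η) / t (P.ξ a - P.η)) (h : P.Conf) :
    P.leftVec ν h ⬝ᵥ P.rightPsiVec ν κ q =
      ((∏ a, q a 0) * ((P.Theta 0).det * (P.leftVec ν 0 ⬝ᵥ P.rightVec ν 0))) *
        ∏ a, (t (P.ξ a) / (κ * P.fd (P.ξ a - P.η))) ^ (h a : ℕ) := by
  rw [rightPsiVec, dotProduct_sum, Finset.sum_eq_single h (fun k _ hk => by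
    rw [dotProduct_smul, hP.pairing_eq_zero ν hk.symm, smul_zero]) (by simp), dotProduct_smul,
    smul_eq_mul]
  have e (a : Fin P.N) : κ⁻¹ * exp (I * P.y * P.η) * (P.faxy (P.ξ a) / P.fd (P.ξ a - P.η)) =
      (κ⁻¹ * (P.faxy (P.ξ a) / P.fd (P.ξ a - P.η))) * P.phase P.η := by rw [phase]; ring
  simp only [e]
  rw [hP.coeff_mul_pairing hI hN ν _ fun a => (hq a).1]
  congr 1
  refine Finset.prod_congr rfl fun a _ => ?_
  have h1 := hP.faxy_ne_zero hI a
  have h2 := hP.fd_ne_zero hI a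
  rw [(hq a).2, (hP.quotient_eq hI ht a).2.2]
  congr 1
  field_simp

theorem rightVec_dotProduct_leftPsiVec (ν : ℂ) {κ : ℂ} (hκ : κ ≠ 0) {t : ℂ → ℂ}
    (ht : t ∈ P.discreteSolutions) {q : Fin P.N → Fin 2 → ℂ} (hq : ∀ a, q a 0 ≠ 0 ∧
      q a 1 / q a 0 = P.fd (P.ξ a - P.η) / t (P.ξ a - P.η)) (h : P.Conf) :
    P.rightVec ν h ⬝ᵥ P.leftPsiVec ν κ q =
      ((∏ a, q a 0) * ((P.Theta 0).det * (P.leftVec ν 0 ⬝ᵥ P.rightVec ν 0))) *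
        ∏ a, (t (P.ξ a) / (κ⁻¹ * P.faxy (P.ξ a))) ^ (h a : ℕ) := by
  rw [leftPsiVec, dotProduct_sum, Finset.sum_eq_single h (fun k _ hk => by
    rw [dotProduct_smul, dotProduct_comm, hP.pairing_eq_zero ν hk, smul_zero]) (by simp),
    dotProduct_smul, smul_eq_mul, dotProduct_comm]
  have e : κ * exp (I * P.y * P.η) = κ * P.phase P.η := rfl
  simp only [e]
  rw [hP.coeff_mul_pairing hI hN ν _ fun a => (hq a).1]
  congr 1
  refine Finset.prod_congr rfl fun a _ => ?_
  have h1 := hP.faxy_ne_zero hI a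
  rw [(hq a).2, (hP.quotient_eq hI ht a).2.2]
  congr 1
  field_simp

theorem rightPsiVec_spec {ν κ : ℂ} (hν : ν ≠ 0) (hκ : κ ≠ 0) {t : ℂ → ℂ}
    (ht : t ∈ P.discreteSolutions) {q : Fin P.N → Fin 2 → ℂ} (hq : ∀ a, q a 0 ≠ 0 ∧
      q a 1 / q a 0 = P.fd (P.ξ a - P.η) / t (P.ξ a - P.η)) :
    P.rightPsiVec ν κ q ≠ 0 ∧
      (∀ u, P.transferMatrix κ u *ᵥ P.rightPsiVec ν κ q = t u • P.rightPsiVec ν κ q) ∧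
      ∀ w, (∀ u, P.transferMatrix κ u *ᵥ w = t u • w) → ∃ c : ℂ, w = c • P.rightPsiVec ν κ q := by
  have hc := hP.coeff_ne_zero hI hN hν fun a => (hq a).1
  have hψ := hP.leftVec_dotProduct_rightPsiVec hI hN ν hκ ht hq
  have hs (a : Fin P.N) : κ * P.fd (P.ξ a - P.η) ≠ 0 := mul_ne_zero hκ (hP.fd_ne_zero hI a)
  have hr (w : P.Conf → ℂ) := hP.eq_zero_of_leftVec_dotProduct hI hν (w := w)
  refine ⟨fun h0 => ?_, ?_, fun w hw => ?_⟩
  · have := hψ 0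
    rw [h0, dotProduct_zero] at this
    simp at this
    exact hc (by simpa using this)
  · exact hP.eigenvector_of_dotProduct hI (T := P.transferMatrix κ) (r := P.leftVec ν)
      (P.isSectorThetaFun_transferMatrix hP κ) hs (s' := fun a => κ⁻¹ * P.faxy (P.ξ a))
      (fun a => by rw [fusedScalar_eq_mul]; field_simp)
      (fun h b hb => hP.leftVec_vecMul_transfer hI ν κ hb)
      (fun h b hb => hP.leftVec_update_vecMul_transfer hI ν hκ hb) hr ht hψ
  · exact ⟨_, span_eq_of_dotProduct (T := P.transferMatrix κ) (r := P.leftVec ν) hs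
      (fun h b hb => hP.leftVec_vecMul_transfer hI ν κ hb) hr hc hψ hw⟩

theorem leftPsiVec_spec {ν κ : ℂ} (hν : ν ≠ 0) (hκ : κ ≠ 0) {t : ℂ → ℂ}
    (ht : t ∈ P.discreteSolutions) {q : Fin P.N → Fin 2 → ℂ} (hq : ∀ a, q a 0 ≠ 0 ∧
      q a 1 / q a 0 = P.fd (P.ξ a - P.η) / t (P.ξ a - P.η)) :
    P.leftPsiVec ν κ q ≠ 0 ∧
      (∀ u, P.leftPsiVec ν κ q ᵥ* P.transferMatrix κ u = t u • P.leftPsiVec ν κ q) ∧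
      ∀ w, (∀ u, w ᵥ* P.transferMatrix κ u = t u • w) → ∃ c : ℂ, w = c • P.leftPsiVec ν κ q := by
  have hc := hP.coeff_ne_zero hI hN hν fun a => (hq a).1
  have hψ := hP.rightVec_dotProduct_leftPsiVec hI hN ν hκ ht hq
  have hs (a : Fin P.N) : κ⁻¹ * P.faxy (P.ξ a) ≠ 0 :=
    mul_ne_zero (inv_ne_zero hκ) (hP.faxy_ne_zero hI a)
  have hr (w : P.Conf → ℂ) := hP.eq_zero_of_rightVec_dotProduct hI hν (w := w)
  -- For the transposed family the right states play the role of the covectors, with the raising and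
  -- lowering factors `κ d` and `κ⁻¹ a_{x,y}` interchanged.
  have h0 : ∀ h b, h b = 0 → P.rightVec ν h ᵥ* (P.transferMatrix κ (P.ξ b))ᵀ =
      (κ⁻¹ * P.faxy (P.ξ b)) • P.rightVec ν (Function.update h b 1) := fun h b hb => by
    rw [Matrix.vecMul_transpose, hP.transfer_mulVec_rightVec hI hν hκ hb]
  have h1 : ∀ h b, h b = 0 → P.rightVec ν (Function.update h b 1) ᵥ*
      (P.transferMatrix κ (P.ξ b - P.η))ᵀ = (κ * P.fd (P.ξ b - P.η)) • P.rightVec ν h :=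
    fun h b hb => by rw [Matrix.vecMul_transpose, hP.transfer_mulVec_rightVec_update hI hν κ hb]
  refine ⟨fun h0 => ?_, fun u => ?_, fun w hw => ?_⟩
  · have := hψ 0
    rw [h0, dotProduct_zero] at this
    simp at this
    exact hc (by simpa using this)
  · rw [← Matrix.mulVec_transpose]
    exact hP.eigenvector_of_dotProduct hI (T := fun u => (P.transferMatrix κ u)ᵀ) (r := P.rightVec ν)
      (fun k l => P.isSectorThetaFun_transferMatrix hP κ l k) hs
      (s' := fun a => κ * P.fd (P.ξ a - P.η))
      (fun a => by rw [fusedScalar_eq_mul]; field_simp) h0 h1 hr ht hψ u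
  · exact ⟨_, span_eq_of_dotProduct (T := fun u => (P.transferMatrix κ u)ᵀ) (r := P.rightVec ν) hs h0 hr hc hψ
      fun u => by rw [Matrix.mulVec_transpose, hw u]⟩

omit hN in
theorem mem_discreteSolutions_of_right {κ : ℂ} (hκ : κ ≠ 0) {t : ℂ → ℂ} {w : P.Conf → ℂ}
    (hw : w ≠ 0) (hTw : ∀ u, P.transferMatrix κ u *ᵥ w = t u • w) : t ∈ P.discreteSolutions :=
  hP.mem_discreteSolutions hI (P.isSectorThetaFun_transferMatrix hP κ)
    (fun a => P.transferMatrix_mul_fused hP hκ a) hw hTw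

end IsAdmissible

end Model
end
end SOS

namespace SOS
noncomputable section

open Complex Matrix

namespace Model

variable (P : Model)

/-! ### The antiperiodic sector inside the dynamical-spin space -/

/-- The inclusion of the antiperiodic sector. -/
def embed : (P.Conf → ℂ) →ₗ[ℂ] P.Space :=
  Fintype.linearCombination ℂ fun h : P.Conf => Finsupp.single (h, -(deg h : ℤ)) (1 : ℂ)

/-- The inclusion of the covectors of the antiperiodic sector. -/
def embedDual : (P.Conf → ℂ) →ₗ[ℂ] Module.Dual ℂ P.Space :=
  Fintype.linearCombination ℂ fun h : P.Conf => P.bra (h, -(deg h : ℤ))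

/-- The restriction of a vector to the antiperiodic sector. -/
def restrict (v : P.Space) : P.Conf → ℂ := fun h => v (h, -(deg h : ℤ))

theorem embed_apply (w : P.Conf → ℂ) (h : P.Conf) (a : ℤ) :
    P.embed w (h, a) = if a = -(deg h : ℤ) then w h else 0 := by
  rw [embed, Fintype.linearCombination_apply, Finsupp.finsetSum_apply, Finset.sum_eq_single h]
  · simp only [Finsupp.smul_single, smul_eq_mul, mul_one, Finsupp.single_apply, Prod.mk.injEq,
      true_and, eq_comm (a := a)]
  · intro k _ hk
    simp [hk]
  · simp

theorem restrict_embed (w : P.Conf → ℂ) : P.restrict (P.embed w) = w := by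
  funext h
  simp [restrict, embed_apply]

theorem embedDual_apply (φ : P.Conf → ℂ) (v : P.Space) : P.embedDual φ v = φ ⬝ᵥ P.restrict v := by
  rw [embedDual, Fintype.linearCombination_apply, LinearMap.sum_apply]
  rfl

theorem eq_embed_restrict {v : P.Space} (hv : ∀ h a, a ≠ -(deg h : ℤ) → v (h, a) = 0) :
    v = P.embed (P.restrict v) := by
  ext ⟨h, a⟩
  rw [embed_apply]
  split_ifs with ha
  · rw [restrict, ha]
  · exact hv h a ha

theorem embed_injective : Function.Injective P.embed :=
  Function.LeftInverse.injective P.restrict_embed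

theorem embedDual_injective : Function.Injective P.embedDual := by
  intro φ ψ h
  refine dotProduct_eq _ _ fun w => ?_
  have := LinearMap.congr_fun h (P.embed w)
  rwa [embedDual_apply, embedDual_apply, restrict_embed] at this

theorem substTau_apply (F : ℂ → Matrix P.Conf P.Conf ℂ) (v : P.Space) (h : P.Conf) (a : ℤ) :
    P.substTau F v (h, a) = ∑ k, F (P.tval a) h k * v (k, a) := by
  induction v using Finsupp.induction_linear with
  | zero => simp
  | add v w hv hw =>
    simp only [map_add, Finsupp.add_apply, hv, hw, mul_add, Finset.sum_add_distrib]
  | single p c =>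
    obtain ⟨k, b⟩ := p
    rw [substTau, Finsupp.linearCombination_single, Finsupp.smul_apply, Finsupp.finsetSum_apply,
      Finset.sum_eq_single h (fun l _ hl => by simp [hl]) (by simp),
      Finset.sum_eq_single k (fun l _ hl => by simp [hl.symm]) (by simp)]
    by_cases hab : b = a
    · subst hab; simp [mul_comm]
    · simp [hab]

theorem shiftT_apply (s : ℤ) (v : P.Space) (h : P.Conf) (a : ℤ) :
    P.shiftT s v (h, a) = v (h, a - s) := by
  have hinj : Function.Injective fun p : P.Conf × ℤ => (p.1, p.2 + s) := by
    rintro ⟨h, a⟩ ⟨k, b⟩ he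
    simpa using he
  have e : (h, a) = (fun p : P.Conf × ℤ => (p.1, p.2 + s)) (h, a - s) := by simp
  rw [shiftT, Finsupp.lmapDomain_apply, e, Finsupp.mapDomain_apply hinj]

theorem calB_apply (u : ℂ) (v : P.Space) (h : P.Conf) (a : ℤ) :
    P.calB u v (h, a) = ∑ k, P.opB u (P.tval a) h k * v (k, a + 1) := by
  rw [calB, Module.End.mul_apply, substTau_apply]
  simp only [shiftT_apply, sub_neg_eq_add]

theorem calC_apply (u : ℂ) (v : P.Space) (h : P.Conf) (a : ℤ) :
    P.calC u v (h, a) = ∑ k, P.opC u (P.tval a) h k * v (k, a - 1) := by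
  rw [calC, Module.End.mul_apply, substTau_apply]
  simp only [shiftT_apply]

theorem tval_neg_deg (h : P.Conf) : P.tval (-(deg h : ℤ)) = P.tconf h := by
  rw [tval, tconf]; push_cast; ring

theorem opB_eq_zero {u t : ℂ} {h k : P.Conf} (hne : deg h ≠ deg k + 1) : P.opB u t h k = 0 := by
  rw [opB, Matrix.of_apply, monodromy_eq_path, P.path_eq_zero]
  simp only [deg] at hne
  simp; omega

theorem opC_eq_zero {u t : ℂ} {h k : P.Conf} (hne : deg k ≠ deg h + 1) : P.opC u t h k = 0 := by
  rw [opC, Matrix.of_apply, monodromy_eq_path, P.path_eq_zero]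
  simp only [deg] at hne
  simp; omega

theorem restrict_calB (u : ℂ) (v : P.Space) :
    P.restrict (P.calB u v) = P.opM 0 1 u *ᵥ P.restrict v := by
  funext h
  rw [restrict, calB_apply]
  refine Finset.sum_congr rfl fun k _ => ?_
  by_cases hk : deg h = deg k + 1
  · have e1 : P.opB u (P.tval (-(deg h : ℤ))) h k = P.opM 0 1 u h k := by
      rw [opB, Matrix.of_apply, monodromy_eq_path, tval_neg_deg]; rfl
    have e2 : -(deg h : ℤ) + 1 = -(deg k : ℤ) := by rw [hk]; push_cast; ring
    rw [e1, e2, restrict]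
  · have e : P.opM 0 1 u h k = 0 := P.opM_eq_zero (by simp; omega)
    change _ = P.opM 0 1 u h k * P.restrict v k
    rw [P.opB_eq_zero hk, e, zero_mul, zero_mul]

theorem restrict_calC (u : ℂ) (v : P.Space) :
    P.restrict (P.calC u v) = P.opM 1 0 u *ᵥ P.restrict v := by
  funext h
  rw [restrict, calC_apply]
  refine Finset.sum_congr rfl fun k _ => ?_
  by_cases hk : deg k = deg h + 1
  · have e1 : P.opC u (P.tval (-(deg h : ℤ))) h k = P.opM 1 0 u h k := by
      rw [opC, Matrix.of_apply, monodromy_eq_path, tval_neg_deg]; rfl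
    have e2 : -(deg h : ℤ) - 1 = -(deg k : ℤ) := by rw [hk]; push_cast; ring
    rw [e1, e2, restrict]
  · have e : P.opM 1 0 u h k = 0 := P.opM_eq_zero (by simp; omega)
    change _ = P.opM 1 0 u h k * P.restrict v k
    rw [P.opC_eq_zero hk, e, zero_mul, zero_mul]

theorem calB_embed (u : ℂ) (w : P.Conf → ℂ) : P.calB u (P.embed w) = P.embed (P.opM 0 1 u *ᵥ w) := by
  rw [P.eq_embed_restrict (v := P.calB u (P.embed w)), restrict_calB, restrict_embed]
  intro h a ha
  rw [calB_apply]
  refine Finset.sum_eq_zero fun k _ => ?_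
  by_cases hk : deg h = deg k + 1
  · rw [embed_apply, if_neg (by omega), mul_zero]
  · rw [P.opB_eq_zero hk, zero_mul]

theorem calC_embed (u : ℂ) (w : P.Conf → ℂ) : P.calC u (P.embed w) = P.embed (P.opM 1 0 u *ᵥ w) := by
  rw [P.eq_embed_restrict (v := P.calC u (P.embed w)), restrict_calC, restrict_embed]
  intro h a ha
  rw [calC_apply]
  refine Finset.sum_eq_zero fun k _ => ?_
  by_cases hk : deg k = deg h + 1
  · rw [embed_apply, if_neg (by omega), mul_zero]
  · rw [P.opC_eq_zero hk, zero_mul]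

theorem embedDual_comp_calB (u : ℂ) (φ : P.Conf → ℂ) :
    (P.embedDual φ).comp (P.calB u) = P.embedDual (φ ᵥ* P.opM 0 1 u) := by
  refine LinearMap.ext fun v => ?_
  rw [LinearMap.comp_apply, embedDual_apply, restrict_calB, Matrix.dotProduct_mulVec,
    ← embedDual_apply]

theorem embedDual_comp_calC (u : ℂ) (φ : P.Conf → ℂ) :
    (P.embedDual φ).comp (P.calC u) = P.embedDual (φ ᵥ* P.opM 1 0 u) := by
  refine LinearMap.ext fun v => ?_
  rw [LinearMap.comp_apply, embedDual_apply, restrict_calC, Matrix.dotProduct_mulVec,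
    ← embedDual_apply]

theorem transfer_embed (κ u : ℂ) (w : P.Conf → ℂ) :
    P.transfer κ u (P.embed w) = P.embed (P.transferMatrix κ u *ᵥ w) := by
  rw [transfer, transferMatrix, LinearMap.add_apply, LinearMap.smul_apply, LinearMap.smul_apply,
    calB_embed, calC_embed, Matrix.add_mulVec, Matrix.smul_mulVec, Matrix.smul_mulVec, map_add,
    map_smul, map_smul]

theorem dualMap_transfer_embedDual (κ u : ℂ) (φ : P.Conf → ℂ) :
    (P.transfer κ u).dualMap (P.embedDual φ) = P.embedDual (φ ᵥ* P.transferMatrix κ u) := by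
  change (P.embedDual φ).comp (P.transfer κ u) = _
  rw [transfer, transferMatrix, LinearMap.comp_add, LinearMap.comp_smul, LinearMap.comp_smul,
    embedDual_comp_calB, embedDual_comp_calC, Matrix.vecMul_add, Matrix.vecMul_smul,
    Matrix.vecMul_smul, map_add, map_smul, map_smul]

/-! ### The spaces of states -/

/-- On a basis state the eigenvalue differs from `sector` by a multiple of `a + deg h`, so for `η ≠
0` the sector is singled out by `a = -deg h`. -/
theorem spinTau_apply (v : P.Space) (h : P.Conf) (a : ℤ) :
    P.spinTau v (h, a) = (P.sector - 2 * P.η * (a + deg h)) * v (h, a) := by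
  rw [spinTau, LinearMap.add_apply, LinearMap.smul_apply, LinearMap.smul_apply, Finsupp.add_apply,
    Finsupp.smul_apply, Finsupp.smul_apply, spin, tau, substTau_apply, substTau_apply,
    Finset.sum_eq_single h (fun k _ hk => by rw [Matrix.diagonal_apply_ne _ hk.symm, zero_mul])
      (by simp),
    Finset.sum_eq_single h (fun k _ hk => by simp [Matrix.one_apply_ne hk.symm]) (by simp),
    Matrix.diagonal_apply_eq, Matrix.smul_apply, Matrix.one_apply_eq, sum_sz, sector]
  simp only [smul_eq_mul, tval, t0]
  ring

/-- A choice of coefficients of the factorized states. -/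
theorem exists_coeffs (t : ℂ → ℂ) : ∃ q : Fin P.N → Fin 2 → ℂ, ∀ a, q a 0 ≠ 0 ∧
    q a 1 / q a 0 = P.fd (P.ξ a - P.η) / t (P.ξ a - P.η) :=
  ⟨fun a => ![1, P.fd (P.ξ a - P.η) / t (P.ξ a - P.η)], fun a => by simp⟩

namespace IsAdmissible

variable {P} (hP : P.IsAdmissible)
include hP

theorem eta_ne_zero : P.η ≠ 0 := fun h => hP.eta_notMem (h ▸ zero_mem_periodLattice P.ω)

theorem coeff_eq_zero {a : ℤ} {h : P.Conf} (ha : a ≠ -(deg h : ℤ)) {c : ℂ}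
    (hc : (P.sector - 2 * P.η * (a + deg h)) * c = P.sector * c) : c = 0 := by
  have h1 : 2 * P.η * (a + deg h) * c = 0 := by linear_combination -hc
  refine (mul_eq_zero.mp h1).resolve_left (mul_ne_zero (mul_ne_zero two_ne_zero hP.eta_ne_zero) ?_)
  intro h0
  have : a + (deg h : ℤ) = 0 := by exact_mod_cast h0
  omega

theorem rightSpace_eq : P.rightSpace = LinearMap.range P.embed := by
  ext v
  rw [rightSpace, Module.End.mem_eigenspace_iff]
  constructor
  · intro hv
    refine ⟨P.restrict v, (P.eq_embed_restrict fun h a ha => ?_).symm⟩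
    have := DFunLike.congr_fun hv (h, a)
    rw [spinTau_apply, Finsupp.smul_apply, smul_eq_mul] at this
    exact hP.coeff_eq_zero ha this
  · rintro ⟨w, rfl⟩
    ext ⟨h, a⟩
    rw [spinTau_apply, Finsupp.smul_apply, smul_eq_mul, embed_apply]
    split_ifs with ha
    · subst ha; push_cast; ring
    · ring

theorem leftSpace_eq : P.leftSpace = LinearMap.range P.embedDual := by
  ext φ
  rw [leftSpace, Submodule.mem_inf, Module.End.mem_eigenspace_iff]
  constructor
  · rintro ⟨-, hφ⟩
    refine ⟨fun h => φ (Finsupp.single (h, -(deg h : ℤ)) 1), ?_⟩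
    refine Finsupp.lhom_ext' fun p => LinearMap.ext_ring ?_
    obtain ⟨h, a⟩ := p
    simp only [LinearMap.comp_apply, Finsupp.lsingle_apply, embedDual_apply]
    have e1 : P.spinTau (Finsupp.single (h, a) 1) =
        (P.sector - 2 * P.η * (a + deg h)) • Finsupp.single (h, a) 1 := by
      ext ⟨k, b⟩
      rw [spinTau_apply, Finsupp.smul_apply, smul_eq_mul]
      by_cases hk : (h, a) = (k, b)
      · cases hk; rfl
      · rw [Finsupp.single_apply, if_neg hk, mul_zero, mul_zero]
    by_cases ha : a = -(deg h : ℤ)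
    · subst ha
      rw [dotProduct, Finset.sum_eq_single h]
      · simp [restrict]
      · intro k _ hk
        simp [restrict, hk.symm]
      · simp
    · have e2 := LinearMap.congr_fun hφ (Finsupp.single (h, a) 1)
      rw [LinearMap.dualMap_apply, e1, map_smul, LinearMap.smul_apply, smul_eq_mul,
        smul_eq_mul] at e2
      rw [hP.coeff_eq_zero ha e2]
      refine Finset.sum_eq_zero fun k _ => ?_
      rw [restrict, Finsupp.single_apply, if_neg, mul_zero]
      intro hk
      cases hk
      exact ha rfl
  · rintro ⟨w, rfl⟩
    refine ⟨?_, ?_⟩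
    · rw [embedDual, Fintype.linearCombination_apply]
      exact Submodule.sum_mem _ fun h _ =>
        Submodule.smul_mem _ _ (Submodule.subset_span ⟨_, rfl⟩)
    · refine LinearMap.ext fun v => ?_
      rw [LinearMap.dualMap_apply, LinearMap.smul_apply, embedDual_apply, embedDual_apply,
        ← dotProduct_smul]
      congr 1
      funext h
      rw [restrict, spinTau_apply, Pi.smul_apply, restrict, smul_eq_mul]
      push_cast
      ring

theorem finrank_rightSpace : Module.finrank ℂ P.rightSpace = 2 ^ P.N := by
  rw [hP.rightSpace_eq, LinearMap.finrank_range_of_inj P.embed_injective,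
    Module.finrank_fintype_fun_eq_card]
  simp

theorem finrank_leftSpace : Module.finrank ℂ P.leftSpace = 2 ^ P.N := by
  rw [hP.leftSpace_eq, LinearMap.finrank_range_of_inj P.embedDual_injective,
    Module.finrank_fintype_fun_eq_card]
  simp

theorem mem_rightEigenspace_iff {κ : ℂ} {t : ℂ → ℂ} {v : P.Space} : v ∈ P.rightEigenspace κ t ↔
    ∃ w, (∀ u, P.transferMatrix κ u *ᵥ w = t u • w) ∧ P.embed w = v := by
  rw [rightEigenspace, Submodule.mem_inf, Submodule.mem_iInf, hP.rightSpace_eq]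
  simp only [Module.End.mem_eigenspace_iff]
  constructor
  · rintro ⟨⟨w, rfl⟩, hw⟩
    refine ⟨w, fun u => P.embed_injective ?_, rfl⟩
    rw [← transfer_embed, hw, map_smul]
  · rintro ⟨w, hw, rfl⟩
    exact ⟨⟨w, rfl⟩, fun u => by rw [transfer_embed, hw, map_smul]⟩

theorem mem_leftEigenspace_iff {κ : ℂ} {t : ℂ → ℂ} {φ : Module.Dual ℂ P.Space} :
    φ ∈ P.leftEigenspace κ t ↔
      ∃ w, (∀ u, w ᵥ* P.transferMatrix κ u = t u • w) ∧ P.embedDual w = φ := by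
  rw [leftEigenspace, Submodule.mem_inf, Submodule.mem_iInf, hP.leftSpace_eq]
  simp only [Module.End.mem_eigenspace_iff]
  constructor
  · rintro ⟨⟨w, rfl⟩, hw⟩
    refine ⟨w, fun u => P.embedDual_injective ?_, rfl⟩
    rw [← dualMap_transfer_embedDual, hw, map_smul]
  · rintro ⟨w, hw, rfl⟩
    exact ⟨⟨w, rfl⟩, fun u => by rw [dualMap_transfer_embedDual, hw, map_smul]⟩

theorem mem_rightSpectrum_iff {κ : ℂ} {t : ℂ → ℂ} : t ∈ P.rightSpectrum κ ↔
    ∃ w : P.Conf → ℂ, w ≠ 0 ∧ ∀ u, P.transferMatrix κ u *ᵥ w = t u • w := by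
  rw [rightSpectrum, Set.mem_ofPred_eq, Submodule.ne_bot_iff]
  constructor
  · rintro ⟨v, hv, hv0⟩
    obtain ⟨w, hw, rfl⟩ := hP.mem_rightEigenspace_iff.mp hv
    exact ⟨w, fun h => hv0 (by rw [h, map_zero]), hw⟩
  · rintro ⟨w, hw0, hw⟩
    exact ⟨_, hP.mem_rightEigenspace_iff.mpr ⟨w, hw, rfl⟩,
      fun h => hw0 (P.embed_injective (by rw [h, map_zero]))⟩

theorem mem_leftSpectrum_iff {κ : ℂ} {t : ℂ → ℂ} : t ∈ P.leftSpectrum κ ↔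
    ∃ w : P.Conf → ℂ, w ≠ 0 ∧ ∀ u, w ᵥ* P.transferMatrix κ u = t u • w := by
  rw [leftSpectrum, Set.mem_ofPred_eq, Submodule.ne_bot_iff]
  constructor
  · rintro ⟨v, hv, hv0⟩
    obtain ⟨w, hw, rfl⟩ := hP.mem_leftEigenspace_iff.mp hv
    exact ⟨w, fun h => hv0 (by rw [h, map_zero]), hw⟩
  · rintro ⟨w, hw0, hw⟩
    exact ⟨_, hP.mem_leftEigenspace_iff.mpr ⟨w, hw, rfl⟩,
      fun h => hw0 (P.embedDual_injective (by rw [h, map_zero]))⟩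

/-- Only commutativity and finite dimension enter, so the equality holds for arbitrary
inhomogeneities; the converse direction uses the transposed family. -/
theorem leftSpectrum_eq_rightSpectrum {κ : ℂ} (hκ : κ ≠ 0) :
    P.leftSpectrum κ = P.rightSpectrum κ := by
  ext t
  rw [hP.mem_leftSpectrum_iff, hP.mem_rightSpectrum_iff]
  constructor
  · rintro ⟨w, hw0, hw⟩
    obtain ⟨φ, hφ0, hφ⟩ := exists_left_eigenvector
      (M := fun u => (P.transferMatrix κ u)ᵀ)
      (fun u v => by
        rw [Commute, SemiconjBy, ← Matrix.transpose_mul, ← Matrix.transpose_mul,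
          (P.commute_transferMatrix hP hκ u v).eq])
      hw0 (t := t) (fun u => by rw [Matrix.mulVec_transpose, hw])
    exact ⟨φ, hφ0, fun u => by rw [← Matrix.vecMul_transpose, hφ]⟩
  · rintro ⟨w, hw0, hw⟩
    exact exists_left_eigenvector (fun u v => P.commute_transferMatrix hP hκ u v) hw0 hw

theorem rightSpectrum_eq {κ κ' : ℂ} (hκ : κ ≠ 0) (hκ' : κ' ≠ 0) :
    P.rightSpectrum κ = P.rightSpectrum κ' := by
  ext t
  rw [hP.mem_rightSpectrum_iff, hP.mem_rightSpectrum_iff]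
  exact ⟨exists_right_eigenvector_rescale hκ hκ', exists_right_eigenvector_rescale hκ' hκ⟩

end IsAdmissible

/-! ### The SOV states -/

theorem embedDual_comp_list_prod {α : Type*} {F : α → Module.End ℂ P.Space}
    {G : α → Matrix P.Conf P.Conf ℂ}
    (hFG : ∀ a φ, (P.embedDual φ).comp (F a) = P.embedDual (φ ᵥ* G a)) (l : List α)
    (φ : P.Conf → ℂ) :
    (P.embedDual φ).comp (l.map F).prod = P.embedDual (φ ᵥ* (l.map G).prod) := by
  induction l generalizing φ with
  | nil => simp [Module.End.one_eq_id]
  | cons a l ih =>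
    rw [List.map_cons, List.map_cons, List.prod_cons, List.prod_cons, ← Matrix.vecMul_vecMul, ← ih,
      ← hFG]
    rfl

theorem list_prod_embed {α : Type*} {F : α → Module.End ℂ P.Space}
    {G : α → Matrix P.Conf P.Conf ℂ}
    (hFG : ∀ a w, F a (P.embed w) = P.embed (G a *ᵥ w)) (l : List α) (w : P.Conf → ℂ) :
    (l.map F).prod (P.embed w) = P.embed ((l.map G).prod *ᵥ w) := by
  induction l with
  | nil => simp
  | cons a l ih =>
    rw [List.map_cons, List.map_cons, List.prod_cons, List.prod_cons, ← Matrix.mulVec_mulVec, ← hFG,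
      ← ih]
    rfl

theorem leftState_eq (ν : ℂ) (h : P.Conf) : P.leftState ν h = P.embedDual (P.leftVec ν h) := by
  have e : P.leftRef ν = P.embedDual (ν⁻¹ • Pi.single (0 : P.Conf) (1 : ℂ)) := by
    have h0 : deg (0 : P.Conf) = 0 := by simp [deg]
    rw [map_smul, embedDual, Fintype.linearCombination_apply_single, h0, one_smul]
    rfl
  rw [leftState, leftVec, e, List.ofFn_eq_map, List.ofFn_eq_map]
  refine P.embedDual_comp_list_prod (fun n φ => ?_) _ _
  rcases (show h n = 0 ∨ h n = 1 by omega) with hn | hn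
  · simp [hn, Module.End.one_eq_id]
  · simp only [hn, Fin.isValue, Fin.coe_ofNat_eq_mod, Nat.one_mod, pow_one]
    rw [LinearMap.comp_smul, embedDual_comp_calC, Matrix.vecMul_smul, map_smul]

theorem rightState_eq (ν : ℂ) (h : P.Conf) : P.rightState ν h = P.embed (P.rightVec ν h) := by
  have e : P.rightRef ν = P.embed (ν⁻¹ • Pi.single (1 : P.Conf) (1 : ℂ)) := by
    have h1 : deg (1 : P.Conf) = P.N := by simp [deg]
    rw [map_smul, embed, Fintype.linearCombination_apply_single, h1, one_smul]
    rfl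
  rw [rightState, rightVec, e, List.ofFn_eq_map, List.ofFn_eq_map]
  refine P.list_prod_embed (fun n w => ?_) _ _
  rcases (show h n = 0 ∨ h n = 1 by omega) with hn | hn
  · simp only [hn, Fin.isValue, Fin.coe_ofNat_eq_mod, Nat.zero_mod, tsub_zero, pow_one]
    rw [LinearMap.smul_apply, calC_embed, Matrix.smul_mulVec, map_smul]
  · simp [hn]

theorem rightPsi_eq (ν κ : ℂ) (q : Fin P.N → Fin 2 → ℂ) :
    P.rightPsi ν κ q = P.embed (P.rightPsiVec ν κ q) := by
  simp only [rightPsi, rightPsiVec, map_sum, map_smul, rightState_eq]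

theorem leftPsi_eq (ν κ : ℂ) (q : Fin P.N → Fin 2 → ℂ) :
    P.leftPsi ν κ q = P.embedDual (P.leftPsiVec ν κ q) := by
  simp only [leftPsi, leftPsiVec, map_sum, map_smul, leftState_eq]

namespace IsAdmissible

variable {P} (hP : P.IsAdmissible) (hI : P.InhomogeneityCondition) (hN : 0 < P.N)
include hP hI hN

theorem rightPsi_spec {ν κ : ℂ} (hν : ν ≠ 0) (hκ : κ ≠ 0) {t : ℂ → ℂ}
    (ht : t ∈ P.discreteSolutions) {q : Fin P.N → Fin 2 → ℂ} (hq : ∀ a, q a 0 ≠ 0 ∧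
      q a 1 / q a 0 = P.fd (P.ξ a - P.η) / t (P.ξ a - P.η)) :
    P.rightPsi ν κ q ≠ 0 ∧ P.rightEigenspace κ t = Submodule.span ℂ {P.rightPsi ν κ q} := by
  obtain ⟨h1, h2, h3⟩ := hP.rightPsiVec_spec hI hN hν hκ ht hq
  rw [rightPsi_eq]
  refine ⟨fun h => h1 (P.embed_injective (by rw [h, map_zero])), ?_⟩
  ext v
  rw [hP.mem_rightEigenspace_iff, Submodule.mem_span_singleton]
  constructor
  · rintro ⟨w, hw, rfl⟩
    obtain ⟨c, rfl⟩ := h3 w hw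
    exact ⟨c, by rw [map_smul]⟩
  · rintro ⟨c, rfl⟩
    exact ⟨c • _, fun u => by rw [Matrix.mulVec_smul, h2, smul_comm], by rw [map_smul]⟩

theorem leftPsi_spec {ν κ : ℂ} (hν : ν ≠ 0) (hκ : κ ≠ 0) {t : ℂ → ℂ}
    (ht : t ∈ P.discreteSolutions) {q : Fin P.N → Fin 2 → ℂ} (hq : ∀ a, q a 0 ≠ 0 ∧
      q a 1 / q a 0 = P.fd (P.ξ a - P.η) / t (P.ξ a - P.η)) :
    P.leftPsi ν κ q ≠ 0 ∧ P.leftEigenspace κ t = Submodule.span ℂ {P.leftPsi ν κ q} := by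
  obtain ⟨h1, h2, h3⟩ := hP.leftPsiVec_spec hI hN hν hκ ht hq
  rw [leftPsi_eq]
  refine ⟨fun h => h1 (P.embedDual_injective (by rw [h, map_zero])), ?_⟩
  ext v
  rw [hP.mem_leftEigenspace_iff, Submodule.mem_span_singleton]
  constructor
  · rintro ⟨w, hw, rfl⟩
    obtain ⟨c, rfl⟩ := h3 w hw
    exact ⟨c, by rw [map_smul]⟩
  · rintro ⟨c, rfl⟩
    exact ⟨c • _, fun u => by rw [Matrix.smul_vecMul, h2, smul_comm], by rw [map_smul]⟩

theorem rightSpectrum_eq_discreteSolutions {κ : ℂ} (hκ : κ ≠ 0) :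
    P.rightSpectrum κ = P.discreteSolutions := by
  ext t
  rw [hP.mem_rightSpectrum_iff]
  constructor
  · rintro ⟨w, hw0, hw⟩
    exact hP.mem_discreteSolutions_of_right hI hκ hw0 hw
  · intro ht
    obtain ⟨q, hq⟩ := P.exists_coeffs t
    obtain ⟨h1, h2, -⟩ := hP.rightPsiVec_spec hI hN one_ne_zero hκ ht hq
    exact ⟨_, h1, h2⟩

end IsAdmissible

end Model
end
end SOS

theorem mainTheorem1 (P : SOS.Model) (hN : 0 < P.N)
    (hx : P.x = 0 ∨ P.x = 1) (hy : P.y = 0 ∨ P.y = 1)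
    (hω : 0 < P.ω.im)
    -- the crossing parameter is generic, and the R-matrix is non-singular on `t₀ + ηℤ`
    (hη : P.η ∉ SOS.periodLattice P.ω)
    (ht : ∀ k : ℤ, P.t0 + k * P.η ∉ SOS.periodLattice P.ω) :
    -- the spaces of states have dimension `2^N`
    (Module.finrank ℂ P.rightSpace = 2 ^ P.N ∧ Module.finrank ℂ P.leftSpace = 2 ^ P.N) ∧
    -- commuting families of operators on the spaces of states
    (∀ κ : ℂ, κ ≠ 0 →
      (∀ u, ∀ v ∈ P.rightSpace, P.transfer κ u v ∈ P.rightSpace) ∧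
      (∀ u, ∀ φ ∈ P.leftSpace, (P.transfer κ u).dualMap φ ∈ P.leftSpace) ∧
      (∀ u u', ∀ v ∈ P.rightSpace,
        P.transfer κ u (P.transfer κ u' v) = P.transfer κ u' (P.transfer κ u v)) ∧
      (∀ u u', ∀ φ ∈ P.leftSpace,
        (P.transfer κ u).dualMap ((P.transfer κ u').dualMap φ) =
          (P.transfer κ u').dualMap ((P.transfer κ u).dualMap φ))) ∧
    -- isospectrality
    (∀ κ κ' : ℂ, κ ≠ 0 → κ' ≠ 0 →
      P.rightSpectrum κ = P.rightSpectrum κ' ∧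
      P.leftSpectrum κ = P.leftSpectrum κ' ∧
      P.leftSpectrum κ = P.rightSpectrum κ) ∧
    (P.InhomogeneityCondition → ∀ κ : ℂ, κ ≠ 0 →
      -- the spectrum is simple
      (∀ t ∈ P.rightSpectrum κ, Module.finrank ℂ (P.rightEigenspace κ t) = 1) ∧
      (∀ t ∈ P.leftSpectrum κ, Module.finrank ℂ (P.leftEigenspace κ t) = 1) ∧
      -- characterization of the spectrum
      P.rightSpectrum κ = P.discreteSolutions ∧
      P.leftSpectrum κ = P.discreteSolutions ∧
      -- the eigenstates
      ∀ t ∈ P.rightSpectrum κ,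
        (∀ a, t (P.ξ a - P.η) ≠ 0 ∧ P.fd (P.ξ a - P.η) ≠ 0 ∧ P.faxy (P.ξ a) ≠ 0 ∧
          P.fd (P.ξ a - P.η) / t (P.ξ a - P.η) = t (P.ξ a) / P.faxy (P.ξ a)) ∧
        ∀ (ν : ℂ) (q : Fin P.N → Fin 2 → ℂ), ν ≠ 0 →
          (∀ a, q a 0 ≠ 0 ∧ q a 1 / q a 0 = P.fd (P.ξ a - P.η) / t (P.ξ a - P.η)) →
          P.rightPsi ν κ q ≠ 0 ∧
          P.rightEigenspace κ t = Submodule.span ℂ {P.rightPsi ν κ q} ∧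
          P.leftPsi ν κ q ≠ 0 ∧
          P.leftEigenspace κ t = Submodule.span ℂ {P.leftPsi ν κ q}) := by
  have hP : P.IsAdmissible := ⟨hx, hy, hω, hη, ht⟩
  refine ⟨⟨hP.finrank_rightSpace, hP.finrank_leftSpace⟩, fun κ hκ => ?_, fun κ κ' hκ hκ' => ?_,
    fun hI κ hκ => ?_⟩
  · have hc (u u' : ℂ) := (P.commute_transferMatrix hP hκ u u').eq
    rw [hP.rightSpace_eq, hP.leftSpace_eq]
    refine ⟨?_, ?_, ?_, ?_⟩
    · rintro u _ ⟨w, rfl⟩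
      exact ⟨_, (P.transfer_embed κ u w).symm⟩
    · rintro u _ ⟨w, rfl⟩
      exact ⟨_, (P.dualMap_transfer_embedDual κ u w).symm⟩
    · rintro u u' _ ⟨w, rfl⟩
      simp only [SOS.Model.transfer_embed, Matrix.mulVec_mulVec, hc u u']
    · rintro u u' _ ⟨w, rfl⟩
      simp only [SOS.Model.dualMap_transfer_embedDual, Matrix.vecMul_vecMul, hc u u']
  · have h1 := hP.leftSpectrum_eq_rightSpectrum hκ
    have h2 := hP.rightSpectrum_eq hκ hκ'
    exact ⟨h2, by rw [h1, h2, hP.leftSpectrum_eq_rightSpectrum hκ'], h1⟩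
  · have hS := hP.rightSpectrum_eq_discreteSolutions hI hN hκ
    have hS' := (hP.leftSpectrum_eq_rightSpectrum hκ).trans hS
    rw [hS, hS']
    refine ⟨fun t ht => ?_, fun t ht => ?_, rfl, rfl, fun t ht => ⟨fun a => ?_, ?_⟩⟩
    · obtain ⟨q, hq⟩ := P.exists_coeffs t
      obtain ⟨h0, h1⟩ := hP.rightPsi_spec hI hN one_ne_zero hκ ht hq
      rw [h1, finrank_span_singleton h0]
    · obtain ⟨q, hq⟩ := P.exists_coeffs t
      obtain ⟨h0, h1⟩ := hP.leftPsi_spec hI hN one_ne_zero hκ ht hq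
      rw [h1, finrank_span_singleton h0]
    · obtain ⟨-, h1, h2⟩ := hP.quotient_eq hI ht a
      exact ⟨h1, hP.fd_ne_zero hI a, hP.faxy_ne_zero hI a, h2⟩
    · intro ν q hν hq
      obtain ⟨h0, h1⟩ := hP.rightPsi_spec hI hN hν hκ ht hq
      obtain ⟨h2, h3⟩ := hP.leftPsi_spec hI hN hν hκ ht hq
      exact ⟨h0, h1, h2, h3⟩
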